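/- Let $G$ be a real (finite-dimensional, smooth, not necessarily connected) Lie group which carries a left-invariant contact form, i.e. $\dim G = 2n+1$ and there is a left-invariant differential $1$-form $\eta$ on $G$ such that the $(2n+1)$-form $(d\eta)^n\wedge\eta$ vanishes at no point of $G$. Call a Riemannian metric flat if the curvature tensor of its Levi-Civita connection vanishes identically. (1) If $\dim G\ge 5$, then there is no flat left-invariant Riemannian metric on $G$ at all (the metric is not assumed to be related to the contact form in any way). (2) If $\dim G\ge 3$, then $G$ carries a flat left-invariant Riemannian metric if and only if $G$ is locally isomorphic to the group $E(2)=\mathbb R^2\rtimes O(2)$ of rigid motions of the Euclidean plane, i.e. if and only if there is a diffeomorphism $\varphi$ from an open neighbourhood $U$ of $1$ in $G$ onto an open neighbourhood of $1$ in $E(2)$ such that $\varphi(xy)=\varphi(x)\varphi(y)$ whenever $x,y,xy\in U$. -/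

import Mathlib

open scoped Manifold ContDiff Bundle Topology

noncomputable section

namespace ContactLie

section Manifolds

variable {E : Type*} [NormedAddCommGroup E] [NormedSpace ℝ E]
  {H : Type*} [TopologicalSpace H] (I : ModelWithCorners ℝ E H)
  {M : Type*} [TopologicalSpace M] [ChartedSpace H M] [IsManifold I ∞ M]

/-- The exterior derivative of a differential `1`-form `η`, evaluated at two tangent vectors `u`, `v`
at `p`: `dη(U, V) = U (η V) - V (η U) - η [U, V]`, where `U`, `V` are the canonical local extensions
of `u`, `v` to vector fields which are smooth near `p`. For a smooth form `η` the value does not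
depend on the choice of the extensions. -/
def extDerivOneForm (η : Π p : M, TangentSpace I p →L[ℝ] ℝ) (p : M) (u v : TangentSpace I p) : ℝ :=
  mvfderiv I (fun q ↦ η q (FiberBundle.extend E v q)) p u
    - mvfderiv I (fun q ↦ η q (FiberBundle.extend E u q)) p v
    - η p (VectorField.mlieBracket I (FiberBundle.extend E u) (FiberBundle.extend E v) p)

/-- The value at `p` of the `(2n+1)`-form `η ∧ (dη)ⁿ = (dη)ⁿ ∧ η` on the tangent vectors
`v 0, …, v (2n)`. -/
def contactVolume (n : ℕ) (η : Π p : M, TangentSpace I p →L[ℝ] ℝ) (p : M)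
    (v : Fin (2 * n + 1) → TangentSpace I p) : ℝ :=
  ((2 : ℝ) ^ n)⁻¹ * ∑ σ : Equiv.Perm (Fin (2 * n + 1)), ((Equiv.Perm.sign σ : ℤ) : ℝ) *
    (η p (v (σ 0)) * ∏ i : Fin n, extDerivOneForm I η p
      (v (σ ⟨2 * (i : ℕ) + 1, by omega⟩)) (v (σ ⟨2 * (i : ℕ) + 2, by omega⟩)))

/-- `η` is a contact form on a manifold of dimension `2n+1`: the `(2n+1)`-form `(dη)ⁿ ∧ η` vanishes
at no point. (Smoothness of `η` is not part of this predicate; the forms to which it is applied below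
are left invariant, hence smooth.) -/
def IsContactForm (n : ℕ) (η : Π p : M, TangentSpace I p →L[ℝ] ℝ) : Prop :=
  Module.finrank ℝ E = 2 * n + 1 ∧ ∀ p : M, ∃ v, contactVolume I n η p v ≠ 0

variable {I}

/-- `cov` is a Levi-Civita connection of the Riemannian metric `g`: it is torsion-free,
`∇_X Y - ∇_Y X = [X, Y]`, and metric, `X ⟨Y, Z⟩ = ⟨∇_X Y, Z⟩ + ⟨Y, ∇_X Z⟩`.
Here `cov Y x (X x)` is the value of `∇_X Y` at `x`. -/
structure IsLeviCivita
    (g : Bundle.ContMDiffRiemannianMetric I ∞ E (TangentSpace I : M → Type _))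
    (cov : CovariantDerivative I E (TangentSpace I : M → Type _)) : Prop where
  torsion_free : ∀ (X Y : Π x : M, TangentSpace I x) (x : M),
    MDiffAt (T% X) x → MDiffAt (T% Y) x →
      cov Y x (X x) - cov X x (Y x) = VectorField.mlieBracket I X Y x
  metric : ∀ (X Y Z : Π x : M, TangentSpace I x) (x : M),
    MDiffAt (T% X) x → MDiffAt (T% Y) x → MDiffAt (T% Z) x →
      mvfderiv I (fun y ↦ g.inner y (Y y) (Z y)) x (X x) =
        g.inner x (cov Y x (X x)) (Z x) + g.inner x (Y x) (cov Z x (X x))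

/-- The curvature `R(X, Y) Z = ∇_X ∇_Y Z - ∇_Y ∇_X Z - ∇_[X, Y] Z` at the point `x`. -/
def curvature (cov : CovariantDerivative I E (TangentSpace I : M → Type _))
    (X Y Z : Π x : M, TangentSpace I x) (x : M) : TangentSpace I x :=
  cov (fun y ↦ cov Z y (Y y)) x (X x) - cov (fun y ↦ cov Z y (X y)) x (Y x)
    - cov Z x (VectorField.mlieBracket I X Y x)

/-- The Riemannian metric `g` is flat: the curvature of its (unique) Levi-Civita connection
vanishes. -/
def IsFlat (g : Bundle.ContMDiffRiemannianMetric I ∞ E (TangentSpace I : M → Type _)) : Prop :=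
  ∃ cov : CovariantDerivative I E (TangentSpace I : M → Type _), IsLeviCivita g cov ∧
    ∀ X Y Z : Π x : M, TangentSpace I x, CMDiff ∞ (T% X) → CMDiff ∞ (T% Y) → CMDiff ∞ (T% Z) →
      ∀ x, curvature cov X Y Z x = 0

end Manifolds

section LieGroups

variable {E : Type*} [NormedAddCommGroup E] [NormedSpace ℝ E]
  {H : Type*} [TopologicalSpace H] (I : ModelWithCorners ℝ E H)
  (G : Type*) [TopologicalSpace G] [ChartedSpace H G] [Group G] [LieGroup I ∞ G]

/-- The Lie group `G` carries a left invariant contact form, i.e. it is (the group underlying)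
a contact Lie group. -/
def HasLeftInvariantContactForm : Prop :=
  ∃ (n : ℕ) (η : Π p : G, TangentSpace I p →L[ℝ] ℝ),
    (∀ (a x : G) (u : TangentSpace I x), η (a * x) (mfderiv I I (a * ·) x u) = η x u) ∧
      IsContactForm I n η

/-- The Lie group `G` carries a left invariant Riemannian metric which is flat. -/
def HasFlatLeftInvariantMetric : Prop :=
  ∃ g : Bundle.ContMDiffRiemannianMetric I ∞ E (TangentSpace I : G → Type _),
    (∀ (a x : G) (u v : TangentSpace I x),
      g.inner (a * x) (mfderiv I I (a * ·) x u) (mfderiv I I (a * ·) x v) = g.inner x u v) ∧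
      IsFlat g

end LieGroups

/-- Two Lie groups are locally isomorphic: there is a diffeomorphism from an open neighbourhood of
`1` in `G` onto an open neighbourhood of `1` in `G'` which is compatible with the multiplications
wherever the product stays in the neighbourhood (in particular, it maps `1` to `1`). -/
def LocallyIsomorphic
    {E : Type*} [NormedAddCommGroup E] [NormedSpace ℝ E]
    {H : Type*} [TopologicalSpace H] (I : ModelWithCorners ℝ E H)
    {E' : Type*} [NormedAddCommGroup E'] [NormedSpace ℝ E']
    {H' : Type*} [TopologicalSpace H'] (I' : ModelWithCorners ℝ E' H')
    (G : Type*) [TopologicalSpace G] [ChartedSpace H G] [Group G]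
    (G' : Type*) [TopologicalSpace G'] [ChartedSpace H' G'] [Group G'] : Prop :=
  ∃ φ : OpenPartialHomeomorph G G', (1 : G) ∈ φ.source ∧
    ContMDiffOn I I' ∞ φ φ.source ∧ ContMDiffOn I' I ∞ φ.symm φ.target ∧
    ∀ x ∈ φ.source, ∀ y ∈ φ.source, x * y ∈ φ.source → φ (x * y) = φ x * φ y

/-! ### The group `E(2) = ℝ² ⋊ O(2)` of rigid motions of the Euclidean plane -/

/-- The identity of `ℂ` for `ε = 1`, complex conjugation for `ε = -1`. -/
def signConj (ε : ℤˣ) (w : ℂ) : ℂ := if ε = 1 then w else (starRingEnd ℂ) w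

lemma signConj_eq (ε : ℤˣ) (w : ℂ) :
    signConj ε w = (w.re : ℂ) + (((ε : ℤ) : ℝ) : ℂ) * (w.im : ℂ) * Complex.I := by
  rcases Int.units_eq_one_or ε with rfl | rfl <;> apply Complex.ext <;> simp [signConj]

lemma coe_zpow_unit (ε : ℤˣ) (b : Circle) : ((b ^ (ε : ℤ) : Circle) : ℂ) = signConj ε b := by
  rcases Int.units_eq_one_or ε with rfl | rfl
  · simp [signConj]
  · simp [signConj, ← Circle.coe_inv_eq_conj]

lemma signConj_add (ε : ℤˣ) (w z : ℂ) : signConj ε (w + z) = signConj ε w + signConj ε z := by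
  unfold signConj; split_ifs <;> simp

lemma signConj_mul (ε : ℤˣ) (w z : ℂ) : signConj ε (w * z) = signConj ε w * signConj ε z := by
  unfold signConj; split_ifs <;> simp

lemma signConj_signConj (ε δ : ℤˣ) (w : ℂ) :
    signConj ε (signConj δ w) = signConj (ε * δ) w := by
  rcases Int.units_eq_one_or ε with rfl | rfl <;> rcases Int.units_eq_one_or δ with rfl | rfl <;>
    simp [signConj]

/-- The group `E(2) = ℝ² ⋊ O(2)`, the plane `ℝ²` being identified with `ℂ`. The element `(z, a, ε)`
stands for the motion `w ↦ z + a * signConj ε w`: the pair `(a, ε)`, with `a` on the unit circle and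
`ε = ±1`, is the element `w ↦ a * w` or `w ↦ a * conj w` of `O(2)`. -/
def E2 : Type := ℂ × Circle × ℤˣ

namespace E2

/-- The rigid motion of the plane given by an element of `E(2)`. -/
def act (g : E2) (w : ℂ) : ℂ := g.1 + (g.2.1 : ℂ) * signConj g.2.2 w

/-- The multiplication is the composition of motions. -/
instance : Mul E2 :=
  ⟨fun g h ↦ (g.1 + (g.2.1 : ℂ) * signConj g.2.2 h.1, g.2.1 * h.2.1 ^ (g.2.2 : ℤ), g.2.2 * h.2.2)⟩

instance : One E2 := ⟨((0 : ℂ), (1 : Circle), (1 : ℤˣ))⟩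

instance : Inv E2 :=
  ⟨fun g ↦ (-(signConj g.2.2 (((g.2.1⁻¹ : Circle) : ℂ) * g.1)), (g.2.1⁻¹) ^ (g.2.2 : ℤ), g.2.2)⟩

lemma ext' {g h : E2} (h1 : g.1 = h.1) (h2 : (g.2.1 : ℂ) = h.2.1) (h3 : g.2.2 = h.2.2) : g = h :=
  Prod.ext h1 (Prod.ext (Circle.ext h2) h3)

@[simp] lemma mul_fst (g h : E2) : (g * h).1 = g.1 + (g.2.1 : ℂ) * signConj g.2.2 h.1 := rfl
@[simp] lemma mul_snd_fst (g h : E2) : (g * h).2.1 = g.2.1 * h.2.1 ^ (g.2.2 : ℤ) := rfl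
@[simp] lemma mul_snd_snd (g h : E2) : (g * h).2.2 = g.2.2 * h.2.2 := rfl
@[simp] lemma one_fst : (1 : E2).1 = 0 := rfl
@[simp] lemma one_snd_fst : (1 : E2).2.1 = 1 := rfl
@[simp] lemma one_snd_snd : (1 : E2).2.2 = 1 := rfl
@[simp] lemma inv_fst (g : E2) :
    (g⁻¹).1 = -(signConj g.2.2 (((g.2.1⁻¹ : Circle) : ℂ) * g.1)) := rfl
@[simp] lemma inv_snd_fst (g : E2) : (g⁻¹).2.1 = (g.2.1⁻¹) ^ (g.2.2 : ℤ) := rfl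
@[simp] lemma inv_snd_snd (g : E2) : (g⁻¹).2.2 = g.2.2 := rfl

instance : Group E2 where
  mul_assoc f g h := by
    apply ext'
    · simp only [mul_fst, mul_snd_fst, mul_snd_snd, Circle.coe_mul, coe_zpow_unit, signConj_mul,
        signConj_add, signConj_signConj]; ring
    · simp only [mul_snd_fst, mul_snd_snd, Circle.coe_mul, coe_zpow_unit, signConj_mul,
        signConj_signConj]; ring
    · simp [mul_assoc]
  one_mul g := by
    apply ext'
    · simp [signConj]
    · simp
    · simp
  mul_one g := by
    apply ext'
    · simp [signConj]
    · simp
    · simp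
  inv_mul_cancel g := by
    apply ext'
    · simp only [mul_fst, inv_fst, inv_snd_fst, inv_snd_snd, coe_zpow_unit, signConj_mul, one_fst]
      ring
    · simp
    · simp

lemma act_mul (g h : E2) (w : ℂ) : act (g * h) w = act g (act h w) := by
  simp only [act, mul_fst, mul_snd_fst, mul_snd_snd, Circle.coe_mul, coe_zpow_unit, signConj_mul,
    signConj_add, signConj_signConj]
  ring

lemma isometry_act (g : E2) : Isometry (act g) := by
  refine Isometry.of_dist_eq fun w z ↦ ?_
  have h : act g w - act g z = (g.2.1 : ℂ) * signConj g.2.2 (w - z) := by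
    have := signConj_add g.2.2 (w - z) z
    rw [sub_add_cancel] at this
    simp only [act, this]; ring
  rw [dist_eq_norm, dist_eq_norm, h, norm_mul, Circle.norm_coe, one_mul]
  unfold signConj
  split_ifs
  · rfl
  · exact Complex.norm_conj _

/-- Every distance preserving bijection of the plane is given by exactly one element of `E(2)`. -/
lemma existsUnique_act (f : ℂ ≃ᵢ ℂ) : ∃! g : E2, ∀ w, act g w = f w := by
  have key : ∀ w, f w = f.toRealLinearIsometryEquiv w + f 0 := fun w ↦ by simp
  obtain ⟨a, ha⟩ := linear_isometry_complex f.toRealLinearIsometryEquiv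
  apply existsUnique_of_exists_of_unique
  · rcases ha with ha | ha
    · refine ⟨(f 0, a, 1), fun w ↦ ?_⟩
      rw [key w, ha]; simp [act, signConj, rotation_apply, add_comm]
    · refine ⟨(f 0, a, -1), fun w ↦ ?_⟩
      rw [key w, ha]; simp [act, signConj, rotation_apply, add_comm]
  · intro g h hg hh
    have H : ∀ w, act g w = act h w := fun w ↦ (hg w).trans (hh w).symm
    have h0 : g.1 = h.1 := by simpa [act, signConj] using H 0
    have h1 : (g.2.1 : ℂ) = h.2.1 := by simpa [act, signConj, h0] using H 1
    refine ext' h0 h1 ?_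
    have h2 : signConj g.2.2 Complex.I = signConj h.2.2 Complex.I := by
      simpa [act, h0, h1] using H Complex.I
    have h3 := congrArg Complex.im h2
    rcases Int.units_eq_one_or g.2.2 with e | e <;> rcases Int.units_eq_one_or h.2.2 with e' | e' <;>
      rw [e, e'] at h3 ⊢ <;> norm_num [signConj] at h3

/-- The two-point space `{1, -1}` as a manifold of dimension `0`. -/
instance instChartedSpaceIntUnits : ChartedSpace PUnit.{1} ℤˣ := ChartedSpace.ofDiscreteTopology

instance : TopologicalSpace E2 := inferInstanceAs (TopologicalSpace (ℂ × Circle × ℤˣ))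

/-- The smooth structure of `E(2)` is that of the product manifold `ℂ × S¹ × {1, -1}`. -/
instance : ChartedSpace (ModelProd ℂ (ModelProd (EuclideanSpace ℝ (Fin 1)) PUnit.{1})) E2 :=
  inferInstanceAs (ChartedSpace _ (ℂ × Circle × ℤˣ))

/-- The model with corners (without boundary) of the `3`-dimensional manifold `E(2)`. -/
abbrev model : ModelWithCorners ℝ (ℂ × EuclideanSpace ℝ (Fin 1) × PUnit.{1})
    (ModelProd ℂ (ModelProd (EuclideanSpace ℝ (Fin 1)) PUnit.{1})) :=
  𝓘(ℝ, ℂ).prod ((𝓡 1).prod 𝓘(ℝ, PUnit.{1}))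

instance instIsManifoldIntUnits : IsManifold 𝓘(ℝ, PUnit.{1}) ∞ ℤˣ :=
  IsManifold.of_discreteTopology _

instance : IsManifold model ∞ E2 := inferInstanceAs (IsManifold model ∞ (ℂ × Circle × ℤˣ))

section Smooth

variable {E : Type*} [NormedAddCommGroup E] [NormedSpace ℝ E]
  {H : Type*} [TopologicalSpace H] {I : ModelWithCorners ℝ E H}
  {M : Type*} [TopologicalSpace M] [ChartedSpace H M]

lemma contMDiff_mul_complex {f g : M → ℂ} (hf : ContMDiff I 𝓘(ℝ, ℂ) ∞ f)
    (hg : ContMDiff I 𝓘(ℝ, ℂ) ∞ g) : ContMDiff I 𝓘(ℝ, ℂ) ∞ (fun x ↦ f x * g x) :=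
  (contDiff_mul (𝕜 := ℝ) (𝔸 := ℂ) (n := ∞)).contMDiff.comp (hf.prodMk_space hg)

lemma contMDiff_signConj {e : M → ℤˣ} {f : M → ℂ} (he : ContMDiff I 𝓘(ℝ, PUnit.{1}) ∞ e)
    (hf : ContMDiff I 𝓘(ℝ, ℂ) ∞ f) : ContMDiff I 𝓘(ℝ, ℂ) ∞ (fun x ↦ signConj (e x) (f x)) := by
  have h1 : ContMDiff I 𝓘(ℝ, ℂ) ∞ (fun x ↦ ((((e x : ℤˣ) : ℤ) : ℝ) : ℂ)) :=
    (contMDiff_of_discreteTopology (I := 𝓘(ℝ, PUnit.{1})) (I' := 𝓘(ℝ, ℂ)) (n := ∞)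
      (f := fun ε : ℤˣ ↦ (((ε : ℤ) : ℝ) : ℂ))).comp he
  have h2 : ContMDiff I 𝓘(ℝ, ℂ) ∞ (fun x ↦ ((f x).re : ℂ)) :=
    (Complex.ofRealCLM.comp Complex.reCLM).contDiff.contMDiff.comp hf
  have h3 : ContMDiff I 𝓘(ℝ, ℂ) ∞ (fun x ↦ ((f x).im : ℂ)) :=
    (Complex.ofRealCLM.comp Complex.imCLM).contDiff.contMDiff.comp hf
  simp only [signConj_eq]
  exact h2.add (contMDiff_mul_complex (contMDiff_mul_complex h1 h3) contMDiff_const)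

lemma contMDiff_circle_coe {f : M → Circle} (hf : ContMDiff I (𝓡 1) ∞ f) :
    ContMDiff I 𝓘(ℝ, ℂ) ∞ (fun x ↦ (f x : ℂ)) :=
  have := finrank_real_complex_fact'
  (contMDiff_coe_sphere (E := ℂ) (n := 1) (m := ∞)).comp hf

lemma contMDiff_circle_zpow [IsManifold I ∞ M] {e : M → ℤˣ} {f : M → Circle} (he : ContMDiff I 𝓘(ℝ, PUnit.{1}) ∞ e)
    (hf : ContMDiff I (𝓡 1) ∞ f) : ContMDiff I (𝓡 1) ∞ (fun x ↦ f x ^ (e x : ℤ)) := by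
  have := finrank_real_complex_fact'
  apply ContMDiff.codRestrict_sphere (E := ℂ) (n := 1)
    (f := fun x ↦ ((f x ^ (e x : ℤ) : Circle) : ℂ))
  simp only [coe_zpow_unit]
  exact contMDiff_signConj he (contMDiff_circle_coe hf)

lemma contMDiff_mk {f : M → E2} (h1 : ContMDiff I 𝓘(ℝ, ℂ) ∞ (fun x ↦ (f x).1))
    (h2 : ContMDiff I (𝓡 1) ∞ (fun x ↦ (f x).2.1))
    (h3 : ContMDiff I 𝓘(ℝ, PUnit.{1}) ∞ (fun x ↦ (f x).2.2)) : ContMDiff I model ∞ f :=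
  h1.prodMk (h2.prodMk h3)

end Smooth

lemma contMDiff_plane : ContMDiff model 𝓘(ℝ, ℂ) ∞ (fun g : E2 ↦ g.1) :=
  contMDiff_fst (M := ℂ) (N := Circle × ℤˣ)

lemma contMDiff_circle : ContMDiff model (𝓡 1) ∞ (fun g : E2 ↦ g.2.1) :=
  (contMDiff_fst (M := Circle) (N := ℤˣ)).comp (contMDiff_snd (M := ℂ) (N := Circle × ℤˣ))

lemma contMDiff_sign : ContMDiff model 𝓘(ℝ, PUnit.{1}) ∞ (fun g : E2 ↦ g.2.2) :=
  (contMDiff_snd (M := Circle) (N := ℤˣ)).comp (contMDiff_snd (M := ℂ) (N := Circle × ℤˣ))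

instance : LieGroup model ∞ E2 where
  contMDiff_mul := by
    have p1 : ContMDiff (model.prod model) model ∞ (fun p : E2 × E2 ↦ p.1) := contMDiff_fst
    have p2 : ContMDiff (model.prod model) model ∞ (fun p : E2 × E2 ↦ p.2) := contMDiff_snd
    refine contMDiff_mk ?_ ?_ ?_
    · exact (contMDiff_plane.comp p1).add (contMDiff_mul_complex
        (contMDiff_circle_coe (contMDiff_circle.comp p1)) (contMDiff_signConj (contMDiff_sign.comp p1) (contMDiff_plane.comp p2)))
    · exact (contMDiff_circle.comp p1).mul
        (contMDiff_circle_zpow (contMDiff_sign.comp p1) (contMDiff_circle.comp p2))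
    · exact (contMDiff_of_discreteTopology (I := 𝓘(ℝ, PUnit.{1}).prod 𝓘(ℝ, PUnit.{1}))
        (I' := 𝓘(ℝ, PUnit.{1})) (n := ∞) (f := fun p : ℤˣ × ℤˣ ↦ p.1 * p.2)).comp
        ((contMDiff_sign.comp p1).prodMk (contMDiff_sign.comp p2))
  contMDiff_inv := by
    refine contMDiff_mk ?_ ?_ ?_
    · exact (contMDiff_signConj contMDiff_sign
        (contMDiff_mul_complex (contMDiff_circle_coe contMDiff_circle.inv) contMDiff_plane)).neg
    · exact contMDiff_circle_zpow contMDiff_sign contMDiff_circle.inv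
    · exact contMDiff_sign

end E2

end ContactLie

end

/-! On the Lie algebra a left-invariant contact form is a linear form `α` such that no nonzero
vector is killed both by `α` and by `α [x, ·]` (`eq_zero_of_radical`,
`HasLeftInvariantContactForm.exists_linearForm`). A flat left-invariant metric is an inner product
with a product `L x y = ∇_x y` whose commutator is the bracket, every `L x` being skew and `L` a
representation (`IsFlatProduct`). The forward implications therefore start from linear algebra.

Let u be the kernel of `L` and b its orthogonal complement; both are stable under all `L x`. On b
the form -tr(`L x` `L y`) is invariant and positive definite, and a flat metric algebra with such a
form is abelian (`IsFlatProduct.comm_of_invariant`): a Casimir argument gives `v` with `L z v = z`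
on the commutator subalgebra, so that ad v = `L v` - 1 there; both ad v and `L v` are skew for some
inner product, hence traceless, and the subalgebra has dimension 0. So the algebra is an abelian b
acting on an abelian ideal u by commuting skew maps.

On u write `α` as ⟨a, ·⟩. Then `α [x, y]` = ⟨`L y a`, x⟩ - ⟨`L x a`, y⟩, and nondegeneracy makes `x
↦ L x a` injective on b and u the span of a and b·a. The trilinear form ⟨`L x a`, `L y (L z a)`⟩
changes sign under cyclic permutation, so it vanishes and `L y (L z a)` is a multiple of a. This
forces dim b = 1 and identifies the algebra with the semidirect product ℂ ⋊ ℝ, where ℝ acts by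
rotations (`IsFlatProduct.exists_motion_coordinates`). In particular the dimension is at most 3.

The equivalence passes through `IsMotionCoordinates`, an embedding (ζ, τ) of the Lie algebra into ℂ
⋊ ℝ. With the Maurer-Cartan form μ, the 1-form τμ is closed and integrates to a function t, then
exp(it)ζμ is closed and integrates to z; near 1 the pair (z, t) obeys the group law of motions
(`IsMotionCoordinates.locallyIsomorphic`). Conversely, differentiating that group law recovers ζ and
τ (`LocallyIsomorphic.exists_isMotionCoordinates`), and letting `L x` rotate the ζ-part at speed
τ(x) defines a flat Levi-Civita connection (`IsMotionCoordinates.hasFlatLeftInvariantMetric`). -/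

open scoped Manifold ContDiff Bundle Topology

noncomputable section

namespace ContactLie

set_option linter.unusedSectionVars false

section

/-! ### Inner products given by bilinear forms, and traces of skew maps. -/

section BilinearForms

variable {V : Type*} [AddCommGroup V] [Module ℝ V]

/-- The inner product given by a positive definite symmetric bilinear form. -/
abbrev innerCore (B : V →ₗ[ℝ] V →ₗ[ℝ] ℝ) (symm : ∀ x y, B x y = B y x)
    (pos : ∀ x, x ≠ 0 → 0 < B x x) : InnerProductSpace.Core ℝ V where
  inner x y := B x y
  conj_inner_symm x y := by simpa using symm y x
  re_inner_nonneg x := by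
    rcases eq_or_ne x 0 with rfl | h
    · simp
    · simpa using (pos x h).le
  add_left x y z := by simp
  smul_left x y r := by simp
  definite x hx := by
    by_contra h
    exact (pos x h).ne' hx

lemma exists_orthonormal_basis [FiniteDimensional ℝ V] (B : V →ₗ[ℝ] V →ₗ[ℝ] ℝ) (symm : ∀ x y, B x y = B y x)
    (pos : ∀ x, x ≠ 0 → 0 < B x x) :
    ∃ e : Module.Basis (Fin (Module.finrank ℝ V)) ℝ V,
      ∀ i j, B (e i) (e j) = if i = j then 1 else 0 := by
  let c := innerCore B symm pos
  let : NormedAddCommGroup V := c.toNormedAddCommGroup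
  let : InnerProductSpace ℝ V := .ofCore c.toCore
  refine ⟨(stdOrthonormalBasis ℝ V).toBasis, fun i j ↦ ?_⟩
  have := (orthonormal_iff_ite.1 (stdOrthonormalBasis ℝ V).orthonormal) i j
  simpa using! this

lemma repr_eq_of_orthonormal {ι : Type*} [Fintype ι] [DecidableEq ι] {B : V →ₗ[ℝ] V →ₗ[ℝ] ℝ}
    {e : Module.Basis ι ℝ V} (he : ∀ i j, B (e i) (e j) = if i = j then 1 else 0) (x : V) (i : ι) :
    e.repr x i = B x (e i) := by
  conv_rhs => rw [← e.sum_repr x]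
  simp only [map_sum, map_smul, LinearMap.sum_apply, LinearMap.smul_apply, he]
  simp

lemma trace_eq_zero_of_skew [FiniteDimensional ℝ V] (B : V →ₗ[ℝ] V →ₗ[ℝ] ℝ) (symm : ∀ x y, B x y = B y x)
    (pos : ∀ x, x ≠ 0 → 0 < B x x) (T : V →ₗ[ℝ] V) (hT : ∀ x, B (T x) x = 0) :
    LinearMap.trace ℝ V T = 0 := by
  obtain ⟨e, he⟩ := exists_orthonormal_basis B symm pos
  rw [LinearMap.trace_eq_matrix_trace ℝ e, Matrix.trace]
  refine Finset.sum_eq_zero fun i _ ↦ ?_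
  rw [Matrix.diag_apply, LinearMap.toMatrix_apply, repr_eq_of_orthonormal he, hT]

/-- The sum of the Leibniz rule over an orthonormal basis vanishes for a skew endomorphism. -/
lemma sum_skew_eq_zero {ι : Type*} [Fintype ι] [DecidableEq ι] {B : V →ₗ[ℝ] V →ₗ[ℝ] ℝ}
    {e : Module.Basis ι ℝ V} (he : ∀ i j, B (e i) (e j) = if i = j then 1 else 0) {T : V →ₗ[ℝ] V}
    (hT : ∀ x y, B (T x) y = - B (T y) x) {Z : Type*} [AddCommGroup Z] [Module ℝ Z]
    (M : V →ₗ[ℝ] V →ₗ[ℝ] Z) : ∑ i, (M (T (e i)) (e i) + M (e i) (T (e i))) = 0 := by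
  have h (i : ι) : T (e i) = ∑ j, B (T (e i)) (e j) • e j := by
    conv_lhs => rw [← e.sum_repr (T (e i))]
    simp only [repr_eq_of_orthonormal he]
  have h1 : ∑ i, M (T (e i)) (e i) = ∑ i, ∑ j, B (T (e i)) (e j) • M (e j) (e i) := by
    refine Finset.sum_congr rfl fun i _ ↦ ?_
    conv_lhs => rw [h i]
    simp
  have h2 : ∑ i, M (e i) (T (e i)) = ∑ i, ∑ j, B (T (e i)) (e j) • M (e i) (e j) := by
    refine Finset.sum_congr rfl fun i _ ↦ ?_
    conv_lhs => rw [h i]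
    simp
  -- After exchanging the summation indices in the first sum, the coefficients of `M (e i) (e j)`
  -- are opposite by skewness.
  rw [Finset.sum_add_distrib, h1, h2, Finset.sum_comm, ← Finset.sum_add_distrib]
  refine Finset.sum_eq_zero fun i _ ↦ ?_
  rw [← Finset.sum_add_distrib]
  refine Finset.sum_eq_zero fun j _ ↦ ?_
  rw [hT (e j) (e i)]; simp

end BilinearForms

/-! ### Flat metric Lie algebras with a definite invariant form. -/

section Flat

variable {V : Type*} [NormedAddCommGroup V] [InnerProductSpace ℝ V]

local notation "⟪" x ", " y "⟫" => inner ℝ x y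

/-- The Levi-Civita product of a flat metric Lie algebra: `L x` is skew for all `x` and, with the
bracket `[x, y] = L x y - L y x`, the map `L` is a representation. -/
structure IsFlatProduct (L : V →ₗ[ℝ] V →ₗ[ℝ] V) : Prop where
  skew : ∀ x y z, ⟪L x y, z⟫ = - ⟪y, L x z⟫
  flat : ∀ x y z, L (L x y - L y x) z = L x (L y z) - L y (L x z)

variable [FiniteDimensional ℝ V]

/-- A flat metric Lie algebra with a definite invariant form is abelian. -/
lemma IsFlatProduct.comm_of_invariant {L : V →ₗ[ℝ] V →ₗ[ℝ] V} (hL : IsFlatProduct L)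
    (B : V →ₗ[ℝ] V →ₗ[ℝ] ℝ) (symm : ∀ x y, B x y = B y x) (pos : ∀ x, x ≠ 0 → 0 < B x x)
    (inv : ∀ x y z, B (L x y - L y x) z = - B (L x z - L z x) y) (x y : V) :
    L x y = L y x := by
  classical
  obtain ⟨e, he⟩ := exists_orthonormal_basis B symm pos
  let ad (x : V) : V →ₗ[ℝ] V := L x - L.flip x
  have ad_apply (x y : V) : ad x y = L x y - L y x := rfl
  -- The tensor Σ eᵢ ⊗ eᵢ is invariant under every `ad x`. The cancellations in `hv₀` and `hC` are
  -- this fact for two choices of `M`.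
  have hsum {Z : Type _} [AddCommGroup Z] [Module ℝ Z] (x : V) (M : V →ₗ[ℝ] V →ₗ[ℝ] Z) :=
    sum_skew_eq_zero he (T := ad x) (fun y z ↦ inv x y z) M
  -- The Casimir operator of the representation `L`. It commutes with every `L x`, and being a sum
  -- of squares of skew maps it has the common kernel of the `L x` as its kernel.
  let C : V →ₗ[ℝ] V := ∑ i, L (e i) ∘ₗ L (e i)
  have C_apply (z : V) : C z = ∑ i, L (e i) (L (e i) z) := by simp [C]
  let v₀ : V := ∑ i, L (e i) (e i)
  have hv₀ (x : V) : L x v₀ = C x := by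
    have := hsum x L
    rw [C_apply, map_sum, ← sub_eq_zero, ← Finset.sum_sub_distrib, ← this]
    refine Finset.sum_congr rfl fun i _ ↦ ?_
    rw [ad_apply, hL.flat, map_sub]; abel
  have hC (x z : V) : L x (C z) = C (L x z) := by
    have := hsum x ((LinearMap.compl₂ L (L.flip z)))
    simp only [LinearMap.compl₂_apply, LinearMap.flip_apply] at this
    rw [C_apply, C_apply, map_sum, ← sub_eq_zero, ← Finset.sum_sub_distrib, ← this]
    refine Finset.sum_congr rfl fun i _ ↦ ?_
    rw [ad_apply, hL.flat, hL.flat, map_sub]; abel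
  have C_symm : C.IsSymmetric := fun y z ↦ by
    simp only [C_apply, sum_inner, inner_sum]
    refine Finset.sum_congr rfl fun i _ ↦ ?_
    rw [hL.skew, hL.skew, neg_neg]
  have C_ker (z : V) (hz : C z = 0) (i) : L (e i) z = 0 := by
    have h1 : ∑ i, ⟪L (e i) z, L (e i) z⟫ = 0 := by
      have : ⟪C z, z⟫ = 0 := by rw [hz, inner_zero_left]
      simp only [C_apply, sum_inner] at this
      rw [← neg_eq_zero, ← Finset.sum_neg_distrib, ← this]
      exact Finset.sum_congr rfl fun i _ ↦ (hL.skew _ _ _).symm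
    have := (Finset.sum_eq_zero_iff_of_nonneg fun i _ ↦ real_inner_self_nonneg).1 h1 i
      (Finset.mem_univ i)
    exact inner_self_eq_zero.1 this
  have C_ker' (z : V) (hz : C z = 0) (x : V) : L x z = 0 := by
    rw [← e.sum_repr x]
    simp only [map_sum, map_smul, LinearMap.sum_apply, LinearMap.smul_apply, C_ker z hz]
    simp
  -- The range of the symmetric map `C` is the orthogonal complement of its kernel, and skewness of
  -- `L (e i)` shows that `v₀` is orthogonal to that kernel.
  obtain ⟨v, hv⟩ : v₀ ∈ LinearMap.range C := by
    have : (LinearMap.range C)ᗮ = LinearMap.ker C := C_symm.orthogonal_range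
    rw [← Submodule.orthogonal_orthogonal (LinearMap.range C), this, Submodule.mem_orthogonal]
    intro u hu
    simp only [v₀, inner_sum]
    refine Finset.sum_eq_zero fun i _ ↦ ?_
    rw [← neg_neg ⟪u, _⟫, ← hL.skew, C_ker u hu, inner_zero_left, neg_zero]
  -- The identity map is a 1-cocycle with values in the representation `L`; modulo the vectors
  -- killed by all `L y`, it is the coboundary of `v`.
  have key (x y : V) : L y x = L y (L x v) := by
    have : C (x - L x v) = 0 := by rw [map_sub, ← hC, hv, hv₀, sub_self]
    simpa [sub_eq_zero] using C_ker' _ this y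
  let s : Submodule ℝ V := Submodule.span ℝ {z | ∃ x y, z = L x y - L y x}
  have hs (z : V) (hz : z ∈ s) : L z v = z := by
    induction hz using Submodule.span_induction with
    | mem z hz =>
      obtain ⟨x, y, rfl⟩ := hz
      rw [hL.flat, ← key, ← key]
    | zero => simp
    | add a b _ _ ha hb => simp [ha, hb]
    | smul c a _ ha => simp [ha]
  -- On the commutator subalgebra `hs` turns `ad v` into `L v - 1`. Both `T` (skew for `B`) and `T +
  -- 1 = L v` (skew for the metric) are traceless, so the trace of the identity, which is the
  -- dimension of `s`, is zero.
  let T : s →ₗ[ℝ] s := ((ad v).comp s.subtype).codRestrict s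
    fun z ↦ Submodule.subset_span ⟨v, z, rfl⟩
  have T_apply (z : s) : (T z : V) = L v z - z := by
    change L v z - L z v = _; rw [hs z z.2]
  have t1 : LinearMap.trace ℝ s T = 0 := by
    refine trace_eq_zero_of_skew (B.domRestrict₁₂ s s) (fun x y ↦ symm _ _)
      (fun x hx ↦ pos _ (by simpa using hx)) T fun x ↦ ?_
    have := inv v x x
    rw [LinearMap.domRestrict₁₂_apply]
    change B (L v x - L x v) x = 0
    linarith
  have t2 : LinearMap.trace ℝ s (T + LinearMap.id) = 0 := by
    refine trace_eq_zero_of_skew ((innerₗ V).domRestrict₁₂ s s) (fun x y ↦ real_inner_comm _ _)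
      (fun x hx ↦ real_inner_self_pos.2 (by simpa using hx)) _ fun x ↦ ?_
    have h := hL.skew v x x
    rw [real_inner_comm] at h
    simp only [LinearMap.domRestrict₁₂_apply, LinearMap.add_apply, LinearMap.id_apply,
      Submodule.coe_add, T_apply, sub_add_cancel, innerₗ_apply_apply]
    rw [real_inner_comm]; linarith
  rw [map_add, t1, zero_add, LinearMap.trace_id] at t2
  have s0 : s = ⊥ := Submodule.finrank_eq_zero.1 (by exact_mod_cast t2)
  have : L x y - L y x ∈ s := Submodule.subset_span ⟨x, y, rfl⟩
  rw [s0, Submodule.mem_bot] at this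
  exact sub_eq_zero.1 this

end Flat

end

section
-- Flat metric Lie algebras with a contact form.
section Flat

variable {V : Type*} [NormedAddCommGroup V] [InnerProductSpace ℝ V]

local notation "⟪" x ", " y "⟫" => inner ℝ x y

/-- The decomposition of a vector along the kernel of `L` and its complement. -/
lemma exists_decomp_ker {V : Type*} [NormedAddCommGroup V] [InnerProductSpace ℝ V]
    [FiniteDimensional ℝ V] (L : V →ₗ[ℝ] V →ₗ[ℝ] V) (x : V) : ∃ xb ∈ (LinearMap.ker L)ᗮ, L x = L xb ∧ x - xb ∈ LinearMap.ker L := by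
  have h := Submodule.sub_starProjection_mem_orthogonal (K := LinearMap.ker L) x
  have h' := Submodule.starProjection_apply_mem (LinearMap.ker L) x
  refine ⟨_, h, ?_, by simp⟩
  rw [map_sub, LinearMap.mem_ker.1 h', sub_zero]

namespace IsFlatProduct

variable {L : V →ₗ[ℝ] V →ₗ[ℝ] V} (hL : IsFlatProduct L)
include hL

lemma inner_self_eq_zero (x y : V) : ⟪L x y, y⟫ = 0 := by
  have := hL.skew x y y
  rw [real_inner_comm (L x y)] at this
  linarith

/-- With `L y = 0` every term of the flatness identity other than `L (L x y) z` vanishes. Since then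
also `[x, y] = L x y`, the kernel is an ideal. -/
lemma map_mem_ker (x : V) {y : V} (hy : y ∈ LinearMap.ker L) : L x y ∈ LinearMap.ker L := by
  rw [LinearMap.mem_ker] at hy ⊢
  ext z
  simpa [hy] using hL.flat x y z

lemma map_mem_orthogonal (x : V) {y : V} (hy : y ∈ (LinearMap.ker L)ᗮ) :
    L x y ∈ (LinearMap.ker L)ᗮ := by
  rw [Submodule.mem_orthogonal'] at hy ⊢
  intro w hw
  rw [hL.skew, hy _ (hL.map_mem_ker x hw), neg_zero]

variable [FiniteDimensional ℝ V]

/-- The orthogonal complement of the kernel of `L` is an abelian subalgebra. -/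
lemma comm_of_mem_orthogonal {x y : V} (hx : x ∈ (LinearMap.ker L)ᗮ)
    (hy : y ∈ (LinearMap.ker L)ᗮ) : L x y = L y x := by
  set b := (LinearMap.ker L)ᗮ with hb
  let L' : b →ₗ[ℝ] b →ₗ[ℝ] b := LinearMap.mk₂ ℝ
    (fun x y ↦ ⟨L x y, hL.map_mem_orthogonal x y.2⟩)
    (fun _ _ _ ↦ Subtype.ext (by simp)) (fun _ _ _ ↦ Subtype.ext (by simp))
    (fun _ _ _ ↦ Subtype.ext (by simp)) (fun _ _ _ ↦ Subtype.ext (by simp))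
  have hL' : IsFlatProduct L' :=
    ⟨fun x y z ↦ hL.skew x y z, fun x y z ↦ Subtype.ext (hL.flat x y z)⟩
  -- The negative trace form of the representation. Cyclicity of the trace makes it invariant; `B x
  -- x` is the squared Hilbert-Schmidt norm of the skew map `L x`, which vanishes only on the kernel
  -- of `L`.
  let B : V →ₗ[ℝ] V →ₗ[ℝ] ℝ := LinearMap.mk₂ ℝ
    (fun x y ↦ - LinearMap.trace ℝ V (L x * L y))
    (fun _ _ _ ↦ by simp [add_mul]; ring) (fun _ _ _ ↦ by simp)
    (fun _ _ _ ↦ by simp [mul_add]; ring) (fun _ _ _ ↦ by simp)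
  have B_apply (x y : V) : B x y = - LinearMap.trace ℝ V (L x * L y) := rfl
  have hbr (x y : V) : L (L x y - L y x) = L x * L y - L y * L x :=
    LinearMap.ext fun z ↦ by simpa using hL.flat x y z
  refine congrArg Subtype.val (hL'.comm_of_invariant (B.domRestrict₁₂ b b) (fun x y ↦ ?_)
    (fun x hx ↦ ?_) (fun x y z ↦ ?_) ⟨x, hx⟩ ⟨y, hy⟩)
  · simp only [LinearMap.domRestrict₁₂_apply, B_apply]
    rw [LinearMap.trace_mul_comm]
  · simp only [LinearMap.domRestrict₁₂_apply, B_apply]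
    rw [LinearMap.trace_eq_sum_inner _ (stdOrthonormalBasis ℝ V), ← Finset.sum_neg_distrib]
    have h (i) : - ⟪stdOrthonormalBasis ℝ V i, (L x * L x) (stdOrthonormalBasis ℝ V i)⟫ =
        ⟪L x (stdOrthonormalBasis ℝ V i), L x (stdOrthonormalBasis ℝ V i)⟫ := by
      rw [hL.skew]; rfl
    simp only [h]
    refine lt_of_le_of_ne (Finset.sum_nonneg fun i _ ↦ real_inner_self_nonneg) fun h0 ↦ hx ?_
    have h1 := (Finset.sum_eq_zero_iff_of_nonneg fun i _ ↦ real_inner_self_nonneg).1 h0.symm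
    have hx0 : L x = 0 := by
      refine (stdOrthonormalBasis ℝ V).toBasis.ext fun i ↦ ?_
      simpa using h1 i (Finset.mem_univ i)
    have hxx : (x : V) ∈ (LinearMap.ker L) ⊓ (LinearMap.ker L)ᗮ := ⟨hx0, x.2⟩
    rw [Submodule.inf_orthogonal_eq_bot] at hxx
    exact Subtype.ext hxx
  · change B (L x y - L y x : V) z = - B (L x z - L z x : V) y
    rw [B_apply, B_apply, hbr, hbr, sub_mul, sub_mul, map_sub, map_sub]
    have h1 := LinearMap.trace_mul_comm ℝ (L z) (L x * L y)
    have h2 := LinearMap.trace_mul_comm ℝ (L y) (L x * L z)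
    simp only [mul_assoc] at h1 h2 ⊢
    rw [h1, h2]; ring

/-- `L` only sees the components orthogonal to its kernel; these commute, so flatness says that the
corresponding operators commute. -/
lemma comm_apply (x y z : V) : L x (L y z) = L y (L x z) := by
  obtain ⟨xb, hx, hx', -⟩ := exists_decomp_ker L x
  obtain ⟨yb, hy, hy', -⟩ := exists_decomp_ker L y
  have := hL.flat xb yb z
  rw [hL.comm_of_mem_orthogonal hx hy, sub_self, map_zero, LinearMap.zero_apply] at this
  rw [hx', hy']
  exact (sub_eq_zero.1 this.symm)

/-- A flat metric Lie algebra with a contact form is the Lie algebra of the group of rigid motions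
of the plane. -/
theorem exists_motion_coordinates (hV : 2 ≤ Module.finrank ℝ V) (α : V →ₗ[ℝ] ℝ)
    (hα : ∀ x, α x = 0 → (∀ y, α (L x y - L y x) = 0) → x = 0) :
    ∃ (ζ : V →ₗ[ℝ] ℂ) (τ : V →ₗ[ℝ] ℝ), (∀ x, ζ x = 0 → τ x = 0 → x = 0) ∧
      (∀ x y, ζ (L x y - L y x) = Complex.I * (τ x * ζ y - τ y * ζ x)) ∧
      (∀ x y, τ (L x y - L y x) = 0) := by
  set u := LinearMap.ker L with hu
  have hVα : ¬ Function.Injective α := fun h ↦ by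
    have := LinearMap.finrank_le_finrank_of_injective h
    rw [Module.finrank_self] at this
    omega
  -- The Riesz vector of `α` restricted to the kernel. It spans the Reeb direction, see `rad`.
  obtain ⟨a, ha, haα⟩ : ∃ a ∈ u, ∀ y ∈ u, ⟪a, y⟫ = α y := by
    let a : u := (InnerProductSpace.toDual ℝ u).symm
      (LinearMap.toContinuousLinearMap (α.domRestrict u))
    refine ⟨a, a.2, fun y hy ↦ ?_⟩
    have := InnerProductSpace.toDual_symm_apply (𝕜 := ℝ) (x := (⟨y, hy⟩ : u))
      (y := LinearMap.toContinuousLinearMap (α.domRestrict u))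
    simpa only [LinearMap.coe_toContinuousLinearMap', LinearMap.domRestrict_apply] using! this
  -- As the components in `uᗮ` commute, the bracket is `L x (y - yb) - L y (x - xb)`. Both terms lie
  -- in `u`, where `α` is the inner product with `a`; the components `xb`, `yb` can be restored
  -- because `L x a` and `L y a` lie in `u`.
  have hω (x y : V) : α (L x y - L y x) = ⟪L y a, x⟫ - ⟪L x a, y⟫ := by
    obtain ⟨xb, hx, hx', hxu⟩ := exists_decomp_ker L x
    obtain ⟨yb, hy, hy', hyu⟩ := exists_decomp_ker L y
    have h1 : L x y - L y x = L x (y - yb) - L y (x - xb) := by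
      have := hL.comm_of_mem_orthogonal hx hy
      rw [← hx', ← hy'] at this
      rw [map_sub, map_sub, this]; abel
    have h2 := haα _ (u.sub_mem (hL.map_mem_ker x hyu) (hL.map_mem_ker y hxu))
    have h3 : ⟪L y a, xb⟫ = 0 := hx _ (hL.map_mem_ker y ha)
    have h4 : ⟪L x a, yb⟫ = 0 := hy _ (hL.map_mem_ker x ha)
    rw [h1, ← h2, inner_sub_right, ← neg_neg ⟪a, L x (y - yb)⟫, ← hL.skew,
      ← neg_neg ⟪a, L y (x - xb)⟫, ← hL.skew, inner_sub_right, inner_sub_right, h3, h4]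
    ring
  have ha0 : a ≠ 0 := fun h ↦ hVα <| (injective_iff_map_eq_zero α).2 fun x hx ↦
    hα x hx fun y ↦ by rw [hω, h]; simp
  have haa : ⟪a, a⟫ ≠ 0 := fun h ↦ ha0 (_root_.inner_self_eq_zero.1 h)
  have hLa : L a = 0 := ha
  -- By `hω` the assumption puts `x` in the radical of `α [·, ·]`, which also contains `a`.
  -- Subtracting the multiple of `a` with the same value of `α` gives a vector that nondegeneracy
  -- forces to be zero.
  have rad (x : V) (hx : ∀ y, ⟪L y a, x⟫ = ⟪L x a, y⟫) : ∃ t : ℝ, x = t • a := by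
    refine ⟨α x / ⟪a, a⟫, sub_eq_zero.1 (hα _ ?_ fun y ↦ ?_)⟩
    · rw [map_sub, map_smul, ← haα a ha, smul_eq_mul, div_mul_cancel₀ _ haa, sub_self]
    · rw [hω, inner_sub_right, inner_smul_right, hL.inner_self_eq_zero, map_sub, map_smul, hLa,
        hx y]
      simp
  have hb0 (x : V) (hx : x ∈ uᗮ) (hxa : L x a = 0) : x = 0 := by
    obtain ⟨t, ht⟩ := rad x fun y ↦ by
      rw [hxa, inner_zero_left]; exact hx _ (hL.map_mem_ker y ha)
    have hxx : x ∈ u ⊓ uᗮ := ⟨ht ▸ u.smul_mem t ha, hx⟩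
    rw [Submodule.inf_orthogonal_eq_bot] at hxx
    exact hxx
  have hu0 (x : V) (hx : x ∈ u) (hxa : ∀ y, ⟪L y a, x⟫ = 0) : ∃ t : ℝ, x = t • a :=
    rad x fun y ↦ by rw [hxa, LinearMap.mem_ker.1 hx]; simp
  -- Skewness and commutativity of the operators give a change of sign under a cyclic permutation of
  -- the three arguments. Three such permutations are the identity, so the form equals its own
  -- negative.
  have hT (x y z : V) : ⟪L x a, L y (L z a)⟫ = 0 := by
    have key (x y z : V) : ⟪L x a, L y (L z a)⟫ = - ⟪L z a, L x (L y a)⟫ := by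
      rw [← neg_neg ⟪L x a, L y (L z a)⟫, ← hL.skew, real_inner_comm, hL.comm_apply y x]
    linarith [key x y z, key z x y, key y z x]
  have hline (y z : V) : ∃ t : ℝ, L y (L z a) = t • a :=
    hu0 _ (hL.map_mem_ker _ (hL.map_mem_ker _ ha)) fun x ↦ hT x y z
  -- This yields dim `uᗮ` ≤ 1. Orthogonality gives `L y (L z a) = 0`, hence `L z` kills `L y (L y a)
  -- = c • a`; here `c = 0` would give `L y a = 0`, and otherwise `L z a = 0`.
  have hpair (y z : V) (hy : y ∈ uᗮ) (hz : z ∈ uᗮ) (hyz : ⟪L y a, L z a⟫ = 0) (hy0 : y ≠ 0) :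
      z = 0 := by
    obtain ⟨t, ht⟩ := hline y z
    have t0 : t = 0 := by
      have : ⟪L y (L z a), a⟫ = 0 := by rw [hL.skew, real_inner_comm, hyz, neg_zero]
      rw [ht, inner_smul_left] at this
      simpa [ha0] using this
    rw [t0, zero_smul] at ht
    obtain ⟨c, hc⟩ := hline y y
    have h1 : L z (L y (L y a)) = 0 := by
      rw [hL.comm_apply z y, hL.comm_apply z y, ht, map_zero]
    rw [hc, map_smul] at h1
    rcases smul_eq_zero.1 h1 with h | h
    · rw [h, zero_smul] at hc
      have : ⟪L y a, L y a⟫ = 0 := by rw [hL.skew, hc, inner_zero_right, neg_zero]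
      exact absurd (hb0 y hy (_root_.inner_self_eq_zero.1 this)) hy0
    · exact hb0 z hz h
  obtain ⟨e, he, he0⟩ : ∃ e ∈ uᗮ, e ≠ 0 := by
    by_contra! hcon
    refine hVα ((injective_iff_map_eq_zero α).2 fun x hx ↦ hα x hx fun y ↦ ?_)
    have h0 (x : V) : L x = 0 := by
      obtain ⟨xb, hx, hx', -⟩ := exists_decomp_ker L x
      rw [hx', hcon xb hx, map_zero]
    simp [h0]
  have hea : L e a ≠ 0 := fun h ↦ he0 (hb0 e he h)
  have hbe (y : V) (hy : y ∈ uᗮ) : ∃ t : ℝ, y = t • e := by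
    refine ⟨⟪L e a, L y a⟫ / ⟪L e a, L e a⟫, sub_eq_zero.1 (hpair e _ he
      (uᗮ.sub_mem hy (uᗮ.smul_mem _ he)) ?_ he0)⟩
    rw [map_sub, map_smul, LinearMap.sub_apply, LinearMap.smul_apply, inner_sub_right,
      inner_smul_right, div_mul_cancel₀ _ (fun h ↦ hea (_root_.inner_self_eq_zero.1 h)), sub_self]
  have hee : ⟪e, e⟫ ≠ 0 := fun h ↦ he0 (_root_.inner_self_eq_zero.1 h)
  have hLx (x : V) : L x = (⟪e, x⟫ / ⟪e, e⟫) • L e := by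
    obtain ⟨xb, hx, hx', hxu⟩ := exists_decomp_ker L x
    obtain ⟨t, rfl⟩ := hbe xb hx
    have : ⟪e, x⟫ = t * ⟪e, e⟫ := by
      have h := he _ hxu
      rw [real_inner_comm, inner_sub_right, inner_smul_right] at h
      linarith
    rw [hx', this, mul_div_cancel_right₀ _ hee, map_smul]
  have hLee : L e e = 0 := by
    obtain ⟨t, ht⟩ := hbe _ (hL.map_mem_orthogonal e he)
    have h := hL.inner_self_eq_zero e e
    rw [ht, inner_smul_left] at h
    have : t = 0 := by simpa [he0] using h
    rw [ht, this, zero_smul]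
  -- On the plane of `a` and `L e a` the skew map `L e` is `l` times a quarter turn. Hence the
  -- factor `l` in `τ`, and the use in `ζ` of `a` and `l⁻¹ • L e a`, which have equal length.
  set l : ℝ := ‖L e a‖ / ‖a‖ with hl
  have hl0 : l ≠ 0 := div_ne_zero (norm_ne_zero_iff.2 hea) (norm_ne_zero_iff.2 ha0)
  have hLL : L e (L e a) = - (l ^ 2) • a := by
    obtain ⟨c, hc⟩ := hline e e
    have h : ⟪L e (L e a), a⟫ = - ⟪L e a, L e a⟫ := by rw [hL.skew]
    rw [hc, inner_smul_left, real_inner_self_eq_norm_sq, real_inner_self_eq_norm_sq] at h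
    have : c = - l ^ 2 := by
      have := norm_ne_zero_iff.2 ha0
      simp only [conj_trivial] at h
      rw [hl]; field_simp; linarith
    rw [hc, this]
  let τ : V →ₗ[ℝ] ℝ := (l / ⟪e, e⟫) • (innerₗ V e)
  have τ_apply (x : V) : τ x = l * (⟪e, x⟫ / ⟪e, e⟫) := by
    simp [τ]; ring
  let ζ : V →ₗ[ℝ] ℂ := (innerₗ V a).smulRight (1 : ℂ) +
    (l⁻¹ • innerₗ V (L e a)).smulRight Complex.I
  have ζ_apply (x : V) : ζ x = (⟪a, x⟫ : ℝ) + (l⁻¹ * ⟪L e a, x⟫ : ℝ) * Complex.I := by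
    simp [ζ]
  have hζ (x y : V) : ζ (L x y) = Complex.I * (τ x * ζ y) := by
    have h1 : ⟪a, L e y⟫ = - ⟪L e a, y⟫ := by rw [hL.skew, neg_neg]
    have h2 : l⁻¹ * ⟪L e a, L e y⟫ = l * ⟪a, y⟫ := by
      rw [← neg_neg ⟪L e a, L e y⟫, ← hL.skew, hLL, inner_smul_left]
      simp only [conj_trivial, neg_mul, neg_neg]
      field_simp
    rw [hLx x, LinearMap.smul_apply, map_smul, ζ_apply, ζ_apply, h1, h2, τ_apply, Complex.real_smul]
    generalize ⟪e, x⟫ / ⟪e, e⟫ = c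
    have h3 : (l : ℂ) ≠ 0 := by exact_mod_cast hl0
    push_cast
    field_simp
    linear_combination (-(c : ℂ) * ⟪L e a, y⟫) * Complex.I_sq
  have hτ (x y : V) : τ (L x y) = 0 := by
    have h1 : ⟪e, L e y⟫ = 0 := by
      rw [← neg_neg ⟪e, L e y⟫, ← hL.skew, hLee, inner_zero_left, neg_zero]
    rw [τ_apply, hLx x, LinearMap.smul_apply, inner_smul_right, h1]; simp
  refine ⟨ζ, τ, fun x hζx hτx ↦ ?_, fun x y ↦ by rw [map_sub, hζ, hζ]; ring,
    fun x y ↦ by rw [map_sub, hτ, hτ, sub_self]⟩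
  rw [ζ_apply] at hζx
  have h1 : ⟪a, x⟫ = 0 := by simpa using congrArg Complex.re hζx
  have h2 : ⟪L e a, x⟫ = 0 := by simpa [hl0] using congrArg Complex.im hζx
  have h3 : ⟪e, x⟫ = 0 := by rw [τ_apply] at hτx; simpa [hl0, he0] using hτx
  -- Orthogonality to `e` puts `x` in `u`; orthogonality to `L e a`, hence to every `L y a`, leaves
  -- only a multiple of `a` by `hu0`; orthogonality to `a` finishes.
  have hxu : x ∈ u := by
    rw [← Submodule.orthogonal_orthogonal u, Submodule.mem_orthogonal]
    intro y hy
    obtain ⟨t, rfl⟩ := hbe y hy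
    rw [inner_smul_left, h3, mul_zero]
  obtain ⟨t, rfl⟩ := hu0 x hxu fun y ↦ by
    rw [hLx y, LinearMap.smul_apply, inner_smul_left, h2, mul_zero]
  rw [inner_smul_right] at h1
  rw [(mul_eq_zero.1 h1).resolve_right haa, zero_smul]

end IsFlatProduct
end Flat

end

section

/-! ### Linear algebra of the top-degree form built from `α` and `Ω`. -/

section ContactVolume

variable {V : Type*} [AddCommGroup V] [Module ℝ V]

/-- Every slot occurs in exactly one factor of the product, so all other factors are constants. This
is the multilinearity needed for `contactMultilinear`. -/
lemma exists_linear_update (n : ℕ) (α : V →ₗ[ℝ] ℝ) (Ω : V →ₗ[ℝ] V →ₗ[ℝ] ℝ)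
    (v : Fin (2 * n + 1) → V) (m : Fin (2 * n + 1)) : ∃ l : V →ₗ[ℝ] ℝ, ∀ z,
      α (Function.update v m z 0) * ∏ i : Fin n,
        Ω (Function.update v m z ⟨2 * (i : ℕ) + 1, by omega⟩)
          (Function.update v m z ⟨2 * (i : ℕ) + 2, by omega⟩) = l z := by
  have hne {k : Fin (2 * n + 1)} (h : (k : ℕ) ≠ m) (z : V) : Function.update v m z k = v k :=
    Function.update_of_ne (fun h' ↦ h (congrArg _ h')) _ _
  have heq {k : Fin (2 * n + 1)} (h : (k : ℕ) = m) (z : V) : Function.update v m z k = z := by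
    rw [Fin.ext h, Function.update_self]
  rcases Nat.eq_zero_or_pos m with h0 | h0
  · refine ⟨(∏ i : Fin n, Ω (v ⟨2 * (i : ℕ) + 1, by omega⟩) (v ⟨2 * (i : ℕ) + 2, by omega⟩)) • α,
      fun z ↦ ?_⟩
    rw [heq h0.symm, LinearMap.smul_apply, smul_eq_mul, mul_comm]
    congr 1
    refine Finset.prod_congr rfl fun i _ ↦ ?_
    rw [hne (by simp only; omega), hne (by simp only; omega)]
  -- The factor containing slot `m ≥ 1`: an even `m` is its second argument, an odd `m` its first.
  · let j : Fin n := ⟨((m : ℕ) - 1) / 2, by omega⟩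
    let P : ℝ := ∏ i ∈ Finset.univ.erase j,
      Ω (v ⟨2 * (i : ℕ) + 1, by omega⟩) (v ⟨2 * (i : ℕ) + 2, by omega⟩)
    have hP (z : V) : ∏ i ∈ Finset.univ.erase j,
        Ω (Function.update v m z ⟨2 * (i : ℕ) + 1, by omega⟩)
          (Function.update v m z ⟨2 * (i : ℕ) + 2, by omega⟩) = P := by
      refine Finset.prod_congr rfl fun i hi ↦ ?_
      have : (i : ℕ) ≠ ((m : ℕ) - 1) / 2 := fun h ↦ (Finset.mem_erase.1 hi).1 (Fin.ext h)
      rw [hne (by simp only; omega), hne (by simp only; omega)]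
    rcases Nat.even_or_odd' (m : ℕ) with ⟨q, hm | hm⟩
    · refine ⟨(α (v 0) * P) • Ω (v ⟨2 * (j : ℕ) + 1, by omega⟩), fun z ↦ ?_⟩
      rw [← Finset.mul_prod_erase _ _ (Finset.mem_univ j), hP, hne (by simp only [Fin.val_zero]; omega),
        hne (by simp only [j]; omega), heq (by simp only [j]; omega), LinearMap.smul_apply, smul_eq_mul]
      ring
    · refine ⟨(α (v 0) * P) • Ω.flip (v ⟨2 * (j : ℕ) + 2, by omega⟩), fun z ↦ ?_⟩
      rw [← Finset.mul_prod_erase _ _ (Finset.mem_univ j), hP, hne (by simp only [Fin.val_zero]; omega),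
        heq (by simp only [j]; omega), hne (by simp only [j]; omega), LinearMap.smul_apply,
        LinearMap.flip_apply, smul_eq_mul]
      ring

/-- The multilinear form `v ↦ α (v 0) * Ω (v 1) (v 2) * … * Ω (v (2n-1)) (v (2n))`. -/
def contactMultilinear (n : ℕ) (α : V →ₗ[ℝ] ℝ) (Ω : V →ₗ[ℝ] V →ₗ[ℝ] ℝ) :
    MultilinearMap ℝ (fun _ : Fin (2 * n + 1) ↦ V) ℝ :=
  .mk' (fun v ↦ α (v 0) * ∏ i : Fin n,
      Ω (v ⟨2 * (i : ℕ) + 1, by omega⟩) (v ⟨2 * (i : ℕ) + 2, by omega⟩))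
    (fun v m x y ↦ by
      obtain ⟨l, hl⟩ := exists_linear_update n α Ω v m
      rw [hl, hl, hl, map_add])
    (fun v m c x ↦ by
      obtain ⟨l, hl⟩ := exists_linear_update n α Ω v m
      rw [hl, hl, map_smul])

lemma contactMultilinear_apply (n : ℕ) (α : V →ₗ[ℝ] ℝ) (Ω : V →ₗ[ℝ] V →ₗ[ℝ] ℝ)
    (v : Fin (2 * n + 1) → V) :
    contactMultilinear n α Ω v = α (v 0) * ∏ i : Fin n,
      Ω (v ⟨2 * (i : ℕ) + 1, by omega⟩) (v ⟨2 * (i : ℕ) + 2, by omega⟩) := rfl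

variable [FiniteDimensional ℝ V]

/-- The sum is an alternating form of top degree. A vector in both the kernel of `α` and the radical
of `Ω` annihilates each summand; if it were nonzero, completing it to a basis would show that the
whole form vanishes. -/
lemma eq_zero_of_radical {n : ℕ} (hn : Module.finrank ℝ V = 2 * n + 1) (α : V →ₗ[ℝ] ℝ)
    (Ω : V →ₗ[ℝ] V →ₗ[ℝ] ℝ) (hΩ : ∀ x y, Ω x y = - Ω y x) (v : Fin (2 * n + 1) → V)
    (hv : ∑ σ : Equiv.Perm (Fin (2 * n + 1)), ((Equiv.Perm.sign σ : ℤ) : ℝ) *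
      (α (v (σ 0)) * ∏ i : Fin n,
        Ω (v (σ ⟨2 * (i : ℕ) + 1, by omega⟩)) (v (σ ⟨2 * (i : ℕ) + 2, by omega⟩))) ≠ 0)
    {x : V} (hx : α x = 0) (hx' : ∀ y, Ω x y = 0) : x = 0 := by
  classical
  by_contra hx0
  let F : V [⋀^Fin (2 * n + 1)]→ₗ[ℝ] ℝ := (contactMultilinear n α Ω).alternatization
  have hF (v) : F v = ∑ σ : Equiv.Perm (Fin (2 * n + 1)), ((Equiv.Perm.sign σ : ℤ) : ℝ) *
      (α (v (σ 0)) * ∏ i : Fin n,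
        Ω (v (σ ⟨2 * (i : ℕ) + 1, by omega⟩)) (v (σ ⟨2 * (i : ℕ) + 2, by omega⟩))) := by
    simp only [F, MultilinearMap.alternatization_apply, MultilinearMap.domDomCongr_apply,
      contactMultilinear_apply]
    refine Finset.sum_congr rfl fun σ _ ↦ ?_
    rw [Units.smul_def, zsmul_eq_mul]
  have hF0 (w : Fin (2 * n + 1) → V) (k) (hk : w k = x) : F w = 0 := by
    rw [hF]
    refine Finset.sum_eq_zero fun σ _ ↦ ?_
    obtain ⟨j, rfl⟩ := σ.surjective k
    refine mul_eq_zero_of_right _ ?_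
    rcases Nat.eq_zero_or_pos j with h0 | h0
    · rw [show j = 0 from Fin.ext h0] at hk
      rw [hk, hx, zero_mul]
    · refine mul_eq_zero_of_right _
        (Finset.prod_eq_zero (Finset.mem_univ ⟨((j : ℕ) - 1) / 2, by omega⟩) ?_)
      rcases Nat.even_or_odd' (j : ℕ) with ⟨m, hm | hm⟩
      · rw [show (⟨2 * (((j : ℕ) - 1) / 2) + 2, by omega⟩ : Fin (2 * n + 1)) = j from
          Fin.ext (by simp only; omega), hk, hΩ, hx', neg_zero]
      · rw [show (⟨2 * (((j : ℕ) - 1) / 2) + 1, by omega⟩ : Fin (2 * n + 1)) = j from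
          Fin.ext (by simp only; omega), hk, hx']
  apply hv
  rw [← hF]
  -- complete `x` to a basis
  have hli : LinearIndepOn ℝ id {x} := LinearIndepOn.singleton hx0
  let b := Module.Basis.extend hli
  let c := b.indexEquiv (Module.finBasisOfFinrankEq ℝ V hn)
  let k : hli.extend (Set.subset_univ _) := ⟨x, hli.subset_extend _ (Set.mem_singleton x)⟩
  have hb : b k = x := Module.Basis.extend_apply_self hli k
  have : F = 0 := (F.map_basis_eq_zero_iff (b.reindex c)).1 <|
    hF0 _ (c k) (by simp [hb])
  rw [this, AlternatingMap.zero_apply]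

end ContactVolume

end

section

/-! ### Left-invariant fields and the Maurer-Cartan form. -/

section LeftInvariant

open VectorField

variable {E : Type*} [NormedAddCommGroup E] [NormedSpace ℝ E]
  {G : Type*} [TopologicalSpace G] [ChartedSpace E G] [Group G]

/-- The left invariant vector field with value `v` at `1`. -/
def leftField (v : E) (q : G) : TangentSpace 𝓘(ℝ, E) q :=
  mfderiv 𝓘(ℝ, E) 𝓘(ℝ, E) (q * ·) (1 : G) v

/-- The Maurer-Cartan form: the identification of the tangent spaces with the tangent space at `1`
by left translations. -/
def mcForm (q : G) : TangentSpace 𝓘(ℝ, E) q →L[ℝ] E :=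
  mfderiv 𝓘(ℝ, E) 𝓘(ℝ, E) (q⁻¹ * ·) q

variable (G) in
/-- The bracket of the Lie algebra of `G`. -/
def lieBr (u v : E) : E := mlieBracket 𝓘(ℝ, E) (leftField (G := G) u) (leftField v) 1

/-- All tangent spaces unfold to `E`, so base points that are only propositionally equal, such as `q
* 1` and `q`, are exchanged by substitution with the vector typed in `E`. -/
lemma mcForm_congr {q q' : G} (h : q = q') (w : E) : mcForm q w = mcForm q' w := by
  subst h; rfl

lemma mfderiv_mul_left_congr (a : G) {q q' : G} (h : q = q') (w : E) :
    (mfderiv 𝓘(ℝ, E) 𝓘(ℝ, E) (a * ·) q w : E) = mfderiv 𝓘(ℝ, E) 𝓘(ℝ, E) (a * ·) q' w := by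
  subst h; rfl

lemma mcForm_one (v : E) : mcForm (1 : G) v = v := by
  have h : (fun y : G ↦ (1 : G)⁻¹ * y) = id := by ext y; simp
  unfold mcForm
  rw [h, mfderiv_id]
  rfl

@[simp] lemma leftField_one (v : E) : leftField v (1 : G) = v := by
  have h : (fun y : G ↦ (1 : G) * y) = id := by ext y; simp
  unfold leftField
  rw [h, mfderiv_id]
  rfl

variable [LieGroup 𝓘(ℝ, E) ∞ G]

variable (E G) in
-- The form in which the theory of Lie brackets of vector fields requires smoothness; over ℝ it
-- means class 3.
lemma lieGroup_minSmoothness : LieGroup 𝓘(ℝ, E) (minSmoothness ℝ 3) G := by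
  refine LieGroup.of_le (n := ∞) ?_
  rw [minSmoothness_of_isRCLikeNormedField]
  exact WithTop.coe_le_coe.2 le_top

lemma mdifferentiableAt_mul_left (a x : G) :
    MDifferentiableAt 𝓘(ℝ, E) 𝓘(ℝ, E) (a * ·) x :=
  (contMDiff_mul_left (I := 𝓘(ℝ, E)) (n := ∞)).mdifferentiableAt (by simp)

lemma mfderiv_mul_left_comp (a b x : G) (u : TangentSpace 𝓘(ℝ, E) x) :
    mfderiv 𝓘(ℝ, E) 𝓘(ℝ, E) (a * ·) (b * x) (mfderiv 𝓘(ℝ, E) 𝓘(ℝ, E) (b * ·) x u) =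
      (mfderiv 𝓘(ℝ, E) 𝓘(ℝ, E) (a * b * ·) x u : E) := by
  have h : (a * b * ·) = (a * ·) ∘ (b * ·) := by ext y; simp [mul_assoc]
  rw [h, mfderiv_comp (I := 𝓘(ℝ, E)) (I' := 𝓘(ℝ, E)) (I'' := 𝓘(ℝ, E)) x
    (mdifferentiableAt_mul_left (E := E) a (b * x)) (mdifferentiableAt_mul_left (E := E) b x)]
  rfl

lemma mcForm_mfderiv_mul (a x : G) (u : TangentSpace 𝓘(ℝ, E) x) :
    mcForm (a * x) (mfderiv 𝓘(ℝ, E) 𝓘(ℝ, E) (a * ·) x u) = mcForm x u := by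
  refine (mfderiv_mul_left_comp (a * x)⁻¹ a x u).trans ?_
  rw [show (a * x)⁻¹ * a = x⁻¹ by group]
  rfl

@[simp] lemma mcForm_leftField (q : G) (v : E) : mcForm q (leftField v q) = v :=
  (mcForm_congr (mul_one q).symm _).trans ((mcForm_mfderiv_mul q 1 v).trans (mcForm_one v))

@[simp] lemma leftField_mcForm (q : G) (u : TangentSpace 𝓘(ℝ, E) q) :
    leftField (mcForm q u) q = u := by
  have h : (q * q⁻¹ * ·) = (id : G → G) := by ext y; simp
  refine (mfderiv_mul_left_congr q (inv_mul_cancel q).symm _).trans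
    ((mfderiv_mul_left_comp q q⁻¹ q u).trans ?_)
  rw [h, mfderiv_id]
  rfl

/-- The differential of the multiplication is a smooth map `TG × TG → TG`. -/
lemma contMDiff_tangentMap_mul :
    ContMDiff (𝓘(ℝ, E).tangent.prod 𝓘(ℝ, E).tangent) 𝓘(ℝ, E).tangent ∞
      (fun p : TangentBundle 𝓘(ℝ, E) G × TangentBundle 𝓘(ℝ, E) G ↦
        (⟨p.1.1 * p.2.1, mfderiv 𝓘(ℝ, E) 𝓘(ℝ, E) (· * p.2.1) p.1.1 p.1.2 +
          mfderiv 𝓘(ℝ, E) 𝓘(ℝ, E) (p.1.1 * ·) p.2.1 p.2.2⟩ : TangentBundle 𝓘(ℝ, E) G)) := by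
  have S₂ : ContMDiff (𝓘(ℝ, E).tangent.prod 𝓘(ℝ, E).tangent) (𝓘(ℝ, E).prod 𝓘(ℝ, E)).tangent ∞
    (equivTangentBundleProd 𝓘(ℝ, E) G 𝓘(ℝ, E) G).symm := contMDiff_equivTangentBundleProd_symm
  have S₃ : ContMDiff (𝓘(ℝ, E).prod 𝓘(ℝ, E)).tangent 𝓘(ℝ, E).tangent ∞
      (tangentMap (𝓘(ℝ, E).prod 𝓘(ℝ, E)) 𝓘(ℝ, E) (fun p : G × G ↦ p.1 * p.2)) :=
    ContMDiff.contMDiff_tangentMap (n := ∞) (contMDiff_mul 𝓘(ℝ, E) ∞) (by simp)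
  convert! S₃.comp S₂ using 1
  funext p
  obtain ⟨⟨g, u⟩, ⟨h, w⟩⟩ := p
  simp only [Function.comp_apply, tangentMap]
  congr 1
  rw [mfderiv_prod_eq_add_apply ((contMDiff_mul 𝓘(ℝ, E) ∞).mdifferentiableAt (by simp))]
  rfl

lemma trivializationAt_tangent_self (x : G) (w : E) :
    (trivializationAt E (TangentSpace 𝓘(ℝ, E)) x (⟨x, w⟩ : TangentBundle 𝓘(ℝ, E) G)).2 = w := by
  have := (tangentBundleCore 𝓘(ℝ, E) G).coordChange_self (achart E x) x (mem_chart_source E x) w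
  exact this

/-- The trivialization centred at `x` is the identity on the fibre over `x`. This converts between
smoothness into a single tangent space and smoothness into the tangent bundle. -/
lemma contMDiff_vertical_iff {E' H' M : Type*} [NormedAddCommGroup E'] [NormedSpace ℝ E']
    [TopologicalSpace H'] {J : ModelWithCorners ℝ E' H'} [TopologicalSpace M] [ChartedSpace H' M]
    (x : G) (f : M → E) :
    ContMDiff J 𝓘(ℝ, E).tangent ∞ (fun m ↦ (⟨x, f m⟩ : TangentBundle 𝓘(ℝ, E) G)) ↔
      ContMDiff J 𝓘(ℝ, E) ∞ f := by
  refine forall_congr' fun m ↦ (Bundle.contMDiffAt_totalSpace ..).trans ?_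
  simp only [trivializationAt_tangent_self]
  exact ⟨fun h ↦ h.2, fun h ↦ ⟨contMDiffAt_const, h⟩⟩

/-- The left-invariant field is the differential of the multiplication applied to the zero vector at
`q` and to `v` at 1. -/
lemma contMDiff_leftField_bundle :
    ContMDiff (𝓘(ℝ, E).prod 𝓘(ℝ, E)) 𝓘(ℝ, E).tangent ∞
      (fun p : G × E ↦ (⟨p.1, leftField p.2 p.1⟩ : TangentBundle 𝓘(ℝ, E) G)) := by
  have h0 : ContMDiff (𝓘(ℝ, E).prod 𝓘(ℝ, E)) 𝓘(ℝ, E).tangent ∞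
      (fun p : G × E ↦ (⟨p.1, 0⟩ : TangentBundle 𝓘(ℝ, E) G)) :=
    (Bundle.contMDiff_zeroSection ℝ (TangentSpace 𝓘(ℝ, E) : G → Type _)).comp contMDiff_fst
  have h2 : ContMDiff (𝓘(ℝ, E).prod 𝓘(ℝ, E)) 𝓘(ℝ, E) ∞ (fun p : G × E ↦ p.2) := contMDiff_snd
  have h1 : ContMDiff (𝓘(ℝ, E).prod 𝓘(ℝ, E)) 𝓘(ℝ, E).tangent ∞
      (fun p : G × E ↦ (⟨1, p.2⟩ : TangentBundle 𝓘(ℝ, E) G)) :=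
    (contMDiff_vertical_iff (J := 𝓘(ℝ, E).prod 𝓘(ℝ, E)) (1 : G) (fun p : G × E ↦ p.2)).2 h2
  convert! contMDiff_tangentMap_mul.comp (h0.prodMk h1) using 1
  funext p
  simp only [Function.comp_apply, map_zero, zero_add]
  have h (q : G) (hq : q = p.1) : (⟨p.1, leftField p.2 p.1⟩ : TangentBundle 𝓘(ℝ, E) G) =
      ⟨q, (leftField p.2 p.1 : E)⟩ := by subst hq; rfl
  exact h _ (mul_one _)

/-- The Maurer-Cartan form is smooth, as a map on the tangent bundle. -/
lemma contMDiff_mcForm_bundle :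
    ContMDiff 𝓘(ℝ, E).tangent 𝓘(ℝ, E) ∞
      (fun p : TangentBundle 𝓘(ℝ, E) G ↦ mcForm p.1 p.2) := by
  -- The form is the differential of the multiplication applied to the zero vector at the inverse
  -- point and to the given vector; the result is tangent at 1.
  have h0 : ContMDiff 𝓘(ℝ, E).tangent 𝓘(ℝ, E).tangent ∞
      (fun p : TangentBundle 𝓘(ℝ, E) G ↦ (⟨p.1⁻¹, 0⟩ : TangentBundle 𝓘(ℝ, E) G)) :=
    (Bundle.contMDiff_zeroSection ℝ (TangentSpace 𝓘(ℝ, E) : G → Type _)).comp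
      ((contMDiff_inv 𝓘(ℝ, E) ∞).comp (Bundle.contMDiff_proj _))
  refine (contMDiff_vertical_iff (1 : G) _).1 ?_
  convert! contMDiff_tangentMap_mul.comp (h0.prodMk contMDiff_id) using 1
  funext p
  simp only [Function.comp_apply, map_zero, zero_add]
  have h (q : G) (hq : q = 1) : (⟨1, (mcForm p.1 p.2 : E)⟩ : TangentBundle 𝓘(ℝ, E) G) =
      ⟨q, (mcForm p.1 p.2 : E)⟩ := by subst hq; rfl
  exact h _ (inv_mul_cancel _)

lemma contMDiff_leftField (v : E) : CMDiff ∞ (T% (leftField (G := G) v)) :=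
  contMDiff_leftField_bundle.comp (contMDiff_id.prodMk contMDiff_const)

lemma mdifferentiableAt_leftField (v : E) (q : G) : MDiffAt (T% (leftField (G := G) v)) q :=
  (contMDiff_leftField v).mdifferentiableAt (by simp)

lemma contMDiff_mcForm_apply {Y : Π q : G, TangentSpace 𝓘(ℝ, E) q} (hY : CMDiff ∞ (T% Y)) :
    CMDiff ∞ (fun q ↦ mcForm q (Y q)) :=
  contMDiff_mcForm_bundle.comp hY

lemma mdifferentiableAt_mcForm_apply {Y : Π q : G, TangentSpace 𝓘(ℝ, E) q} {q : G}
    (hY : MDiffAt (T% Y) q) : MDiffAt (fun q ↦ mcForm q (Y q)) q :=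
  (contMDiff_mcForm_bundle.mdifferentiableAt (by simp)).comp q hY

variable [CompleteSpace E]

lemma mlieBracket_leftField (u v : E) (q : G) :
    mlieBracket 𝓘(ℝ, E) (leftField u) (leftField v) q = leftField (lieBr G u v) q := by
  have := lieGroup_minSmoothness E G
  exact (congrFun (mulInvariantVector_mlieBracket (I := 𝓘(ℝ, E)) (G := G) u v) q).symm

end LeftInvariant

end

section


/-! ### Lie brackets as commutators of derivations on a manifold. -/

section Commutator

open VectorField

variable {E : Type*} [NormedAddCommGroup E] [NormedSpace ℝ E]
  {M : Type*} [TopologicalSpace M] [ChartedSpace E M]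
  {F : Type*} [NormedAddCommGroup F] [NormedSpace ℝ F]

lemma mvfderiv_apply_mfderiv {h : M → F} {σ : E → M} {y : E}
    (hh : MDifferentiableAt 𝓘(ℝ, E) 𝓘(ℝ, F) h (σ y))
    (hσ : MDifferentiableAt 𝓘(ℝ, E) 𝓘(ℝ, E) σ y) (w : E) :
    mvfderiv 𝓘(ℝ, E) h (σ y) (mfderiv 𝓘(ℝ, E) 𝓘(ℝ, E) σ y w) = fderiv ℝ (h ∘ σ) y w := by
  rw [← mfderiv_eq_fderiv, mfderiv_comp (I' := 𝓘(ℝ, E)) y hh hσ]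
  rfl

variable [IsManifold 𝓘(ℝ, E) ∞ M]

lemma isInvertible_mfderiv_extChartAt_symm (p : M) {y : E} (hy : y ∈ (extChartAt 𝓘(ℝ, E) p).target) :
    (mfderiv 𝓘(ℝ, E) 𝓘(ℝ, E) (extChartAt 𝓘(ℝ, E) p).symm y).IsInvertible := by
  have : IsManifold 𝓘(ℝ, E) 1 M := IsManifold.of_le (n := ∞) (by simp)
  have := isInvertible_mfderivWithin_extChartAt_symm (I := 𝓘(ℝ, E)) hy
  simpa [modelWithCornersSelf_coe, Set.range_id, mfderivWithin_univ] using this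

lemma contMDiffAt_extChartAt_symm (p : M) {y : E} (hy : y ∈ (extChartAt 𝓘(ℝ, E) p).target) :
    ContMDiffAt 𝓘(ℝ, E) 𝓘(ℝ, E) ∞ (extChartAt 𝓘(ℝ, E) p).symm y :=
  (contMDiffOn_extChartAt_symm p).contMDiffAt
    ((isOpen_extChartAt_target p).mem_nhds hy)

lemma differentiableAt_of_mdifferentiableAt_section {X : Π y : E, TangentSpace 𝓘(ℝ, E) y} {y : E}
    (hX : MDiffAt (T% X) y) : DifferentiableAt ℝ (X : E → E) y := by
  refine mdifferentiableAt_iff_differentiableAt.1 ?_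
  exact ((contMDiff_snd_tangentBundle_modelSpace E 𝓘(ℝ, E) (n := 1)).contMDiffAt.mdifferentiableAt
    one_ne_zero).comp y hX

lemma mlieBracket_eq_lieBracket (X Y : E → E) (y : E) :
    (mlieBracket 𝓘(ℝ, E) X Y y : E) = lieBracket ℝ X Y y := by
  rw [← lieBracketWithin_univ]
  exact (congrFun (mlieBracketWithin_univ (I := 𝓘(ℝ, E)) (V := X) (W := Y)).symm y).trans
    (congrFun mlieBracketWithin_eq_lieBracketWithin y)

variable [CompleteSpace E]

/-- Pulling everything back along `σ` reduces the identity to vector fields on `E`, where it is the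
symmetry of the second derivative. Keeping `σ` and `κ` abstract avoids base points of the form `σ (κ
x)`. -/
lemma mvfderiv_mlieBracket_of_parametrization {σ : E → M} {κ : M → E} {y₀ : E}
    (hσ : ∀ᶠ y in 𝓝 y₀, ContMDiffAt 𝓘(ℝ, E) 𝓘(ℝ, E) ∞ σ y ∧
      (mfderiv 𝓘(ℝ, E) 𝓘(ℝ, E) σ y).IsInvertible)
    (hκ : MDifferentiableAt 𝓘(ℝ, E) 𝓘(ℝ, E) κ (σ y₀)) (hκσ : ∀ᶠ y in 𝓝 y₀, κ (σ y) = y)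
    (hσκ : ∀ᶠ q in 𝓝 (σ y₀), σ (κ q) = q)
    {f : M → F} {X Y : Π q : M, TangentSpace 𝓘(ℝ, E) q}
    (hf : CMDiffAt 2 f (σ y₀)) (hX : MDiffAt (T% X) (σ y₀)) (hY : MDiffAt (T% Y) (σ y₀)) :
    mvfderiv 𝓘(ℝ, E) f (σ y₀) (mlieBracket 𝓘(ℝ, E) X Y (σ y₀)) =
      mvfderiv 𝓘(ℝ, E) (fun q ↦ mvfderiv 𝓘(ℝ, E) f q (Y q)) (σ y₀) (X (σ y₀)) -
        mvfderiv 𝓘(ℝ, E) (fun q ↦ mvfderiv 𝓘(ℝ, E) f q (X q)) (σ y₀) (Y (σ y₀)) := by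
  have : IsManifold 𝓘(ℝ, E) (minSmoothness ℝ 3) M := by
    refine IsManifold.of_le (n := ∞) ?_
    rw [minSmoothness_of_isRCLikeNormedField]
    exact WithTop.coe_le_coe.2 le_top
  have : IsManifold 𝓘(ℝ, E) 2 M := IsManifold.of_le (n := ∞) (WithTop.coe_le_coe.2 le_top)
  have : IsManifold 𝓘(ℝ, E) 1 M := IsManifold.of_le (n := ∞) (by simp)
  obtain ⟨hσ₀, hinv₀⟩ := hσ.self_of_nhds
  have hinv (Z : Π q : M, TangentSpace 𝓘(ℝ, E) q) : ∀ᶠ y in 𝓝 y₀,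
      (mfderiv 𝓘(ℝ, E) 𝓘(ℝ, E) σ y (mpullback 𝓘(ℝ, E) 𝓘(ℝ, E) σ Z y) : E) = Z (σ y) := by
    filter_upwards [hσ] with y hy
    rw [mpullback_apply]
    exact hy.2.self_apply_inverse _
  have hdiff (Z : Π q : M, TangentSpace 𝓘(ℝ, E) q) (hZ : MDiffAt (T% Z) (σ y₀)) :
      DifferentiableAt ℝ (mpullback 𝓘(ℝ, E) 𝓘(ℝ, E) σ Z : E → E) y₀ := by
    apply differentiableAt_of_mdifferentiableAt_section
    exact MDifferentiableAt.mpullback_vectorField (n := ∞) hZ hσ₀ hinv₀ (WithTop.coe_le_coe.2 le_top)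
  have hfσ : ContDiffAt ℝ 2 (f ∘ σ) y₀ :=
    (ContMDiffAt.comp (I' := 𝓘(ℝ, E)) y₀ hf (hσ₀.of_le (WithTop.coe_le_coe.2 le_top))).contDiffAt
  have hfev : ∀ᶠ y in 𝓝 y₀, MDifferentiableAt 𝓘(ℝ, E) 𝓘(ℝ, F) f (σ y) := by
    have h1 : ∀ᶠ q in 𝓝 (σ y₀), ContMDiffAt 𝓘(ℝ, E) 𝓘(ℝ, F) 2 f q :=
      contMDiffAt_iff_contMDiffAt_nhds (by simp) |>.1 hf
    filter_upwards [hσ₀.continuousAt.eventually h1] with y hy using hy.mdifferentiableAt (by simp)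
  have hk (Z : Π q : M, TangentSpace 𝓘(ℝ, E) q) : ∀ᶠ y in 𝓝 y₀,
      mvfderiv 𝓘(ℝ, E) f (σ y) (Z (σ y)) =
        fderiv ℝ (f ∘ σ) y (mpullback 𝓘(ℝ, E) 𝓘(ℝ, E) σ Z y) := by
    filter_upwards [hσ, hinv Z, hfev] with y hy hZ hfy
    exact (congrArg (mvfderiv 𝓘(ℝ, E) f (σ y)) hZ.symm).trans
      (mvfderiv_apply_mfderiv hfy (hy.1.mdifferentiableAt (by simp)) _)
  have main (Z W : Π q : M, TangentSpace 𝓘(ℝ, E) q) (hZ : MDiffAt (T% Z) (σ y₀)) :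
      mvfderiv 𝓘(ℝ, E) (fun q ↦ mvfderiv 𝓘(ℝ, E) f q (Z q)) (σ y₀) (W (σ y₀)) =
      fderiv ℝ (fun y ↦ fderiv ℝ (f ∘ σ) y (mpullback 𝓘(ℝ, E) 𝓘(ℝ, E) σ Z y)) y₀
        (mpullback 𝓘(ℝ, E) 𝓘(ℝ, E) σ W y₀) := by
    have hd : DifferentiableAt ℝ
        (fun y ↦ fderiv ℝ (f ∘ σ) y (mpullback 𝓘(ℝ, E) 𝓘(ℝ, E) σ Z y)) y₀ :=
      ((hfσ.fderiv_right (m := 1) (by norm_num)).differentiableAt (by simp)).clm_apply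
        (hdiff Z hZ)
    have hκ₀ : κ (σ y₀) = y₀ := hκσ.self_of_nhds
    -- The chain rule needs this differentiability beforehand; near the point the function is its
    -- own coordinate expression composed with `κ`.
    have hm : MDifferentiableAt 𝓘(ℝ, E) 𝓘(ℝ, F)
        (fun q ↦ mvfderiv 𝓘(ℝ, E) f q (Z q)) (σ y₀) := by
      have h1 : MDifferentiableAt 𝓘(ℝ, E) 𝓘(ℝ, F) ((fun y ↦ fderiv ℝ (f ∘ σ) y
          (mpullback 𝓘(ℝ, E) 𝓘(ℝ, E) σ Z y)) ∘ κ) (σ y₀) := by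
        refine MDifferentiableAt.comp (I' := 𝓘(ℝ, E)) _ ?_ hκ
        rw [hκ₀]
        exact hd.mdifferentiableAt
      refine h1.congr_of_eventuallyEq ?_
      have h2 := hκ.continuousAt.eventually (f := κ) (by rw [hκ₀]; exact hk Z)
      filter_upwards [h2, hσκ] with q hq hq'
      rw [Function.comp_apply, ← hq, hq']
    have h3 := Filter.EventuallyEq.fderiv_eq (𝕜 := ℝ) (hk Z)
    refine Eq.trans ?_ ((mvfderiv_apply_mfderiv hm (hσ₀.mdifferentiableAt (by simp)) _).trans
      (congrArg (fun T : E →L[ℝ] F ↦ T (mpullback 𝓘(ℝ, E) 𝓘(ℝ, E) σ W y₀)) h3))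
    exact congrArg (mvfderiv 𝓘(ℝ, E) (fun q ↦ mvfderiv 𝓘(ℝ, E) f q (Z q)) (σ y₀))
      (hinv W).self_of_nhds.symm
  rw [main Y X hY, main X Y hX, (hk (mlieBracket 𝓘(ℝ, E) X Y)).self_of_nhds,
    mpullback_mlieBracket (n := ∞) hX hY hσ₀ (by
      rw [minSmoothness_of_isRCLikeNormedField]; exact WithTop.coe_le_coe.2 le_top)]
  refine (congrArg (fderiv ℝ (f ∘ σ) y₀) (mlieBracket_eq_lieBracket _ _ _)).trans ?_
  exact fderiv_apply_lieBracket hfσ (by rw [minSmoothness_of_isRCLikeNormedField]) (hdiff Y hY)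
    (hdiff X hX)

/-- The derivative along a Lie bracket is the commutator of the derivatives. -/
lemma mvfderiv_mlieBracket {f : M → F} {X Y : Π q : M, TangentSpace 𝓘(ℝ, E) q} {x : M}
    (hf : CMDiffAt 2 f x) (hX : MDiffAt (T% X) x) (hY : MDiffAt (T% Y) x) :
    mvfderiv 𝓘(ℝ, E) f x (mlieBracket 𝓘(ℝ, E) X Y x) =
      mvfderiv 𝓘(ℝ, E) (fun q ↦ mvfderiv 𝓘(ℝ, E) f q (Y q)) x (X x) -
        mvfderiv 𝓘(ℝ, E) (fun q ↦ mvfderiv 𝓘(ℝ, E) f q (X q)) x (Y x) := by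
  have hy₀ : extChartAt 𝓘(ℝ, E) x x ∈ (extChartAt 𝓘(ℝ, E) x).target := mem_extChartAt_target x
  have hx : (extChartAt 𝓘(ℝ, E) x).symm (extChartAt 𝓘(ℝ, E) x x) = x := extChartAt_to_inv x
  have htarget := (isOpen_extChartAt_target (I := 𝓘(ℝ, E)) x).mem_nhds hy₀
  have hsource := extChartAt_source_mem_nhds (I := 𝓘(ℝ, E)) x
  have hκ : MDifferentiableAt 𝓘(ℝ, E) 𝓘(ℝ, E) (extChartAt 𝓘(ℝ, E) x) x :=
    mdifferentiableAt_extChartAt (mem_chart_source E x)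
  have key (σ : E → M) (κ : M → E) (y₀ : E)
      (h1 : ∀ᶠ y in 𝓝 y₀, ContMDiffAt 𝓘(ℝ, E) 𝓘(ℝ, E) ∞ σ y ∧
        (mfderiv 𝓘(ℝ, E) 𝓘(ℝ, E) σ y).IsInvertible)
      (h2 : MDifferentiableAt 𝓘(ℝ, E) 𝓘(ℝ, E) κ x) (h3 : ∀ᶠ y in 𝓝 y₀, κ (σ y) = y)
      (h4 : ∀ᶠ q in 𝓝 x, σ (κ q) = q) (hx : σ y₀ = x) :
      mvfderiv 𝓘(ℝ, E) f x (mlieBracket 𝓘(ℝ, E) X Y x) =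
        mvfderiv 𝓘(ℝ, E) (fun q ↦ mvfderiv 𝓘(ℝ, E) f q (Y q)) x (X x) -
          mvfderiv 𝓘(ℝ, E) (fun q ↦ mvfderiv 𝓘(ℝ, E) f q (X q)) x (Y x) := by
    subst hx
    exact mvfderiv_mlieBracket_of_parametrization h1 h2 h3 h4 hf hX hY
  refine key (extChartAt 𝓘(ℝ, E) x).symm (extChartAt 𝓘(ℝ, E) x) (extChartAt 𝓘(ℝ, E) x x)
    ?_ hκ ?_ ?_ hx
  · filter_upwards [htarget] with y hy using
      ⟨contMDiffAt_extChartAt_symm x hy, isInvertible_mfderiv_extChartAt_symm x hy⟩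
  · filter_upwards [htarget] with y hy using (extChartAt 𝓘(ℝ, E) x).right_inv hy
  · filter_upwards [hsource] with q hq using (extChartAt 𝓘(ℝ, E) x).left_inv hq

end Commutator

/-! ### The Maurer-Cartan equation. -/

section MaurerCartan

open VectorField

variable {E : Type*} [NormedAddCommGroup E] [NormedSpace ℝ E] [FiniteDimensional ℝ E]
  {G : Type*} [TopologicalSpace G] [ChartedSpace E G] [Group G] [LieGroup 𝓘(ℝ, E) ∞ G]

variable (G) in
lemma lieBr_swap (u v : E) : lieBr G u v = - lieBr G v u := by
  unfold lieBr
  exact mlieBracket_swap_apply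

lemma leftField_add (u v : E) :
    leftField (G := G) (u + v) = leftField u + leftField v := by
  funext q; exact map_add _ _ _

lemma leftField_smul (c : ℝ) (v : E) :
    leftField (G := G) (c • v) = c • leftField v := by
  funext q; exact map_smul _ _ _

variable (E G) in
/-- The bracket of the Lie algebra of `G` as a bilinear map. -/
def lieBrₗ : E →ₗ[ℝ] E →ₗ[ℝ] E :=
  have := FiniteDimensional.complete ℝ E
  have := lieGroup_minSmoothness E G
  have hadd (u v w : E) : lieBr G (u + v) w = lieBr G u w + lieBr G v w := by
    unfold lieBr
    rw [leftField_add]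
    exact mlieBracket_add_left (mdifferentiableAt_leftField u 1) (mdifferentiableAt_leftField v 1)
  have hsmul (c : ℝ) (u w : E) : lieBr G (c • u) w = c • lieBr G u w := by
    unfold lieBr
    rw [leftField_smul]
    exact mlieBracket_const_smul_left (mdifferentiableAt_leftField u 1)
  LinearMap.mk₂ ℝ (lieBr G) hadd hsmul
    (fun u v w ↦ by rw [lieBr_swap, hadd, neg_add, ← lieBr_swap, ← lieBr_swap])
    (fun c u v ↦ by rw [lieBr_swap, hsmul, ← smul_neg, ← lieBr_swap])

/-- The Maurer-Cartan equation, with the terms coming from the derivatives of the vector fields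
left out. -/
def mcDefect (x : G) (X Y : Π q : G, TangentSpace 𝓘(ℝ, E) q) : E :=
  mcForm x (mlieBracket 𝓘(ℝ, E) X Y x) - mvfderiv 𝓘(ℝ, E) (fun q ↦ mcForm q (Y q)) x (X x) +
    mvfderiv 𝓘(ℝ, E) (fun q ↦ mcForm q (X q)) x (Y x)

lemma mcDefect_swap (x : G) (X Y : Π q : G, TangentSpace 𝓘(ℝ, E) q) :
    mcDefect x X Y = - mcDefect x Y X := by
  have h : mcForm x (mlieBracket 𝓘(ℝ, E) X Y x) = - mcForm x (mlieBracket 𝓘(ℝ, E) Y X x) := by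
    rw [mlieBracket_swap_apply, map_neg]
  unfold mcDefect
  rw [h]
  abel

lemma mcDefect_add_left {x : G} {X X' Y : Π q : G, TangentSpace 𝓘(ℝ, E) q}
    (hX : MDiffAt (T% X) x) (hX' : MDiffAt (T% X') x) :
    mcDefect x (X + X') Y = mcDefect x X Y + mcDefect x X' Y := by
  have := FiniteDimensional.complete ℝ E
  have := lieGroup_minSmoothness E G
  have h1 : mcForm x (mlieBracket 𝓘(ℝ, E) (X + X') Y x) = mcForm x (mlieBracket 𝓘(ℝ, E) X Y x) +
      mcForm x (mlieBracket 𝓘(ℝ, E) X' Y x) := by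
    rw [mlieBracket_add_left hX hX', map_add]
  have h2 : mvfderiv 𝓘(ℝ, E) (fun q ↦ mcForm q ((X + X') q)) x =
      mvfderiv 𝓘(ℝ, E) (fun q ↦ mcForm q (X q)) x + mvfderiv 𝓘(ℝ, E) (fun q ↦ mcForm q (X' q)) x := by
    rw [← mvfderiv_add (mdifferentiableAt_mcForm_apply hX) (mdifferentiableAt_mcForm_apply hX')]
    congr 1
    funext q
    exact map_add _ _ _
  have h3 : mvfderiv 𝓘(ℝ, E) (fun q ↦ mcForm q (Y q)) x ((X + X') x) =
      mvfderiv 𝓘(ℝ, E) (fun q ↦ mcForm q (Y q)) x (X x) +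
      mvfderiv 𝓘(ℝ, E) (fun q ↦ mcForm q (Y q)) x (X' x) := map_add _ _ _
  unfold mcDefect
  rw [h1, h2, h3, add_apply]
  abel

lemma mcDefect_smul_left {x : G} {f : G → ℝ} {X Y : Π q : G, TangentSpace 𝓘(ℝ, E) q}
    (hf : MDiffAt f x) (hX : MDiffAt (T% X) x) :
    mcDefect x (f • X) Y = f x • mcDefect x X Y := by
  have := FiniteDimensional.complete ℝ E
  have := lieGroup_minSmoothness E G
  have h1 : mcForm x (mlieBracket 𝓘(ℝ, E) (f • X) Y x) =
      - mvfderiv 𝓘(ℝ, E) f x (Y x) • mcForm x (X x) +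
        f x • mcForm x (mlieBracket 𝓘(ℝ, E) X Y x) := by
    rw [mlieBracket_smul_left hf hX, map_add, map_smul, map_smul]
  have h2 : mvfderiv 𝓘(ℝ, E) (fun q ↦ mcForm q ((f • X) q)) x =
      f x • mvfderiv 𝓘(ℝ, E) (fun q ↦ mcForm q (X q)) x +
        (mvfderiv 𝓘(ℝ, E) f x).smulRight (mcForm x (X x)) := by
    rw [← mvfderiv_smul hf (mdifferentiableAt_mcForm_apply hX)]
    congr 1
    funext q
    exact map_smul _ _ _
  have h3 : mvfderiv 𝓘(ℝ, E) (fun q ↦ mcForm q (Y q)) x ((f • X) x) =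
      f x • mvfderiv 𝓘(ℝ, E) (fun q ↦ mcForm q (Y q)) x (X x) := map_smul _ _ _
  unfold mcDefect
  rw [h1, h2, h3, add_apply, ContinuousLinearMap.smulRight_apply,
    smul_apply]
  module

/-- The Maurer-Cartan equation. -/
lemma mcForm_mlieBracket {x : G} {X Y : Π q : G, TangentSpace 𝓘(ℝ, E) q}
    (hX : MDiffAt (T% X) x) (hY : MDiffAt (T% Y) x) :
    mcForm x (mlieBracket 𝓘(ℝ, E) X Y x) =
      mvfderiv 𝓘(ℝ, E) (fun q ↦ mcForm q (Y q)) x (X x) -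
        mvfderiv 𝓘(ℝ, E) (fun q ↦ mcForm q (X q)) x (Y x) +
          lieBr G (mcForm x (X x)) (mcForm x (Y x)) := by
  have := FiniteDimensional.complete ℝ E
  have : IsManifold 𝓘(ℝ, E) 1 G := IsManifold.of_le (n := ∞) (by simp)
  -- The defect is tensorial in both fields, so they may be replaced by left-invariant ones with the
  -- same values at `x`. On those the form is constant and only the bracket survives.
  have key := TensorialAt.pointwise₂ (I := 𝓘(ℝ, E)) (F := E) (F' := E)
    (V := (TangentSpace 𝓘(ℝ, E) : G → Type _)) (V' := (TangentSpace 𝓘(ℝ, E) : G → Type _))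
    (Φ := mcDefect x) (x := x)
    (σ := X) (σ' := leftField (mcForm x (X x))) (τ := Y) (τ' := leftField (mcForm x (Y x)))
    (fun Y _ ↦ ⟨fun hf hX ↦ mcDefect_smul_left hf hX, fun hX hX' ↦ mcDefect_add_left hX hX'⟩)
    (fun X _ ↦ ⟨fun hf hY ↦ by
        rw [mcDefect_swap, mcDefect_smul_left hf hY, ← smul_neg, ← mcDefect_swap],
      fun hY hY' ↦ by
        rw [mcDefect_swap, mcDefect_add_left hY hY', neg_add, ← mcDefect_swap, ← mcDefect_swap]⟩)
    hX (mdifferentiableAt_leftField _ _) hY (mdifferentiableAt_leftField _ _)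
    (leftField_mcForm _ _).symm (leftField_mcForm _ _).symm
  have h : mcDefect x (leftField (mcForm x (X x))) (leftField (mcForm x (Y x))) =
      lieBr G (mcForm x (X x)) (mcForm x (Y x)) := by
    unfold mcDefect
    rw [mlieBracket_leftField, mcForm_leftField]
    simp only [mcForm_leftField, mvfderiv_const]
    exact (congrArg₂ (· + ·) (sub_zero _) rfl).trans (add_zero _)
  rw [← h, ← key]
  unfold mcDefect
  abel

end MaurerCartan

end

section


/-! ### From a left-invariant contact form to a linear form on the Lie algebra. -/

section Contact

open VectorField

variable {E : Type*} [NormedAddCommGroup E] [NormedSpace ℝ E]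

lemma mvfderiv_clm_comp {M F F' : Type*} [TopologicalSpace M] [ChartedSpace E M]
    [NormedAddCommGroup F] [NormedSpace ℝ F] [NormedAddCommGroup F'] [NormedSpace ℝ F']
    (T : F →L[ℝ] F') {g : M → F} {x : M} (hg : MDiffAt g x) (w : TangentSpace 𝓘(ℝ, E) x) :
    mvfderiv 𝓘(ℝ, E) (fun q ↦ T (g q)) x w = T (mvfderiv 𝓘(ℝ, E) g x w) := by
  have h := mfderiv_comp (I := 𝓘(ℝ, E)) (I' := 𝓘(ℝ, F)) (I'' := 𝓘(ℝ, F')) x (g := T) (f := g)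
    T.differentiableAt.mdifferentiableAt hg
  have h' := congrArg (fun S : TangentSpace 𝓘(ℝ, E) x →L[ℝ] F' ↦ S w) h
  refine h'.trans ?_
  rw [mfderiv_eq_fderiv, ContinuousLinearMap.fderiv]
  rfl

variable [FiniteDimensional ℝ E]
  {G : Type*} [TopologicalSpace G] [ChartedSpace E G] [Group G] [LieGroup 𝓘(ℝ, E) ∞ G]

lemma eq_mcForm_of_leftInvariant {η : Π p : G, TangentSpace 𝓘(ℝ, E) p →L[ℝ] ℝ}
    (hη : ∀ (a x : G) (u : TangentSpace 𝓘(ℝ, E) x),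
      η (a * x) (mfderiv 𝓘(ℝ, E) 𝓘(ℝ, E) (a * ·) x u) = η x u)
    (q : G) (u : TangentSpace 𝓘(ℝ, E) q) : η q u = η 1 (mcForm q u : E) := by
  have h (p : G) (hp : p = 1) (w : E) : η p w = η 1 w := by subst hp; rfl
  rw [← hη q⁻¹ q u]
  exact h _ (inv_mul_cancel q) _

/-- Apply `α` to the Maurer-Cartan equation: the derivative terms cancel. Hence the exterior
derivative of a left-invariant form is minus its value on the bracket. -/
lemma deriv_sub_deriv_sub_eq (α : E →L[ℝ] ℝ) {U V : Π p : G, TangentSpace 𝓘(ℝ, E) p} {p : G}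
    (hU : MDiffAt (T% U) p) (hV : MDiffAt (T% V) p) :
    mvfderiv 𝓘(ℝ, E) (fun q ↦ α (mcForm q (V q))) p (U p) -
      mvfderiv 𝓘(ℝ, E) (fun q ↦ α (mcForm q (U q))) p (V p) -
      α (mcForm p (mlieBracket 𝓘(ℝ, E) U V p)) =
    - α (lieBr G (mcForm p (U p)) (mcForm p (V p))) := by
  rw [mvfderiv_clm_comp α (mdifferentiableAt_mcForm_apply hV),
    mvfderiv_clm_comp α (mdifferentiableAt_mcForm_apply hU), mcForm_mlieBracket hU hV, map_add,
    map_sub]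
  abel

lemma extDerivOneForm_leftInvariant {η : Π p : G, TangentSpace 𝓘(ℝ, E) p →L[ℝ] ℝ}
    (α : E →L[ℝ] ℝ) (hη : ∀ q u, η q u = α (mcForm q u)) (p : G) (u v : TangentSpace 𝓘(ℝ, E) p) :
    extDerivOneForm 𝓘(ℝ, E) η p u v = - α (lieBr G (mcForm p u) (mcForm p v)) := by
  have : IsManifold 𝓘(ℝ, E) 1 G := IsManifold.of_le (n := ∞) (by simp)
  unfold extDerivOneForm
  simp only [hη]
  have h := deriv_sub_deriv_sub_eq α
    (FiberBundle.mdifferentiableAt_extend (I := 𝓘(ℝ, E)) (F := E) (σ₀ := u))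
    (FiberBundle.mdifferentiableAt_extend (I := 𝓘(ℝ, E)) (F := E) (σ₀ := v))
  rw [FiberBundle.extend_apply_self, FiberBundle.extend_apply_self] at h
  exact h

/-- A left invariant contact form restricts to a linear form on the Lie algebra which is
nondegenerate in the following sense. -/
lemma HasLeftInvariantContactForm.exists_linearForm (h : HasLeftInvariantContactForm 𝓘(ℝ, E) G) :
    ∃ α : E →ₗ[ℝ] ℝ, ∀ x, α x = 0 → (∀ y, α (lieBr G x y) = 0) → x = 0 := by
  obtain ⟨n, η, hη, hn, hc⟩ := h
  obtain ⟨v, hv⟩ := hc 1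
  let α : E →L[ℝ] ℝ := η 1
  have hα : ∀ q u, η q u = α (mcForm q u) := eq_mcForm_of_leftInvariant hη
  refine ⟨α, fun x hx hx' ↦ ?_⟩
  have hd (u v : E) : extDerivOneForm 𝓘(ℝ, E) η (1 : G) u v = - α (lieBr G u v) := by
    refine (extDerivOneForm_leftInvariant α hα 1 u v).trans ?_
    rw [mcForm_one, mcForm_one]
  let Ω : E →ₗ[ℝ] E →ₗ[ℝ] ℝ := -((lieBrₗ E G).compr₂ (α : E →ₗ[ℝ] ℝ))
  have hΩ (x y : E) : Ω x y = - α (lieBr G x y) := rfl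
  refine eq_zero_of_radical hn α Ω (fun x y ↦ by rw [hΩ, hΩ, lieBr_swap, map_neg]) v ?_ hx
    (fun y ↦ by rw [hΩ]; exact neg_eq_zero.2 (hx' y))
  -- The normalizing power of 2 in `contactVolume` is dropped.
  refine fun h0 ↦ right_ne_zero_of_mul hv (Eq.trans ?_ h0)
  refine Finset.sum_congr rfl fun σ _ ↦ ?_
  congr 2
  exact Finset.prod_congr rfl fun i _ ↦ hd _ _

end Contact

end

section


/-! ### From a flat left-invariant metric to the Lie algebra. -/

open VectorField

lemma exists_motion_coordinates_of_bilin {V : Type*} [AddCommGroup V] [Module ℝ V]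
    [FiniteDimensional ℝ V] (B : V →ₗ[ℝ] V →ₗ[ℝ] ℝ) (symm : ∀ x y, B x y = B y x)
    (pos : ∀ x, x ≠ 0 → 0 < B x x) (L : V →ₗ[ℝ] V →ₗ[ℝ] V)
    (skew : ∀ x y z, B (L x y) z = - B y (L x z))
    (flat : ∀ x y z, L (L x y - L y x) z = L x (L y z) - L y (L x z))
    (hV : 2 ≤ Module.finrank ℝ V) (α : V →ₗ[ℝ] ℝ)
    (hα : ∀ x, α x = 0 → (∀ y, α (L x y - L y x) = 0) → x = 0) :
    ∃ (ζ : V →ₗ[ℝ] ℂ) (τ : V →ₗ[ℝ] ℝ), (∀ x, ζ x = 0 → τ x = 0 → x = 0) ∧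
      (∀ x y, ζ (L x y - L y x) = Complex.I * (τ x * ζ y - τ y * ζ x)) ∧
      (∀ x y, τ (L x y - L y x) = 0) := by
  let c := innerCore B symm pos
  let : NormedAddCommGroup V := c.toNormedAddCommGroup
  let : InnerProductSpace ℝ V := .ofCore c.toCore
  exact IsFlatProduct.exists_motion_coordinates (L := L) ⟨skew, flat⟩ hV α hα

/-- The algebra behind uniqueness of the Levi-Civita connection: a trilinear expression symmetric in
its first two arguments and skew in its last two equals its own negative. -/
lemma eq_zero_of_symm_of_skew {V : Type*} [AddCommGroup V] [Module ℝ V]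
    (B : V →ₗ[ℝ] V →ₗ[ℝ] ℝ) (symm : ∀ x y, B x y = B y x) (pos : ∀ x, x ≠ 0 → 0 < B x x)
    (D : V → V → V) (hD : ∀ x y, D x y = D y x) (skew : ∀ x y z, B (D x y) z = - B y (D x z))
    (x y : V) : D x y = 0 := by
  have h (z : V) : B (D x y) z = 0 := by
    have : B (D x y) z = - B (D x y) z := by
      calc B (D x y) z = - B y (D z x) := by rw [skew, hD x z]
        _ = B x (D y z) := by rw [symm y, skew, hD z y, neg_neg]
        _ = - B (D x y) z := by rw [hD x y, skew, neg_neg]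
    linarith
  by_contra hne
  exact (pos _ hne).ne' (h _)

variable {E : Type*} [NormedAddCommGroup E] [NormedSpace ℝ E]
  {G : Type*} [TopologicalSpace G] [ChartedSpace E G] [Group G]

variable (G) in
/-- The Lie algebra of `G` embeds into the Lie algebra `ℂ ⋊ ℝ` of the group of motions of the
plane, by the maps `ζ` and `τ`. -/
structure IsMotionCoordinates (ζ : E →ₗ[ℝ] ℂ) (τ : E →ₗ[ℝ] ℝ) : Prop where
  eq_zero : ∀ x, ζ x = 0 → τ x = 0 → x = 0
  map_lieBr_fst : ∀ x y, ζ (lieBr G x y) = Complex.I * (τ x * ζ y - τ y * ζ x)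
  map_lieBr_snd : ∀ x y, τ (lieBr G x y) = 0

variable [FiniteDimensional ℝ E]

lemma IsMotionCoordinates.finrank_le {ζ : E →ₗ[ℝ] ℂ} {τ : E →ₗ[ℝ] ℝ}
    (h : IsMotionCoordinates G ζ τ) : Module.finrank ℝ E ≤ 3 := by
  have hinj : Function.Injective (ζ.prod τ) := by
    refine (injective_iff_map_eq_zero _).2 fun x hx ↦ ?_
    exact h.eq_zero x (congrArg Prod.fst hx) (congrArg Prod.snd hx)
  have := LinearMap.finrank_le_finrank_of_injective hinj
  rwa [Module.finrank_prod, Complex.finrank_real_complex, Module.finrank_self] at this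

variable [LieGroup 𝓘(ℝ, E) ∞ G]

/-- The covariant derivatives of the left invariant vector fields. -/
def connForm (cov : CovariantDerivative 𝓘(ℝ, E) E (TangentSpace 𝓘(ℝ, E) : G → Type _)) (q : G)
    (x y : E) : E :=
  mcForm q (cov (leftField y) q (leftField x q))

lemma leftField_connForm
    (cov : CovariantDerivative 𝓘(ℝ, E) E (TangentSpace 𝓘(ℝ, E) : G → Type _)) (q : G) (x y : E) :
    leftField (connForm cov q x y) q = cov (leftField y) q (leftField x q) :=
  leftField_mcForm q _

/-- The covariant derivative of left invariant vector fields at `1` as a bilinear map. -/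
def connFormₗ (cov : CovariantDerivative 𝓘(ℝ, E) E (TangentSpace 𝓘(ℝ, E) : G → Type _)) :
    E →ₗ[ℝ] E →ₗ[ℝ] E :=
  LinearMap.mk₂ ℝ (connForm cov 1)
    (fun x x' y ↦ by
      unfold connForm
      rw [leftField_add, Pi.add_apply, map_add, map_add])
    (fun c x y ↦ by
      unfold connForm
      rw [leftField_smul, Pi.smul_apply, map_smul, map_smul])
    (fun x y y' ↦ by
      unfold connForm
      rw [leftField_add, cov.isCovariantDerivativeOnUniv.add (mdifferentiableAt_leftField y 1)
        (mdifferentiableAt_leftField y' 1), add_apply, map_add])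
    (fun c x y ↦ by
      unfold connForm
      rw [leftField_smul, cov.isCovariantDerivativeOnUniv.smul_const c
        (mdifferentiableAt_leftField y 1), smul_apply, map_smul])

variable {g : Bundle.ContMDiffRiemannianMetric 𝓘(ℝ, E) ∞ E (TangentSpace 𝓘(ℝ, E) : G → Type _)}
  {cov : CovariantDerivative 𝓘(ℝ, E) E (TangentSpace 𝓘(ℝ, E) : G → Type _)}

lemma IsLeviCivita.connForm_sub (h : IsLeviCivita g cov) (q : G) (x y : E) :
    connForm cov q x y - connForm cov q y x = lieBr G x y := by
  have := FiniteDimensional.complete ℝ E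
  unfold connForm
  rw [← map_sub, h.torsion_free _ _ q (mdifferentiableAt_leftField x q)
    (mdifferentiableAt_leftField y q), mlieBracket_leftField, mcForm_leftField]

/-- The inner product on the Lie algebra given by a Riemannian metric. -/
def innerAtOne (g : Bundle.ContMDiffRiemannianMetric 𝓘(ℝ, E) ∞ E
    (TangentSpace 𝓘(ℝ, E) : G → Type _)) : E →ₗ[ℝ] E →ₗ[ℝ] ℝ :=
  LinearMap.mk₂ ℝ (fun x y ↦ g.inner 1 x y)
    (fun x x' y ↦ by
      exact congrArg (fun T : E →L[ℝ] ℝ ↦ T y) (map_add (g.inner 1) _ _))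
    (fun c x y ↦ by
      exact congrArg (fun T : E →L[ℝ] ℝ ↦ T y) (map_smul (g.inner 1) _ _))
    (fun x y y' ↦ map_add (g.inner 1 x) _ _) (fun c x y ↦ map_smul (g.inner 1 x) _ _)

lemma inner_leftField
    (hg : ∀ (a x : G) (u v : TangentSpace 𝓘(ℝ, E) x),
      g.inner (a * x) (mfderiv 𝓘(ℝ, E) 𝓘(ℝ, E) (a * ·) x u) (mfderiv 𝓘(ℝ, E) 𝓘(ℝ, E) (a * ·) x v) =
        g.inner x u v) (q : G) (x y : E) :
    g.inner q (leftField x q) (leftField y q) = innerAtOne g x y := by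
  refine Eq.trans ?_ (hg q 1 x y)
  have h (p : G) (hp : p = q) (x y : E) : g.inner q x y = g.inner p x y := by subst hp; rfl
  exact h _ (mul_one q) _ _

lemma IsLeviCivita.connForm_skew (h : IsLeviCivita g cov)
    (hg : ∀ (a x : G) (u v : TangentSpace 𝓘(ℝ, E) x),
      g.inner (a * x) (mfderiv 𝓘(ℝ, E) 𝓘(ℝ, E) (a * ·) x u) (mfderiv 𝓘(ℝ, E) 𝓘(ℝ, E) (a * ·) x v) =
        g.inner x u v) (q : G) (x y z : E) :
    innerAtOne g (connForm cov q x y) z = - innerAtOne g y (connForm cov q x z) := by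
  have h1 := h.metric (leftField x) (leftField y) (leftField z) q (mdifferentiableAt_leftField x q)
    (mdifferentiableAt_leftField y q) (mdifferentiableAt_leftField z q)
  simp only [inner_leftField hg] at h1
  rw [← leftField_connForm, ← leftField_connForm, inner_leftField hg, inner_leftField hg,
    mvfderiv_const] at h1
  exact eq_neg_of_add_eq_zero_left h1.symm

lemma innerAtOne_symm (x y : E) : innerAtOne g x y = innerAtOne g y x := g.symm 1 x y

lemma innerAtOne_pos (x : E) (hx : x ≠ 0) : 0 < innerAtOne g x x := g.pos 1 x hx

/-- The Levi-Civita connection of a left invariant metric is left invariant. -/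
lemma IsLeviCivita.cov_leftField (h : IsLeviCivita g cov)
    (hg : ∀ (a x : G) (u v : TangentSpace 𝓘(ℝ, E) x),
      g.inner (a * x) (mfderiv 𝓘(ℝ, E) 𝓘(ℝ, E) (a * ·) x u) (mfderiv 𝓘(ℝ, E) 𝓘(ℝ, E) (a * ·) x v) =
        g.inner x u v) (q : G) (x y : E) :
    cov (leftField y) q (leftField x q) = leftField (connForm cov 1 x y) q := by
  -- At `q` and at 1 the connection coefficients satisfy the same torsion and metric identities, so
  -- their difference is symmetric and skew.
  have key := eq_zero_of_symm_of_skew (innerAtOne g) innerAtOne_symm innerAtOne_pos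
    (fun x y ↦ connForm cov q x y - connForm cov 1 x y)
    (fun x y ↦ by
      have h1 := h.connForm_sub q x y
      have h2 := h.connForm_sub 1 x y
      rw [← h2] at h1
      rw [sub_eq_sub_iff_add_eq_add] at h1 ⊢
      rw [h1]; abel)
    (fun x y z ↦ by
      simp only [map_sub, LinearMap.sub_apply, h.connForm_skew hg q x y z,
        h.connForm_skew hg 1 x y z]
      ring) x y
  rw [← sub_eq_zero.1 key, leftField_connForm]

/-- Covariant derivatives of left-invariant fields are again left invariant, so the curvature on
such fields is an expression in the coefficients at 1. -/
lemma connForm_flat (h : IsLeviCivita g cov)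
    (hg : ∀ (a x : G) (u v : TangentSpace 𝓘(ℝ, E) x),
      g.inner (a * x) (mfderiv 𝓘(ℝ, E) 𝓘(ℝ, E) (a * ·) x u) (mfderiv 𝓘(ℝ, E) 𝓘(ℝ, E) (a * ·) x v) =
        g.inner x u v)
    (hcurv : ∀ X Y Z : Π x : G, TangentSpace 𝓘(ℝ, E) x, CMDiff ∞ (T% X) → CMDiff ∞ (T% Y) →
      CMDiff ∞ (T% Z) → ∀ x, curvature cov X Y Z x = 0) (x y z : E) :
    connForm cov 1 (lieBr G x y) z =
      connForm cov 1 x (connForm cov 1 y z) - connForm cov 1 y (connForm cov 1 x z) := by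
  have := FiniteDimensional.complete ℝ E
  have h0 := hcurv _ _ _ (contMDiff_leftField x) (contMDiff_leftField y) (contMDiff_leftField z) 1
  unfold curvature at h0
  simp only [h.cov_leftField hg] at h0
  rw [mlieBracket_leftField, h.cov_leftField hg] at h0
  simp only [leftField_one] at h0
  exact (sub_eq_zero.1 h0).symm

/-- The Lie algebra of a contact Lie group with a flat left invariant metric. -/
theorem exists_isMotionCoordinates (hc : HasLeftInvariantContactForm 𝓘(ℝ, E) G)
    (hf : HasFlatLeftInvariantMetric 𝓘(ℝ, E) G) (hE : 2 ≤ Module.finrank ℝ E) :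
    ∃ (ζ : E →ₗ[ℝ] ℂ) (τ : E →ₗ[ℝ] ℝ), IsMotionCoordinates G ζ τ := by
  obtain ⟨g, hg, cov, hcov, hcurv⟩ := hf
  obtain ⟨α, hα⟩ := hc.exists_linearForm
  have hbr (x y : E) : connFormₗ cov x y - connFormₗ cov y x = lieBr G x y :=
    hcov.connForm_sub 1 x y
  obtain ⟨ζ, τ, h1, h2, h3⟩ := exists_motion_coordinates_of_bilin (innerAtOne g) innerAtOne_symm
    innerAtOne_pos (connFormₗ cov) (hcov.connForm_skew hg 1)
    (fun x y z ↦ by rw [hbr]; exact connForm_flat hcov hg hcurv x y z) hE α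
    (fun x hx hx' ↦ hα x hx fun y ↦ by rw [← hbr]; exact hx' y)
  simp only [hbr] at h2 h3
  exact ⟨ζ, τ, h1, h2, h3⟩

end

section


/-! ### Smoothness of sections of bundles of linear maps. -/

section HomBundle

open Bundle

variable {E H B M : Type*} [NormedAddCommGroup E] [NormedSpace ℝ E] [TopologicalSpace H]
  {I : ModelWithCorners ℝ E H} [TopologicalSpace B] [ChartedSpace H B] {n : ℕ∞ω}

/-- In finite dimension a linear map depends linearly and continuously on its values on a basis. -/
lemma contMDiffAt_clm_of_apply {F W : Type*} [NormedAddCommGroup F] [NormedSpace ℝ F]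
    [FiniteDimensional ℝ F] [NormedAddCommGroup W] [NormedSpace ℝ W] {f : B → F →L[ℝ] W} {x : B}
    (h : ∀ v, ContMDiffAt I 𝓘(ℝ, W) n (fun q ↦ f q v) x) :
    ContMDiffAt I 𝓘(ℝ, F →L[ℝ] W) n f x := by
  let e := Module.finBasis ℝ F
  let c : (Fin (Module.finrank ℝ F) → W) →L[ℝ] (F →L[ℝ] W) :=
    ∑ i, (ContinuousLinearMap.smulRightL ℝ F W (LinearMap.toContinuousLinearMap (e.coord i))).comp
      (ContinuousLinearMap.proj i)
  have hc : f = fun q ↦ c (fun i ↦ f q (e i)) := by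
    funext q
    ext v
    simp only [c, sum_apply, ContinuousLinearMap.comp_apply,
      ContinuousLinearMap.proj_apply, ContinuousLinearMap.smulRightL_apply_apply,
      ContinuousLinearMap.smulRight_apply, LinearMap.coe_toContinuousLinearMap',
      Module.Basis.coord_apply]
    conv_lhs => rw [← e.sum_repr v, map_sum]
    simp only [map_smul]
  rw [hc]
  exact c.contMDiff.contMDiffAt.comp x (contMDiffAt_pi_space.2 fun i ↦ h (e i))

variable {F₁ F₂ : Type*} [NormedAddCommGroup F₁] [NormedSpace ℝ F₁] [FiniteDimensional ℝ F₁]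
  [NormedAddCommGroup F₂] [NormedSpace ℝ F₂]
  {E₁ E₂ : B → Type*} [TopologicalSpace (TotalSpace F₁ E₁)] [∀ x, AddCommGroup (E₁ x)]
  [∀ x, Module ℝ (E₁ x)] [∀ x, TopologicalSpace (E₁ x)] [FiberBundle F₁ E₁] [VectorBundle ℝ F₁ E₁]
  [TopologicalSpace (TotalSpace F₂ E₂)] [∀ x, AddCommGroup (E₂ x)]
  [∀ x, Module ℝ (E₂ x)] [∀ x, TopologicalSpace (E₂ x)] [FiberBundle F₂ E₂] [VectorBundle ℝ F₂ E₂]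
  [∀ x, IsTopologicalAddGroup (E₂ x)] [∀ x, ContinuousSMul ℝ (E₂ x)]

lemma contMDiffAt_trivialization_symm (x : B) (v : F₁) :
    ContMDiffAt I (I.prod 𝓘(ℝ, F₁)) n
      (fun q ↦ TotalSpace.mk' F₁ q ((trivializationAt F₁ E₁ x).symm q v)) x := by
  refine contMDiffAt_totalSpace.2 ⟨contMDiffAt_id, ?_⟩
  refine (contMDiffAt_const (c := v)).congr_of_eventuallyEq ?_
  filter_upwards [(trivializationAt F₁ E₁ x).open_baseSet.mem_nhds
    (FiberBundle.mem_baseSet_trivializationAt F₁ E₁ x)] with q hq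
  exact congrArg Prod.snd ((trivializationAt F₁ E₁ x).apply_mk_symm hq v)

/-- It suffices to test on local sections that are constant in a trivialization. Two applications
reduce the smoothness of a metric to that of functions. -/
lemma contMDiffAt_hom_of_apply {ϕ : Π q : B, E₁ q →L[ℝ] E₂ q} {x : B}
    (h : ∀ v : F₁, ContMDiffAt I (I.prod 𝓘(ℝ, F₂)) n
      (fun q ↦ TotalSpace.mk' F₂ q (ϕ q ((trivializationAt F₁ E₁ x).symm q v))) x) :
    ContMDiffAt I (I.prod 𝓘(ℝ, F₁ →L[ℝ] F₂)) n
      (fun q ↦ TotalSpace.mk' (F₁ →L[ℝ] F₂) (E := fun q ↦ E₁ q →L[ℝ] E₂ q) q (ϕ q)) x := by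
  refine (contMDiffAt_hom_bundle _).2 ⟨contMDiffAt_id, contMDiffAt_clm_of_apply fun v ↦ ?_⟩
  refine (contMDiffAt_totalSpace.1 (h v)).2.congr_of_eventuallyEq ?_
  filter_upwards [(trivializationAt F₁ E₁ x).open_baseSet.mem_nhds
    (FiberBundle.mem_baseSet_trivializationAt F₁ E₁ x),
    (trivializationAt F₂ E₂ x).open_baseSet.mem_nhds
    (FiberBundle.mem_baseSet_trivializationAt F₂ E₂ x)] with q hq hq'
  simp only [ContinuousLinearMap.inCoordinates_eq hq hq']
  rfl

end HomBundle

/-! ### Derivatives of vector-valued functions on a manifold. -/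

section Deriv

variable {E : Type*} [NormedAddCommGroup E] [NormedSpace ℝ E]
  {M : Type*} [TopologicalSpace M] [ChartedSpace E M]
  {F F₁ F₂ : Type*} [NormedAddCommGroup F] [NormedSpace ℝ F]
  [NormedAddCommGroup F₁] [NormedSpace ℝ F₁] [NormedAddCommGroup F₂] [NormedSpace ℝ F₂]

lemma mvfderiv_bilin_apply (b : F₁ →L[ℝ] F₂ →L[ℝ] F) {f : M → F₁} {g : M → F₂} {x : M}
    (hf : MDiffAt f x) (hg : MDiffAt g x) (w : TangentSpace 𝓘(ℝ, E) x) :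
    mvfderiv 𝓘(ℝ, E) (fun q ↦ b (f q) (g q)) x w =
      b (mvfderiv 𝓘(ℝ, E) f x w) (g x) + b (f x) (mvfderiv 𝓘(ℝ, E) g x w) := by
  have hfg : MDifferentiableAt 𝓘(ℝ, E) 𝓘(ℝ, F₁ × F₂) (fun q ↦ (f q, g q)) x :=
    hf.prodMk_space hg
  have hb := b.isBoundedBilinearMap.hasFDerivAt (f x, g x)
  have h := mfderiv_comp (I := 𝓘(ℝ, E)) (I' := 𝓘(ℝ, F₁ × F₂)) (I'' := 𝓘(ℝ, F)) x
    (g := fun p : F₁ × F₂ ↦ b p.1 p.2) (f := fun q ↦ (f q, g q))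
    hb.differentiableAt.mdifferentiableAt hfg
  have h' := congrArg (fun S : TangentSpace 𝓘(ℝ, E) x →L[ℝ] F ↦ S w) h
  refine h'.trans ?_
  rw [mfderiv_eq_fderiv, hb.fderiv]
  have h1 := mvfderiv_clm_comp (ContinuousLinearMap.fst ℝ F₁ F₂) hfg w
  have h2 := mvfderiv_clm_comp (ContinuousLinearMap.snd ℝ F₁ F₂) hfg w
  simp only [ContinuousLinearMap.coe_fst', ContinuousLinearMap.coe_snd'] at h1 h2
  rw [h1, h2, add_comm]
  rfl

variable [IsManifold 𝓘(ℝ, E) ∞ M]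

lemma contMDiff_mvfderiv_apply {f : M → F} {X : Π q : M, TangentSpace 𝓘(ℝ, E) q}
    (hf : CMDiff ∞ f) (hX : CMDiff ∞ (T% X)) :
    CMDiff ∞ (fun q ↦ mvfderiv 𝓘(ℝ, E) f q (X q)) := by
  have h1 : ContMDiff 𝓘(ℝ, E).tangent 𝓘(ℝ, F).tangent ∞ (tangentMap 𝓘(ℝ, E) 𝓘(ℝ, F) f) :=
    ContMDiff.contMDiff_tangentMap (n := ∞) hf (by simp)
  exact ((contMDiff_snd_tangentBundle_modelSpace F 𝓘(ℝ, F)).comp h1).comp hX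

end Deriv

end

section


open VectorField

/-! ### The inner product and flat product on the algebra of motions. -/

section Algebra

variable {E : Type*} [NormedAddCommGroup E] [NormedSpace ℝ E] [FiniteDimensional ℝ E]
  {G : Type*} [TopologicalSpace G] [ChartedSpace E G] [Group G] [LieGroup 𝓘(ℝ, E) ∞ G]

/-- The inner product on the Lie algebra given by the maps `ζ` and `τ` to `ℂ` and `ℝ`. -/
def motionInner (ζ : E →ₗ[ℝ] ℂ) (τ : E →ₗ[ℝ] ℝ) : E →L[ℝ] E →L[ℝ] ℝ :=
  LinearMap.toContinuousBilinearMap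
    (((innerₗ ℂ).compl₁₂ ζ ζ) + (LinearMap.mul ℝ ℝ).compl₁₂ τ τ)

lemma motionInner_apply (ζ : E →ₗ[ℝ] ℂ) (τ : E →ₗ[ℝ] ℝ) (x y : E) :
    motionInner ζ τ x y = inner ℝ (ζ x) (ζ y) + τ x * τ y := rfl

/-- In ℂ × ℝ let `L x` be multiplication by iτ(x) on ℂ and zero on ℝ. These maps are skew and
commute, and `L` kills brackets because τ does. The lower bound on the dimension makes (ζ, τ) an
isomorphism, so this can be transported. -/
lemma IsMotionCoordinates.exists_product {ζ : E →ₗ[ℝ] ℂ} {τ : E →ₗ[ℝ] ℝ}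
    (h : IsMotionCoordinates G ζ τ) (hE : 3 ≤ Module.finrank ℝ E) :
    ∃ L : E →L[ℝ] E →L[ℝ] E, (∀ x y, L x y - L y x = lieBr G x y) ∧
      (∀ x y z, motionInner ζ τ (L x y) z + motionInner ζ τ y (L x z) = 0) ∧
      (∀ x y z, L (lieBr G x y) z = L x (L y z) - L y (L x z)) := by
  have hinj : Function.Injective (ζ.prod τ) := by
    refine (injective_iff_map_eq_zero _).2 fun x hx ↦ ?_
    exact h.eq_zero x (congrArg Prod.fst hx) (congrArg Prod.snd hx)
  have hrank : Module.finrank ℝ E = Module.finrank ℝ (ℂ × ℝ) := by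
    rw [Module.finrank_prod, Complex.finrank_real_complex, Module.finrank_self]
    exact le_antisymm h.finrank_le hE
  let Φ : E ≃ₗ[ℝ] ℂ × ℝ := LinearEquiv.ofInjectiveOfFinrankEq (ζ.prod τ) hinj hrank
  have hΦ (x : E) : Φ x = (ζ x, τ x) := rfl
  let L₀ : E →ₗ[ℝ] E →ₗ[ℝ] E := LinearMap.mk₂ ℝ (fun x y ↦ Φ.symm (Complex.I * τ x * ζ y, 0))
    (fun x x' y ↦ by
      rw [← map_add]; congr 1; ext <;> simp [map_add, mul_add, add_mul])
    (fun c x y ↦ by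
      rw [← map_smul]; congr 1; apply Prod.ext
      · simp only [map_smul, smul_eq_mul, Complex.ofReal_mul, Prod.smul_fst, Complex.real_smul]; ring
      · simp)
    (fun x y y' ↦ by
      rw [← map_add]; congr 1; ext <;> simp [map_add, mul_add])
    (fun c x y ↦ by
      rw [← map_smul]; congr 1; apply Prod.ext
      · simp only [map_smul, Prod.smul_fst, Complex.real_smul]; ring
      · simp)
  have hL (x y : E) : Φ (L₀ x y) = (Complex.I * τ x * ζ y, 0) := Φ.apply_symm_apply _
  have hζ (x y : E) : ζ (L₀ x y) = Complex.I * τ x * ζ y := congrArg Prod.fst (hL x y)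
  have hτ (x y : E) : τ (L₀ x y) = 0 := congrArg Prod.snd (hL x y)
  refine ⟨LinearMap.toContinuousBilinearMap L₀, fun x y ↦ ?_, fun x y z ↦ ?_, fun x y z ↦ ?_⟩
  · refine hinj (Prod.ext ?_ ?_)
    · change ζ (L₀ x y - L₀ y x) = ζ (lieBr G x y)
      rw [map_sub, hζ, hζ, h.map_lieBr_fst]; ring
    · change τ (L₀ x y - L₀ y x) = τ (lieBr G x y)
      rw [map_sub, hτ, hτ, h.map_lieBr_snd, sub_zero]
  · change inner ℝ (ζ (L₀ x y)) (ζ z) + τ (L₀ x y) * τ z +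
      (inner ℝ (ζ y) (ζ (L₀ x z)) + τ y * τ (L₀ x z)) = 0
    rw [hζ, hζ, hτ, hτ, Complex.inner, Complex.inner]
    simp
    ring
  · change L₀ (lieBr G x y) z = L₀ x (L₀ y z) - L₀ y (L₀ x z)
    refine hinj (Prod.ext ?_ ?_)
    · change ζ (L₀ _ _) = ζ (_ - _)
      rw [map_sub, hζ, hζ, hζ, hζ, hζ, h.map_lieBr_snd]; push_cast; ring
    · change τ (L₀ _ _) = τ (_ - _)
      rw [map_sub, hτ, hτ, hτ, sub_zero]

lemma motionInner_symm (ζ : E →ₗ[ℝ] ℂ) (τ : E →ₗ[ℝ] ℝ) (x y : E) :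
    motionInner ζ τ x y = motionInner ζ τ y x := by
  rw [motionInner_apply, motionInner_apply, real_inner_comm, mul_comm]

lemma IsMotionCoordinates.motionInner_pos {ζ : E →ₗ[ℝ] ℂ} {τ : E →ₗ[ℝ] ℝ}
    (h : IsMotionCoordinates G ζ τ) {x : E} (hx : x ≠ 0) : 0 < motionInner ζ τ x x := by
  rw [motionInner_apply, real_inner_self_eq_norm_sq, ← sq]
  by_contra hle
  have h1 : ‖ζ x‖ ^ 2 = 0 := by nlinarith [sq_nonneg ‖ζ x‖, sq_nonneg (τ x)]
  have h2 : τ x ^ 2 = 0 := by nlinarith [sq_nonneg ‖ζ x‖, sq_nonneg (τ x)]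
  exact hx (h.eq_zero x (by simpa using h1) (by simpa using h2))

/-- Serves the boundedness field of a Riemannian metric on a bundle. An injective linear map out of
a finite-dimensional space is antilipschitz, so bounded sets have bounded preimages. -/
lemma IsMotionCoordinates.isBounded {ζ : E →ₗ[ℝ] ℂ} {τ : E →ₗ[ℝ] ℝ}
    (h : IsMotionCoordinates G ζ τ) : Bornology.IsBounded {x | motionInner ζ τ x x < 1} := by
  have hker : LinearMap.ker (ζ.prod τ) = ⊥ :=
    LinearMap.ker_eq_bot'.2 fun x hx ↦
      h.eq_zero x (congrArg Prod.fst hx) (congrArg Prod.snd hx)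
  obtain ⟨K, -, hK⟩ := LinearMap.exists_antilipschitzWith (ζ.prod τ) hker
  refine (hK.isBounded_preimage (Metric.isBounded_closedBall (x := 0) (r := 1))).subset
    fun x hx ↦ ?_
  rw [Set.mem_ofPred_eq, motionInner_apply, real_inner_self_eq_norm_sq, ← sq] at hx
  rw [Set.mem_preimage, mem_closedBall_zero_iff]
  refine max_le ?_ ?_
  · change ‖ζ x‖ ≤ 1
    nlinarith [norm_nonneg (ζ x), sq_nonneg (τ x)]
  · change |τ x| ≤ 1
    rw [← sq_abs (τ x)] at hx
    nlinarith [sq_nonneg ‖ζ x‖, abs_nonneg (τ x)]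

end Algebra

end

section


/-! ### Left-invariant metrics and connections. -/

section FlatMetric

open VectorField

variable {E : Type*} [NormedAddCommGroup E] [NormedSpace ℝ E] [FiniteDimensional ℝ E]
  {G : Type*} [TopologicalSpace G] [ChartedSpace E G] [Group G] [LieGroup 𝓘(ℝ, E) ∞ G]

/-- The value at a point of the left invariant bilinear form with value `b` at `1`. -/
def leftBilin (b : E →L[ℝ] E →L[ℝ] ℝ) (q : G) :
    TangentSpace 𝓘(ℝ, E) q →L[ℝ] TangentSpace 𝓘(ℝ, E) q →L[ℝ] ℝ :=
  let A : E →L[ℝ] E := mcForm q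
  let B : E →L[ℝ] E →L[ℝ] ℝ := b.bilinearComp A A
  B

lemma leftBilin_apply (b : E →L[ℝ] E →L[ℝ] ℝ) (q : G) (u v : TangentSpace 𝓘(ℝ, E) q) :
    leftBilin b q u v = b (mcForm q u) (mcForm q v) := rfl

lemma contMDiffAt_mcForm_apply {Y : Π q : G, TangentSpace 𝓘(ℝ, E) q} {q : G}
    (hY : CMDiffAt ∞ (T% Y) q) : CMDiffAt ∞ (fun q ↦ mcForm q (Y q)) q :=
  contMDiff_mcForm_bundle.contMDiffAt.comp q hY

lemma contMDiff_leftBilin (b : E →L[ℝ] E →L[ℝ] ℝ) :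
    ContMDiff 𝓘(ℝ, E) (𝓘(ℝ, E).prod 𝓘(ℝ, E →L[ℝ] E →L[ℝ] ℝ)) ∞
      (fun q : G ↦ Bundle.TotalSpace.mk' (E →L[ℝ] E →L[ℝ] ℝ)
        (E := fun q : G ↦ TangentSpace 𝓘(ℝ, E) q →L[ℝ] TangentSpace 𝓘(ℝ, E) q →L[ℝ] ℝ)
        q (leftBilin b q)) := by
  have : IsManifold 𝓘(ℝ, E) 1 G := IsManifold.of_le (n := ∞) (by simp)
  intro x
  have hs (v : E) := contMDiffAt_trivialization_symm (I := 𝓘(ℝ, E)) (n := ∞) (F₁ := E)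
    (E₁ := (TangentSpace 𝓘(ℝ, E) : G → Type _)) x v
  refine contMDiffAt_hom_of_apply (F₁ := E) (F₂ := E →L[ℝ] ℝ)
    (E₁ := (TangentSpace 𝓘(ℝ, E) : G → Type _))
    (E₂ := fun q : G ↦ TangentSpace 𝓘(ℝ, E) q →L[ℝ] ℝ) fun v ↦ ?_
  refine contMDiffAt_hom_of_apply (F₁ := E) (F₂ := ℝ)
    (E₁ := (TangentSpace 𝓘(ℝ, E) : G → Type _)) (E₂ := fun _ : G ↦ ℝ) fun w ↦ ?_
  refine Bundle.contMDiffAt_totalSpace.2 ⟨contMDiffAt_id, ?_⟩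
  change ContMDiffAt 𝓘(ℝ, E) 𝓘(ℝ, ℝ) ∞ (fun q : G ↦ leftBilin b q _ _) x
  simp only [leftBilin_apply]
  exact ((b.contMDiff.contMDiffAt.comp x (contMDiffAt_mcForm_apply (hs v))).clm_apply
    (contMDiffAt_mcForm_apply (hs w)))

variable (G) in
/-- The left invariant Riemannian metric given by an inner product on the Lie algebra. -/
def leftMetric (b : E →L[ℝ] E →L[ℝ] ℝ) (symm : ∀ x y, b x y = b y x)
    (pos : ∀ x, x ≠ 0 → 0 < b x x) (bdd : Bornology.IsBounded {x | b x x < 1}) :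
    Bundle.ContMDiffRiemannianMetric 𝓘(ℝ, E) ∞ E (TangentSpace 𝓘(ℝ, E) : G → Type _) where
  inner := leftBilin b
  symm q v w := symm _ _
  pos q v hv := by
    refine pos _ fun h ↦ hv ((leftField_mcForm q v).symm.trans ?_)
    exact (congrArg (fun w ↦ leftField w q) h).trans (map_zero (mfderiv _ _ _ _))
  isVonNBounded q := by
    let A : E →L[ℝ] E := mcForm q
    have hA : LinearMap.ker (A : E →ₗ[ℝ] E) = ⊥ := LinearMap.ker_eq_bot'.2 fun v hv ↦
      (leftField_mcForm q v).symm.trans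
        ((congrArg (fun w ↦ leftField w q) hv).trans (map_zero (mfderiv _ _ _ _)))
    obtain ⟨K, -, hK⟩ := LinearMap.exists_antilipschitzWith (A : E →ₗ[ℝ] E) hA
    have hb : Bornology.IsBounded {v : E | b (A v) (A v) < 1} := hK.isBounded_preimage bdd
    have hb' : Bornology.IsVonNBounded ℝ {v : E | b (A v) (A v) < 1} :=
      (NormedSpace.isVonNBounded_iff ℝ).2 hb
    exact hb'
  contMDiff := contMDiff_leftBilin b

/-- Left translation as a linear map from the Lie algebra to a tangent space. -/
def leftFieldL (q : G) : E →L[ℝ] TangentSpace 𝓘(ℝ, E) q :=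
  mfderiv 𝓘(ℝ, E) 𝓘(ℝ, E) (q * ·) (1 : G)

lemma mcForm_leftFieldL (q : G) (v : E) : mcForm q (leftFieldL q v) = v :=
  mcForm_leftField q v

lemma mcForm_injective (q : G) : Function.Injective (mcForm (E := E) q) :=
  Function.LeftInverse.injective (leftField_mcForm q)

variable (G) in
/-- The left invariant connection given by a bilinear map on the Lie algebra. -/
def leftConnection (L : E →L[ℝ] E →L[ℝ] E) :
    CovariantDerivative 𝓘(ℝ, E) E (TangentSpace 𝓘(ℝ, E) : G → Type _) where
  -- In the left trivialization, where `Y` becomes an `E`-valued function F, this is the connection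
  -- d + L: the derivative of F along v plus `L` of v applied to F.
  toFun Y q := (leftFieldL q).comp (mvfderiv 𝓘(ℝ, E) (fun q ↦ mcForm q (Y q)) q +
    (L.flip (mcForm q (Y q))).comp (mcForm q))
  isCovariantDerivativeOnUniv :=
    { add := fun {Y Y' q} hY hY' _ ↦ by
        have h1 : mvfderiv 𝓘(ℝ, E) (fun q ↦ mcForm q ((Y + Y') q)) q =
            mvfderiv 𝓘(ℝ, E) (fun q ↦ mcForm q (Y q)) q +
              mvfderiv 𝓘(ℝ, E) (fun q ↦ mcForm q (Y' q)) q := by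
          rw [← mvfderiv_add (mdifferentiableAt_mcForm_apply hY) (mdifferentiableAt_mcForm_apply hY')]
          congr 1
          funext q
          exact map_add _ _ _
        have h2 : mcForm q ((Y + Y') q) = mcForm q (Y q) + mcForm q (Y' q) := map_add _ _ _
        ext v
        refine mcForm_injective q ?_
        change mcForm q (leftFieldL q (mvfderiv 𝓘(ℝ, E) (fun q ↦ mcForm q ((Y + Y') q)) q v +
            L (mcForm q v) (mcForm q ((Y + Y') q)))) =
          mcForm q (leftFieldL q (mvfderiv 𝓘(ℝ, E) (fun q ↦ mcForm q (Y q)) q v +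
            L (mcForm q v) (mcForm q (Y q))) +
          leftFieldL q (mvfderiv 𝓘(ℝ, E) (fun q ↦ mcForm q (Y' q)) q v +
            L (mcForm q v) (mcForm q (Y' q))))
        rw [map_add (mcForm q), mcForm_leftFieldL, mcForm_leftFieldL, mcForm_leftFieldL, h1, h2,
          map_add, add_apply]
        abel
      leibniz := fun {Y f q} hY hf _ ↦ by
        have h1 : mvfderiv 𝓘(ℝ, E) (fun q ↦ mcForm q ((f • Y) q)) q =
            f q • mvfderiv 𝓘(ℝ, E) (fun q ↦ mcForm q (Y q)) q +
              (mvfderiv 𝓘(ℝ, E) f q).smulRight (mcForm q (Y q)) := by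
          rw [← mvfderiv_smul hf (mdifferentiableAt_mcForm_apply hY)]
          congr 1
          funext q
          exact map_smul _ _ _
        have h2 : mcForm q ((f • Y) q) = f q • mcForm q (Y q) := map_smul _ _ _
        ext v
        refine mcForm_injective q ?_
        change mcForm q (leftFieldL q (mvfderiv 𝓘(ℝ, E) (fun q ↦ mcForm q ((f • Y) q)) q v +
            L (mcForm q v) (mcForm q ((f • Y) q)))) =
          mcForm q (f q • leftFieldL q (mvfderiv 𝓘(ℝ, E) (fun q ↦ mcForm q (Y q)) q v +
            L (mcForm q v) (mcForm q (Y q))) + mvfderiv 𝓘(ℝ, E) f q v • Y q)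
        rw [map_add (mcForm q), map_smul, map_smul, mcForm_leftFieldL, mcForm_leftFieldL, h1, h2,
          map_smul, add_apply, smul_apply, ContinuousLinearMap.smulRight_apply]
        module }

lemma mcForm_leftConnection (L : E →L[ℝ] E →L[ℝ] E) (Y : Π q : G, TangentSpace 𝓘(ℝ, E) q) (q : G)
    (u : TangentSpace 𝓘(ℝ, E) q) :
    mcForm q (leftConnection G L Y q u) = mvfderiv 𝓘(ℝ, E) (fun q ↦ mcForm q (Y q)) q u +
      L (mcForm q u) (mcForm q (Y q)) :=
  mcForm_leftFieldL q _

/-- In the left trivialization, vanishing torsion is the Maurer-Cartan equation combined with `hL`,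
and compatibility with the metric is the Leibniz rule for `b` combined with `skew`. -/
lemma isLeviCivita_leftConnection (b : E →L[ℝ] E →L[ℝ] ℝ) (symm : ∀ x y, b x y = b y x)
    (pos : ∀ x, x ≠ 0 → 0 < b x x) (bdd : Bornology.IsBounded {x | b x x < 1})
    (L : E →L[ℝ] E →L[ℝ] E) (hL : ∀ x y, L x y - L y x = lieBr G x y)
    (skew : ∀ x y z, b (L x y) z + b y (L x z) = 0) :
    IsLeviCivita (leftMetric G b symm pos bdd) (leftConnection G L) where
  torsion_free X Y q hX hY := by
    refine mcForm_injective q ?_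
    rw [map_sub, mcForm_leftConnection, mcForm_leftConnection, mcForm_mlieBracket hX hY, ← hL]
    abel
  metric X Y Z q hX hY hZ := by
    change mvfderiv 𝓘(ℝ, E) (fun y ↦ b (mcForm y (Y y)) (mcForm y (Z y))) q (X q) =
      b (mcForm q (leftConnection G L Y q (X q))) (mcForm q (Z q)) +
        b (mcForm q (Y q)) (mcForm q (leftConnection G L Z q (X q)))
    rw [mvfderiv_bilin_apply b (mdifferentiableAt_mcForm_apply hY)
      (mdifferentiableAt_mcForm_apply hZ), mcForm_leftConnection, mcForm_leftConnection, map_add,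
      map_add, add_apply]
    have := skew (mcForm q (X q)) (mcForm q (Y q)) (mcForm q (Z q))
    linarith

/-- Second derivatives cancel because derivation along the bracket is the commutator, and first
derivatives of the fields cancel by the Maurer-Cartan equation. What remains is the curvature of
`L`, zero by `flat`. -/
lemma curvature_leftConnection (L : E →L[ℝ] E →L[ℝ] E)
    (flat : ∀ x y z, L (lieBr G x y) z = L x (L y z) - L y (L x z))
    {X Y Z : Π q : G, TangentSpace 𝓘(ℝ, E) q} (hX : CMDiff ∞ (T% X)) (hY : CMDiff ∞ (T% Y))
    (hZ : CMDiff ∞ (T% Z)) (q : G) : curvature (leftConnection G L) X Y Z q = 0 := by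
  have := FiniteDimensional.complete ℝ E
  have hFZ := contMDiff_mcForm_apply hZ
  have hmd {F : G → E} (hF : CMDiff ∞ F) : MDiffAt F q := hF.mdifferentiableAt (by simp)
  have key {U : Π q : G, TangentSpace 𝓘(ℝ, E) q} (hU : CMDiff ∞ (T% U))
      (u : TangentSpace 𝓘(ℝ, E) q) :
      mcForm q (leftConnection G L (fun y ↦ leftConnection G L Z y (U y)) q u) =
        mvfderiv 𝓘(ℝ, E) (fun y ↦ mvfderiv 𝓘(ℝ, E) (fun y ↦ mcForm y (Z y)) y (U y)) q u +
        (L (mvfderiv 𝓘(ℝ, E) (fun y ↦ mcForm y (U y)) q u) (mcForm q (Z q)) +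
          L (mcForm q (U q)) (mvfderiv 𝓘(ℝ, E) (fun y ↦ mcForm y (Z y)) q u)) +
        L (mcForm q u) (mvfderiv 𝓘(ℝ, E) (fun y ↦ mcForm y (Z y)) q (U q) +
          L (mcForm q (U q)) (mcForm q (Z q))) := by
    have h1 := contMDiff_mvfderiv_apply hFZ hU
    have h2 := contMDiff_mcForm_apply hU
    have h3 : MDiffAt (fun y ↦ L (mcForm y (U y)) (mcForm y (Z y))) q :=
      ((L.contMDiff.comp h2).clm_apply hFZ).mdifferentiableAt (by simp)
    rw [mcForm_leftConnection]
    simp only [mcForm_leftConnection]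
    rw [← mvfderiv_bilin_apply L (hmd h2) (hmd hFZ), ← add_apply, ← mvfderiv_fun_add (hmd h1) h3]
  refine mcForm_injective q ?_
  have hXq := hX.mdifferentiableAt (x := q) (by simp)
  have hYq := hY.mdifferentiableAt (x := q) (by simp)
  have hF4 := mvfderiv_mlieBracket ((hFZ q).of_le (WithTop.coe_le_coe.2 le_top)) hXq hYq
  have hF3 := mcForm_mlieBracket hXq hYq
  unfold curvature
  rw [map_sub, map_sub, key hY, key hX, mcForm_leftConnection, hF4, hF3, map_zero]
  simp only [map_add, map_sub, add_apply, sub_apply, flat]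
  abel

/-- A Lie group whose Lie algebra is that of the group of motions of the plane carries a flat left
invariant metric. -/
theorem IsMotionCoordinates.hasFlatLeftInvariantMetric {ζ : E →ₗ[ℝ] ℂ} {τ : E →ₗ[ℝ] ℝ}
    (h : IsMotionCoordinates G ζ τ) (hE : 3 ≤ Module.finrank ℝ E) :
    HasFlatLeftInvariantMetric 𝓘(ℝ, E) G := by
  obtain ⟨L, hL, skew, flat⟩ := h.exists_product hE
  refine ⟨leftMetric G (motionInner ζ τ) (motionInner_symm ζ τ) (fun x ↦ h.motionInner_pos)
    h.isBounded, fun a x u v ↦ ?_, leftConnection G L,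
    isLeviCivita_leftConnection _ _ _ _ L hL skew, fun X Y Z hX hY hZ ↦
      curvature_leftConnection L flat hX hY hZ⟩
  change leftBilin (motionInner ζ τ) (a * x) _ _ = leftBilin (motionInner ζ τ) x u v
  rw [leftBilin_apply, leftBilin_apply]
  rw [mcForm_mfderiv_mul, mcForm_mfderiv_mul]

end FlatMetric

end

section


/-! ### Polar coordinates near the identity of E(2). -/

namespace E2

lemma isOpen_slit : IsOpen {g : E2 | (g.2.1 : ℂ) ∈ Complex.slitPlane ∧ g.2.2 = 1} := by
  have h1 : Continuous fun g : E2 ↦ (g.2.1 : ℂ) := continuous_subtype_val.comp contMDiff_circle.continuous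
  have h2 : Continuous fun g : E2 ↦ g.2.2 := contMDiff_sign.continuous
  exact (Complex.isOpen_slitPlane.preimage h1).inter ((isOpen_discrete {1}).preimage h2)

lemma arg_coe_exp {t : ℝ} (ht : t ∈ Set.Ioo (-Real.pi) Real.pi) :
    Complex.arg (Circle.exp t : ℂ) = t := by
  rw [Circle.coe_exp, Complex.arg_exp_mul_I, toIocMod_eq_self]
  exact ⟨ht.1, by linarith [ht.2, Real.pi_pos]⟩

/-- The parametrization of a neighbourhood of `1` by the translation and the angle of rotation. -/
def polar : OpenPartialHomeomorph (ℂ × ℝ) E2 where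
  toFun p := (p.1, Circle.exp p.2, 1)
  invFun g := (g.1, Complex.arg g.2.1)
  source := {p | p.2 ∈ Set.Ioo (-Real.pi) Real.pi}
  target := {g | (g.2.1 : ℂ) ∈ Complex.slitPlane ∧ g.2.2 = 1}
  map_source' p hp := by
    refine ⟨?_, rfl⟩
    rw [Complex.mem_slitPlane_iff_arg]
    refine ⟨?_, Circle.coe_ne_zero _⟩
    change Complex.arg (Circle.exp p.2 : ℂ) ≠ _
    rw [arg_coe_exp hp]
    exact hp.2.ne
  map_target' g hg := by
    refine ⟨Complex.neg_pi_lt_arg _, lt_of_le_of_ne (Complex.arg_le_pi _) ?_⟩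
    exact (Complex.mem_slitPlane_iff_arg.1 hg.1).1
  left_inv' p hp := Prod.ext rfl (arg_coe_exp hp)
  right_inv' g hg := by
    refine ext' rfl ?_ hg.2.symm
    change (Circle.exp (Complex.arg (g.2.1 : ℂ)) : ℂ) = g.2.1
    rw [Circle.exp_arg]
  open_source := isOpen_Ioo.preimage continuous_snd
  open_target := isOpen_slit
  continuousOn_toFun := by
    refine Continuous.continuousOn ?_
    have : Continuous fun p : ℂ × ℝ ↦ ((p.1, Circle.exp p.2, 1) : ℂ × Circle × ℤˣ) := by fun_prop
    exact this
  continuousOn_invFun := by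
    have h1 : Continuous fun g : E2 ↦ (g.2.1 : ℂ) :=
      continuous_subtype_val.comp contMDiff_circle.continuous
    have h0 : Continuous fun g : E2 ↦ g.1 := contMDiff_plane.continuous
    exact h0.continuousOn.prodMk fun g hg ↦
      (ContinuousAt.comp (f := fun g : E2 ↦ (g.2.1 : ℂ)) (g := Complex.arg) (x := g)
        (Complex.continuousAt_arg hg.1) h1.continuousAt).continuousWithinAt

lemma polar_symm_apply (g : E2) : polar.symm g = (g.1, Complex.arg g.2.1) := rfl

lemma polar_source : polar.source = {p | p.2 ∈ Set.Ioo (-Real.pi) Real.pi} := rfl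

lemma polar_target :
    polar.target = {g | (g.2.1 : ℂ) ∈ Complex.slitPlane ∧ g.2.2 = 1} := rfl

lemma contMDiff_polar : ContMDiff 𝓘(ℝ, ℂ × ℝ) model ∞ polar := by
  refine contMDiff_mk ?_ ?_ ?_
  · exact contDiff_fst.contMDiff
  · exact (contMDiff_circleExp (m := ∞)).comp (contDiff_snd (𝕜 := ℝ) (E := ℂ) (F := ℝ)).contMDiff
  · exact contMDiff_const

/-- The angle is the imaginary part of the logarithm, which is smooth on the slit plane. -/
lemma contMDiffOn_polar_symm : ContMDiffOn model 𝓘(ℝ, ℂ × ℝ) ∞ polar.symm polar.target := by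
  have h1 : ContMDiff model 𝓘(ℝ, ℂ) ∞ (fun g : E2 ↦ (g.2.1 : ℂ)) :=
    contMDiff_circle_coe contMDiff_circle
  intro g hg
  refine ContMDiffAt.contMDiffWithinAt ?_
  refine ContMDiffAt.prodMk_space contMDiff_plane.contMDiffAt ?_
  have h2 : ContDiffAt ℝ ∞ Complex.log (g.2.1 : ℂ) :=
    (Complex.contDiffAt_log (n := ∞) hg.1).restrict_scalars ℝ
  have h3 : ContDiffAt ℝ ∞ Complex.arg (g.2.1 : ℂ) := by
    have : Complex.arg = fun z ↦ Complex.imCLM (Complex.log z) := by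
      funext z; simp [Complex.log_im]
    rw [this]
    exact Complex.imCLM.contDiff.contDiffAt.comp _ h2
  exact ContMDiffAt.comp (I' := 𝓘(ℝ, ℂ)) g (g := Complex.arg) h3.contMDiffAt h1.contMDiffAt

end E2

end

section


/-! ### From a local isomorphism to the Lie algebra. -/

section Converse

open VectorField

variable {E : Type*} [NormedAddCommGroup E] [NormedSpace ℝ E]
  {G : Type*} [TopologicalSpace G] [ChartedSpace E G] [Group G] [LieGroup 𝓘(ℝ, E) ∞ G]

lemma mvfderiv_comp_mul_left {V : Type*} [NormedAddCommGroup V] [NormedSpace ℝ V] {f : G → V}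
    {a x : G} (hf : MDiffAt f (a * x)) (u : TangentSpace 𝓘(ℝ, E) x) :
    mvfderiv 𝓘(ℝ, E) (fun y ↦ f (a * y)) x u =
      mvfderiv 𝓘(ℝ, E) f (a * x) (mfderiv 𝓘(ℝ, E) 𝓘(ℝ, E) (a * ·) x u) := by
  have h := mfderiv_comp (I := 𝓘(ℝ, E)) (I' := 𝓘(ℝ, E)) (I'' := 𝓘(ℝ, V)) x (g := f)
    (f := (a * ·)) hf (mdifferentiableAt_mul_left a x)
  exact congrArg (fun S : TangentSpace 𝓘(ℝ, E) x →L[ℝ] V ↦ S u) h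

lemma mvfderiv_leftField {V : Type*} [NormedAddCommGroup V] [NormedSpace ℝ V] {f : G → V}
    {q : G} (hf : MDiffAt f q) (v : E) :
    mvfderiv 𝓘(ℝ, E) f q (leftField v q) = mvfderiv 𝓘(ℝ, E) (fun y ↦ f (q * y)) (1 : G) v := by
  have h : MDiffAt f (q * 1) := by rwa [mul_one]
  refine Eq.trans ?_ (mvfderiv_comp_mul_left h v).symm
  have h' (p : G) (hp : p = q) (w : E) :
      mvfderiv 𝓘(ℝ, E) f q w = mvfderiv 𝓘(ℝ, E) f p w := by subst hp; rfl
  exact h' _ (mul_one q) _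

lemma mvfderiv_congr {M V : Type*} [TopologicalSpace M] [ChartedSpace E M] [NormedAddCommGroup V]
    [NormedSpace ℝ V] {f g : M → V} {x : M} (h : f =ᶠ[𝓝 x] g) (u : TangentSpace 𝓘(ℝ, E) x) :
    mvfderiv 𝓘(ℝ, E) f x u = mvfderiv 𝓘(ℝ, E) g x u :=
  congrArg (fun S : E →L[ℝ] V ↦ S u) h.mfderiv_eq

lemma mvfderiv_comp_hasDerivAt {M V : Type*} [TopologicalSpace M] [ChartedSpace E M]
    [NormedAddCommGroup V] [NormedSpace ℝ V] {g : ℝ → V} {g' : V} {f : M → ℝ} {x : M}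
    (hg : HasDerivAt g g' (f x)) (hf : MDiffAt f x) (u : TangentSpace 𝓘(ℝ, E) x) :
    mvfderiv 𝓘(ℝ, E) (fun q ↦ g (f q)) x u = mvfderiv 𝓘(ℝ, E) f x u • g' := by
  have h := mfderiv_comp (I := 𝓘(ℝ, E)) (I' := 𝓘(ℝ, ℝ)) (I'' := 𝓘(ℝ, V)) x (g := g) (f := f)
    hg.differentiableAt.mdifferentiableAt hf
  refine (congrArg (fun S : TangentSpace 𝓘(ℝ, E) x →L[ℝ] V ↦ S u) h).trans ?_
  rw [mfderiv_eq_fderiv, hg.hasFDerivAt.fderiv]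
  rfl

lemma hasDerivAt_cexp_I_mul (t : ℝ) (w : ℂ) :
    HasDerivAt (fun t : ℝ ↦ Complex.exp (Complex.I * t) * w)
      (Complex.exp (Complex.I * t) * Complex.I * w) t := by
  have h := (((Complex.ofRealCLM.hasDerivAt (x := t)).const_mul Complex.I).cexp).mul_const w
  simpa using h

/-- Functions which behave like the coordinates on the group of motions of the plane with respect to
the group law give an embedding of the Lie algebra. -/
lemma isMotionCoordinates_of_functions [FiniteDimensional ℝ E] {z : G → ℂ} {t : G → ℝ}
    (hz : ContMDiffAt 𝓘(ℝ, E) 𝓘(ℝ, ℂ) ∞ z 1) (ht : CMDiffAt ∞ t 1)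
    (hadd : ∀ᶠ x in 𝓝 (1 : G), ∀ᶠ y in 𝓝 (1 : G), t (x * y) = t x + t y)
    (hmul : ∀ᶠ x in 𝓝 (1 : G), ∀ᶠ y in 𝓝 (1 : G),
      z (x * y) = z x + Complex.exp (Complex.I * t x) * z y)
    (hinj : ∀ u : TangentSpace 𝓘(ℝ, E) (1 : G), mvfderiv 𝓘(ℝ, E) z 1 u = 0 →
      mvfderiv 𝓘(ℝ, E) t 1 u = 0 → u = 0) :
    ∃ (ζ : E →ₗ[ℝ] ℂ) (τ : E →ₗ[ℝ] ℝ), IsMotionCoordinates G ζ τ := by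
  have := FiniteDimensional.complete ℝ E
  let ζ : E →L[ℝ] ℂ := mvfderiv 𝓘(ℝ, E) z (1 : G)
  let τ : E →L[ℝ] ℝ := mvfderiv 𝓘(ℝ, E) t (1 : G)
  have hz1 : MDifferentiableAt 𝓘(ℝ, E) 𝓘(ℝ, ℂ) z 1 := hz.mdifferentiableAt (by simp)
  have ht1 : MDiffAt t 1 := ht.mdifferentiableAt (by simp)
  -- Differentiate the additivity of `t` in the second factor at 1. The same for `z` below gives the
  -- factor exp(i t(x)).
  have hdt : ∀ᶠ x in 𝓝 (1 : G), ∀ v, mvfderiv 𝓘(ℝ, E) t x (leftField v x) = τ v := by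
    filter_upwards [hadd, (contMDiffAt_iff_contMDiffAt_nhds (n := 1) (by simp)).1
      (ht.of_le (by simp))] with x hx htx v
    refine (mvfderiv_leftField (htx.mdifferentiableAt (by simp)) v).trans
      ((mvfderiv_congr hx _).trans ?_)
    rw [mvfderiv_fun_add mdifferentiableAt_const ht1, mvfderiv_const, zero_add]
    rfl
  have hdz : ∀ᶠ x in 𝓝 (1 : G), ∀ v, mvfderiv 𝓘(ℝ, E) z x (leftField v x) =
      Complex.exp (Complex.I * t x) * ζ v := by
    filter_upwards [hmul, (contMDiffAt_iff_contMDiffAt_nhds (n := 1) (by simp)).1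
      (hz.of_le (by simp))] with x hx hzx v
    have h2 : MDifferentiableAt 𝓘(ℝ, E) 𝓘(ℝ, ℂ) (fun y ↦ Complex.exp (Complex.I * t x) * z y) 1 :=
      MDifferentiableAt.comp (I' := 𝓘(ℝ, ℂ)) (1 : G) (ContinuousLinearMap.mul ℝ ℂ
        (Complex.exp (Complex.I * t x))).differentiableAt.mdifferentiableAt hz1
    refine (mvfderiv_leftField (hzx.mdifferentiableAt (by simp)) v).trans
      ((mvfderiv_congr hx _).trans ?_)
    rw [mvfderiv_fun_add mdifferentiableAt_const h2, mvfderiv_const, zero_add]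
    exact mvfderiv_clm_comp (ContinuousLinearMap.mul ℝ ℂ (Complex.exp (Complex.I * t x))) hz1 v
  have ht0 : t 1 = 0 := by
    have := hadd.self_of_nhds.self_of_nhds
    rw [mul_one] at this
    linarith
  have hτ (u v : E) : τ (lieBr G u v) = 0 := by
    have h := mvfderiv_mlieBracket (ht.of_le (WithTop.coe_le_coe.2 le_top))
      (mdifferentiableAt_leftField u (1 : G)) (mdifferentiableAt_leftField v (1 : G))
    refine h.trans ?_
    rw [mvfderiv_congr (hdt.mono fun x hx ↦ hx v), mvfderiv_congr (hdt.mono fun x hx ↦ hx u),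
      mvfderiv_const, mvfderiv_const]
    exact sub_self (0 : ℝ)
  -- The bracket is the commutator of derivations; by `hdz` the second derivative is the derivative
  -- of exp(i t) ζ(v) at 1, where `t` vanishes.
  have hζ (u v : E) : ζ (lieBr G u v) = Complex.I * (τ u * ζ v - τ v * ζ u) := by
    have h := mvfderiv_mlieBracket (hz.of_le (WithTop.coe_le_coe.2 le_top))
      (mdifferentiableAt_leftField u (1 : G)) (mdifferentiableAt_leftField v (1 : G))
    have key (u v : E) : mvfderiv 𝓘(ℝ, E) (fun q ↦ mvfderiv 𝓘(ℝ, E) z q (leftField v q)) (1 : G)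
        (leftField u 1) = Complex.I * τ u * ζ v := by
      rw [mvfderiv_congr (hdz.mono fun x hx ↦ hx v), leftField_one]
      refine (mvfderiv_comp_hasDerivAt (hasDerivAt_cexp_I_mul (t 1) (ζ v)) ht1 u).trans ?_
      rw [ht0, Complex.ofReal_zero, mul_zero, Complex.exp_zero, one_mul, Complex.real_smul]
      change ((τ u : ℝ) : ℂ) * (Complex.I * ζ v) = _
      ring
    refine h.trans ?_
    rw [key, key]
    ring
  exact ⟨ζ, τ, fun x hx hx' ↦ hinj x hx hx', hζ, hτ⟩

/-- A differentiable local left inverse forces an injective derivative, by the chain rule. -/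
lemma eq_zero_of_mvfderiv_eq_zero {M V : Type*} [TopologicalSpace M] [ChartedSpace E M]
    [NormedAddCommGroup V] [NormedSpace ℝ V] {Ψ : M → V} {χ : V → M} {x : M}
    (hΨ : MDifferentiableAt 𝓘(ℝ, E) 𝓘(ℝ, V) Ψ x) (hχ : MDifferentiableAt 𝓘(ℝ, V) 𝓘(ℝ, E) χ (Ψ x))
    (hχΨ : ∀ᶠ q in 𝓝 x, χ (Ψ q) = q) {u : TangentSpace 𝓘(ℝ, E) x}
    (hu : mvfderiv 𝓘(ℝ, E) Ψ x u = 0) : u = 0 := by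
  have h := mfderiv_comp (I := 𝓘(ℝ, E)) (I' := 𝓘(ℝ, V)) (I'' := 𝓘(ℝ, E)) x hχ hΨ
  have h1 : (mfderiv 𝓘(ℝ, E) 𝓘(ℝ, E) (χ ∘ Ψ) x : E →L[ℝ] E) = ContinuousLinearMap.id ℝ E :=
    (Filter.EventuallyEq.mfderiv_eq (f := id) (f₁ := χ ∘ Ψ) hχΨ).trans mfderiv_id
  have h2 : (mfderiv 𝓘(ℝ, E) 𝓘(ℝ, E) (χ ∘ Ψ) x : E →L[ℝ] E) u = 0 :=
    (congrArg (fun S : E →L[ℝ] E ↦ S u) h).trans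
      ((congrArg (mfderiv 𝓘(ℝ, V) 𝓘(ℝ, E) χ (Ψ x)) hu).trans (map_zero _))
  rw [h1] at h2
  exact h2

/-- A Lie group which is locally isomorphic to the group of motions of the plane has the same Lie
algebra. -/
theorem LocallyIsomorphic.exists_isMotionCoordinates [FiniteDimensional ℝ E]
    (h : LocallyIsomorphic 𝓘(ℝ, E) E2.model G E2) :
    ∃ (ζ : E →ₗ[ℝ] ℂ) (τ : E →ₗ[ℝ] ℝ), IsMotionCoordinates G ζ τ := by
  obtain ⟨φ, h1, hφ, hφ', hmul⟩ := h
  have hone : φ 1 = 1 := by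
    have := hmul 1 h1 1 h1 (by rwa [mul_one])
    rwa [mul_one, left_eq_mul] at this
  have hp1 : (1 : E2) ∈ E2.polar.target := by
    rw [E2.polar_target]
    exact ⟨by simp, rfl⟩
  have h1' : (1 : E2) ∈ φ.target := hone ▸ φ.map_source h1
  have hψ : ContMDiffAt 𝓘(ℝ, E) 𝓘(ℝ, ℂ × ℝ) ∞ (fun x ↦ E2.polar.symm (φ x)) 1 := by
    refine ContMDiffAt.comp (I' := E2.model) 1 (g := E2.polar.symm) ?_
      (hφ.contMDiffAt (φ.open_source.mem_nhds h1))
    rw [hone]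
    exact E2.contMDiffOn_polar_symm.contMDiffAt (E2.polar.open_target.mem_nhds hp1)
  have hz : ContMDiffAt 𝓘(ℝ, E) 𝓘(ℝ, ℂ) ∞ (fun x ↦ (E2.polar.symm (φ x)).1) 1 :=
    ContMDiffAt.comp (I' := 𝓘(ℝ, ℂ × ℝ)) 1 contDiff_fst.contMDiff.contMDiffAt hψ
  have ht : ContMDiffAt 𝓘(ℝ, E) 𝓘(ℝ, ℝ) ∞ (fun x ↦ (E2.polar.symm (φ x)).2) 1 :=
    ContMDiffAt.comp (I' := 𝓘(ℝ, ℂ × ℝ)) 1 contDiff_snd.contMDiff.contMDiffAt hψ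
  have ht0 : (E2.polar.symm (φ 1)).2 = 0 := by
    rw [hone, E2.polar_symm_apply]
    exact Complex.arg_one
  -- Two angles below π/2 in absolute value add without leaving the range of the argument, which
  -- makes the angle coordinate additive.
  have hev : ∀ᶠ x in 𝓝 (1 : G), x ∈ φ.source ∧ φ x ∈ E2.polar.target ∧
      |(E2.polar.symm (φ x)).2| < Real.pi / 2 := by
    have e1 : ∀ᶠ x in 𝓝 (1 : G), φ x ∈ E2.polar.target :=
      (φ.continuousAt h1).eventually (E2.polar.open_target.mem_nhds (by rwa [hone]))
    have e2 : ∀ᶠ x in 𝓝 (1 : G), |(E2.polar.symm (φ x)).2| < Real.pi / 2 :=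
      ht.continuousAt.abs.eventually (gt_mem_nhds (by
        change |(E2.polar.symm (φ 1)).2| < _
        rw [ht0, abs_zero]; positivity))
    filter_upwards [φ.open_source.mem_nhds h1, e1, e2] with x a b c using ⟨a, b, c⟩
  have hev2 : ∀ᶠ x in 𝓝 (1 : G), ∀ᶠ y in 𝓝 (1 : G), φ (x * y) = φ x * φ y := by
    filter_upwards [φ.open_source.mem_nhds h1] with x hx
    have : ∀ᶠ y in 𝓝 (1 : G), x * y ∈ φ.source := by
      have hc : ContinuousAt (fun y ↦ x * y) (1 : G) :=
        (mdifferentiableAt_mul_left (E := E) x 1).continuousAt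
      exact hc.eventually (φ.open_source.mem_nhds (by simpa using hx))
    filter_upwards [this, φ.open_source.mem_nhds h1] with y hy hy'
    exact hmul x hx y hy' hy
  refine isMotionCoordinates_of_functions hz ht ?_ ?_ fun u hu hu' ↦ ?_
  · filter_upwards [hev, hev2] with x hx hx2
    filter_upwards [hev, hx2] with y hy hxy
    simp only [E2.polar_symm_apply] at hx hy ⊢
    rw [hxy, E2.mul_snd_fst, hx.2.1.2, Units.val_one, zpow_one, Circle.coe_mul]
    refine (Complex.arg_mul_eq_add_arg_iff (Circle.coe_ne_zero _) (Circle.coe_ne_zero _)).2 ?_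
    have := abs_lt.1 hx.2.2
    have := abs_lt.1 hy.2.2
    constructor <;> linarith
  · filter_upwards [hev, hev2] with x hx hx2
    filter_upwards [hx2] with y hxy
    simp only [E2.polar_symm_apply]
    rw [hxy, E2.mul_fst, hx.2.1.2]
    have : Complex.exp (Complex.I * Complex.arg ((φ x).2.1 : ℂ)) = (φ x).2.1 := by
      rw [mul_comm, ← Circle.coe_exp, Circle.exp_arg]
    rw [this]
    simp [signConj]
  · have hψ1 := hψ.mdifferentiableAt (by simp)
    have hχ : MDifferentiableAt 𝓘(ℝ, ℂ × ℝ) 𝓘(ℝ, E) (fun p ↦ φ.symm (E2.polar p))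
        (E2.polar.symm (φ 1)) := by
      refine MDifferentiableAt.comp (I' := E2.model) _ (g := φ.symm) ?_
        (E2.contMDiff_polar.mdifferentiableAt (by simp))
      rw [hone, E2.polar.right_inv hp1]
      exact (hφ'.contMDiffAt (φ.open_target.mem_nhds h1')).mdifferentiableAt (by simp)
    refine eq_zero_of_mvfderiv_eq_zero hψ1 hχ (hev.mono fun x hx ↦ ?_) (Prod.ext ?_ ?_)
    · rw [E2.polar.right_inv hx.2.1, φ.left_inv hx.1]
    · exact (mvfderiv_clm_comp (ContinuousLinearMap.fst ℝ ℂ ℝ) hψ1 u).symm.trans hu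
    · exact (mvfderiv_clm_comp (ContinuousLinearMap.snd ℝ ℂ ℝ) hψ1 u).symm.trans hu'

end Converse

end

section


/-! ### The Maurer-Cartan form in a chart. -/

section ChartForm

open VectorField

variable {E : Type*} [NormedAddCommGroup E] [NormedSpace ℝ E]
  {G : Type*} [TopologicalSpace G] [ChartedSpace E G] [Group G]

variable (G) in
/-- The Maurer-Cartan form in the chart at `1`. -/
def mcChart (y : E) : E →L[ℝ] E :=
  (mcForm ((extChartAt 𝓘(ℝ, E) (1 : G)).symm y)).comp
    (mfderiv 𝓘(ℝ, E) 𝓘(ℝ, E) (extChartAt 𝓘(ℝ, E) (1 : G))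
      ((extChartAt 𝓘(ℝ, E) (1 : G)).symm y)).inverse

variable (G) in
/-- The coordinate vector fields of the chart at `1`. -/
def coordField (v : E) (q : G) : TangentSpace 𝓘(ℝ, E) q :=
  mpullback 𝓘(ℝ, E) 𝓘(ℝ, E) (extChartAt 𝓘(ℝ, E) (1 : G)) (fun _ ↦ v) q

lemma mcChart_apply (y v : E) :
    mcChart G y v = mcForm ((extChartAt 𝓘(ℝ, E) (1 : G)).symm y)
      (coordField G v ((extChartAt 𝓘(ℝ, E) (1 : G)).symm y)) := rfl

variable [FiniteDimensional ℝ E] [LieGroup 𝓘(ℝ, E) ∞ G]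

lemma isInvertible_mfderiv_chart {q : G} (hq : q ∈ (extChartAt 𝓘(ℝ, E) (1 : G)).source) :
    (mfderiv 𝓘(ℝ, E) 𝓘(ℝ, E) (extChartAt 𝓘(ℝ, E) (1 : G)) q).IsInvertible := by
  have : IsManifold 𝓘(ℝ, E) 1 G := IsManifold.of_le (n := ∞) (by simp)
  exact isInvertible_mfderiv_extChartAt hq

lemma contMDiffAt_chart {q : G} (hq : q ∈ (extChartAt 𝓘(ℝ, E) (1 : G)).source) :
    ContMDiffAt 𝓘(ℝ, E) 𝓘(ℝ, E) ∞ (extChartAt 𝓘(ℝ, E) (1 : G)) q :=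
  contMDiffAt_extChartAt' (by rwa [extChartAt_source] at hq)

lemma coordField_mfderiv {q : G} (hq : q ∈ (extChartAt 𝓘(ℝ, E) (1 : G)).source)
    (w : TangentSpace 𝓘(ℝ, E) q) :
    coordField (E := E) G (mfderiv 𝓘(ℝ, E) 𝓘(ℝ, E) (extChartAt 𝓘(ℝ, E) (1 : G)) q w) q = w :=
  (isInvertible_mfderiv_chart hq).inverse_apply_self w

lemma mfderiv_chart_symm {y : E} (hy : y ∈ (extChartAt 𝓘(ℝ, E) (1 : G)).target) (u : E) :
    mfderiv 𝓘(ℝ, E) 𝓘(ℝ, E) (extChartAt 𝓘(ℝ, E) (1 : G)).symm y u =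
      coordField G u ((extChartAt 𝓘(ℝ, E) (1 : G)).symm y) := by
  have hq := (extChartAt 𝓘(ℝ, E) (1 : G)).map_target hy
  have h := mfderiv_comp (I := 𝓘(ℝ, E)) (I' := 𝓘(ℝ, E)) (I'' := 𝓘(ℝ, E)) y
    ((contMDiffAt_chart hq).mdifferentiableAt (by simp))
    ((contMDiffAt_extChartAt_symm (1 : G) hy).mdifferentiableAt (by simp))
  have hev : (extChartAt 𝓘(ℝ, E) (1 : G) ∘ (extChartAt 𝓘(ℝ, E) (1 : G)).symm) =ᶠ[𝓝 y] id := by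
    filter_upwards [(isOpen_extChartAt_target (I := 𝓘(ℝ, E)) (1 : G)).mem_nhds hy] with y' hy'
    exact (extChartAt 𝓘(ℝ, E) (1 : G)).right_inv hy'
  have h1 : (mfderiv 𝓘(ℝ, E) 𝓘(ℝ, E) (extChartAt 𝓘(ℝ, E) (1 : G) ∘
      (extChartAt 𝓘(ℝ, E) (1 : G)).symm) y : E →L[ℝ] E) = ContinuousLinearMap.id ℝ E :=
    (Filter.EventuallyEq.mfderiv_eq (I := 𝓘(ℝ, E)) (I' := 𝓘(ℝ, E)) hev).trans mfderiv_id
  have h2 := (congrArg (fun S : E →L[ℝ] E ↦ S u) h1).symm.trans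
    (congrArg (fun S : E →L[ℝ] E ↦ S u) h)
  exact (((isInvertible_mfderiv_chart hq).inverse_apply_eq).2 h2).symm

lemma mcChart_eq_zero {y : E} (hy : y ∈ (extChartAt 𝓘(ℝ, E) (1 : G)).target) {v : E}
    (hv : mcChart G y v = 0) : v = 0 := by
  have hq := (extChartAt 𝓘(ℝ, E) (1 : G)).map_target hy
  have h1 : coordField G v ((extChartAt 𝓘(ℝ, E) (1 : G)).symm y) = 0 :=
    mcForm_injective _ ((mcChart_apply y v).symm.trans (hv.trans (map_zero _).symm))
  have h2 := (isInvertible_mfderiv_chart hq).self_apply_inverse v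
  exact h2.symm.trans ((congrArg _ h1).trans (map_zero _))

lemma contMDiffAt_coordField {q : G} (hq : q ∈ (extChartAt 𝓘(ℝ, E) (1 : G)).source) (v : E) :
    CMDiffAt ∞ (T% (coordField G v)) q := by
  have := FiniteDimensional.complete ℝ E
  have : IsManifold 𝓘(ℝ, E) 1 G := IsManifold.of_le (n := ∞) (by simp)
  refine ContMDiffAt.mpullback_vectorField_preimage (n := ∞) ?_ (contMDiffAt_chart hq)
    (isInvertible_mfderiv_chart hq) (by simp)
  exact contMDiffAt_vectorSpace_iff_contDiffAt.2 contDiffAt_const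

lemma mlieBracket_coordField {q : G} (hq : q ∈ (extChartAt 𝓘(ℝ, E) (1 : G)).source) (u v : E) :
    mlieBracket 𝓘(ℝ, E) (coordField G u) (coordField G v) q = 0 := by
  have := FiniteDimensional.complete ℝ E
  have := lieGroup_minSmoothness E G
  have hc (v : E) : MDifferentiableAt 𝓘(ℝ, E) 𝓘(ℝ, E).tangent
      (fun y : E ↦ (⟨y, v⟩ : TangentBundle 𝓘(ℝ, E) E)) (extChartAt 𝓘(ℝ, E) (1 : G) q) :=
    ((contMDiffAt_vectorSpace_iff_contDiffAt (n := 1) (V := fun _ : E ↦ v)).2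
      contDiffAt_const).mdifferentiableAt one_ne_zero
  have h := mpullback_mlieBracket (n := ∞) (I := 𝓘(ℝ, E)) (I' := 𝓘(ℝ, E)) (hc u) (hc v)
    (contMDiffAt_chart hq) (by
      rw [minSmoothness_of_isRCLikeNormedField]; exact WithTop.coe_le_coe.2 le_top)
  refine h.symm.trans ?_
  rw [mpullback_apply]
  have h0 := mlieBracket_eq_lieBracket (fun _ : E ↦ u) (fun _ ↦ v)
    (extChartAt 𝓘(ℝ, E) (1 : G) q)
  have h1 : lieBracket ℝ (fun _ : E ↦ u) (fun _ ↦ v) (extChartAt 𝓘(ℝ, E) (1 : G) q) = 0 := by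
    simp [lieBracket]
  exact (congrArg _ (h0.trans h1)).trans (map_zero _)

lemma contDiffOn_mcChart :
    ContDiffOn ℝ ∞ (mcChart G) (extChartAt 𝓘(ℝ, E) (1 : G)).target := by
  refine contDiffOn_clm_apply.2 fun v y hy ↦ ContDiffAt.contDiffWithinAt ?_
  have hq := (extChartAt 𝓘(ℝ, E) (1 : G)).map_target hy
  exact (ContMDiffAt.comp (I' := 𝓘(ℝ, E)) y (contMDiffAt_mcForm_apply (contMDiffAt_coordField hq v))
    (contMDiffAt_extChartAt_symm (1 : G) hy)).contDiffAt

/-- The Maurer-Cartan equation for coordinate fields, whose bracket vanishes. -/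
lemma fderiv_mcChart {y : E} (hy : y ∈ (extChartAt 𝓘(ℝ, E) (1 : G)).target) (u v : E) :
    fderiv ℝ (mcChart G) y u v - fderiv ℝ (mcChart G) y v u =
      - lieBr G (mcChart G y u) (mcChart G y v) := by
  have hq := (extChartAt 𝓘(ℝ, E) (1 : G)).map_target hy
  have hmd (v : E) := (contMDiffAt_coordField hq v).mdifferentiableAt (by simp)
  have h1 (u v : E) : fderiv ℝ (mcChart G) y u v =
      mvfderiv 𝓘(ℝ, E) (fun q ↦ mcForm q (coordField G v q))
        ((extChartAt 𝓘(ℝ, E) (1 : G)).symm y)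
        (coordField G u ((extChartAt 𝓘(ℝ, E) (1 : G)).symm y)) := by
    rw [← mfderiv_chart_symm hy, mvfderiv_apply_mfderiv (mdifferentiableAt_mcForm_apply (hmd v))
      ((contMDiffAt_extChartAt_symm (1 : G) hy).mdifferentiableAt (by simp))]
    have hd : DifferentiableAt ℝ (mcChart G) y :=
      (contDiffOn_mcChart.contDiffAt
        ((isOpen_extChartAt_target (I := 𝓘(ℝ, E)) (1 : G)).mem_nhds hy)).differentiableAt (by simp)
    have h := (hd.hasFDerivAt.clm_apply (hasFDerivAt_const v y)).fderiv
    change _ = fderiv ℝ (fun y ↦ mcChart G y v) y u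
    rw [h]
    simp
  have h2 := mcForm_mlieBracket (hmd u) (hmd v)
  rw [mlieBracket_coordField hq, map_zero] at h2
  rw [h1, h1, mcChart_apply, mcChart_apply]
  exact eq_neg_of_add_eq_zero_left h2.symm

end ChartForm

end

section


/-! ### Integrating the Maurer-Cartan form to coordinates. -/

section Potentials

variable {E : Type*} [NormedAddCommGroup E] [NormedSpace ℝ E] [FiniteDimensional ℝ E]
  {G : Type*} [TopologicalSpace G] [ChartedSpace E G] [Group G]

lemma contDiffOn_infty_of_hasFDerivAt {F : Type*} [NormedAddCommGroup F] [NormedSpace ℝ F]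
    {f : E → F} {f' : E → E →L[ℝ] F} {s : Set E} (hs : IsOpen s)
    (h : ∀ y ∈ s, HasFDerivAt f (f' y) y) (hf' : ContDiffOn ℝ ∞ f' s) : ContDiffOn ℝ ∞ f s := by
  rw [contDiffOn_infty_iff_fderiv_of_isOpen hs]
  exact ⟨fun y hy ↦ (h y hy).differentiableAt.differentiableWithinAt,
    hf'.congr fun y hy ↦ (h y hy).fderiv⟩

/-- A smooth closed `1`-form on a ball has a smooth primitive. -/
lemma exists_potential {F : Type*} [NormedAddCommGroup F] [NormedSpace ℝ F] [CompleteSpace F]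
    {f' : E → E →L[ℝ] F} {y₀ : E} {r : ℝ} (hf' : ContDiffOn ℝ ∞ f' (Metric.ball y₀ r))
    (hsymm : ∀ y ∈ Metric.ball y₀ r, ∀ u v, fderiv ℝ f' y u v = fderiv ℝ f' y v u) :
    ∃ f : E → F, f y₀ = 0 ∧ (∀ y ∈ Metric.ball y₀ r, HasFDerivAt f (f' y) y) ∧
      ContDiffOn ℝ ∞ f (Metric.ball y₀ r) := by
  obtain ⟨f, hf⟩ := Convex.exists_forall_hasFDerivAt_of_fderiv_symmetric (convex_ball y₀ r)
    Metric.isOpen_ball (hf'.differentiableOn (by simp)) hsymm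
  have hf₀ : ∀ y ∈ Metric.ball y₀ r, HasFDerivAt (fun y ↦ f y - f y₀) (f' y) y :=
    fun y hy ↦ (hf y hy).sub_const _
  exact ⟨fun y ↦ f y - f y₀, sub_self _, hf₀,
    contDiffOn_infty_of_hasFDerivAt Metric.isOpen_ball hf₀ hf'⟩

/-- The form τμ is closed because τ kills brackets. In the differential of exp(it)ζμ, the term iτμ ∧
ζμ from the exponential cancels the bracket term of ζ dμ. The Poincaré lemma on a ball gives first
t, then z. -/
lemma IsMotionCoordinates.exists_potentials {ζ : E →ₗ[ℝ] ℂ} {τ : E →ₗ[ℝ] ℝ}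
    (h : IsMotionCoordinates G ζ τ) {μ : E → E →L[ℝ] E} {y₀ : E} {r : ℝ}
    (hμ : ContDiffOn ℝ ∞ μ (Metric.ball y₀ r))
    (hMC : ∀ y ∈ Metric.ball y₀ r, ∀ u v,
      fderiv ℝ μ y u v - fderiv ℝ μ y v u = - lieBr G (μ y u) (μ y v)) :
    ∃ (t : E → ℝ) (z : E → ℂ), t y₀ = 0 ∧ z y₀ = 0 ∧
      (∀ y ∈ Metric.ball y₀ r, HasFDerivAt t (τ.toContinuousLinearMap.comp (μ y)) y) ∧
      (∀ y ∈ Metric.ball y₀ r,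
        HasFDerivAt z (Complex.exp (Complex.I * t y) • ζ.toContinuousLinearMap.comp (μ y)) y) ∧
      ContDiffOn ℝ ∞ t (Metric.ball y₀ r) ∧ ContDiffOn ℝ ∞ z (Metric.ball y₀ r) := by
  set B := Metric.ball y₀ r
  have hμd (y : E) (hy : y ∈ B) : HasFDerivAt μ (fderiv ℝ μ y) y :=
    ((hμ.contDiffAt (Metric.isOpen_ball.mem_nhds hy)).differentiableAt (by simp)).hasFDerivAt
  have hcomp {F : Type} [NormedAddCommGroup F] [NormedSpace ℝ F] (T : E →L[ℝ] F) (y : E)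
      (hy : y ∈ B) : HasFDerivAt (fun y ↦ T.comp (μ y))
        ((ContinuousLinearMap.compL ℝ E E F T).comp (fderiv ℝ μ y)) y :=
    (ContinuousLinearMap.compL ℝ E E F T).hasFDerivAt.comp y (hμd y hy)
  obtain ⟨t, ht0, ht, hts⟩ := exists_potential (f' := fun y ↦ τ.toContinuousLinearMap.comp (μ y))
    (y₀ := y₀) (r := r) (contDiffOn_const.clm_comp hμ) fun y hy u v ↦ by
      rw [(hcomp τ.toContinuousLinearMap y hy).fderiv]
      change τ (fderiv ℝ μ y u v) = τ (fderiv ℝ μ y v u)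
      rw [← sub_eq_zero, ← map_sub, hMC y hy, map_neg, h.map_lieBr_snd, neg_zero]
  have hexp : ContDiffOn ℝ ∞ (fun y ↦ Complex.exp (Complex.I * t y)) B :=
    (contDiffOn_const.mul (Complex.ofRealCLM.contDiff.comp_contDiffOn hts)).cexp
  have hexpd (y : E) (hy : y ∈ B) : HasFDerivAt (fun y ↦ Complex.exp (Complex.I * t y))
      ((τ.toContinuousLinearMap.comp (μ y)).smulRight (Complex.exp (Complex.I * t y) * Complex.I))
      y := by
    have h1 := (hasDerivAt_cexp_I_mul (t y) 1).hasFDerivAt.comp y (ht y hy)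
    simp only [mul_one] at h1
    exact h1
  obtain ⟨z, hz0, hz, hzs⟩ := exists_potential
    (f' := fun y ↦ Complex.exp (Complex.I * t y) • ζ.toContinuousLinearMap.comp (μ y))
    (y₀ := y₀) (r := r) (hexp.smul (contDiffOn_const.clm_comp hμ)) fun y hy u v ↦ by
      rw [((hexpd y hy).fun_smul (hcomp ζ.toContinuousLinearMap y hy)).fderiv]
      change Complex.exp (Complex.I * t y) * ζ (fderiv ℝ μ y u v) +
        ((τ (μ y u) : ℝ) • (Complex.exp (Complex.I * t y) * Complex.I)) * ζ (μ y v) =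
        Complex.exp (Complex.I * t y) * ζ (fderiv ℝ μ y v u) +
        ((τ (μ y v) : ℝ) • (Complex.exp (Complex.I * t y) * Complex.I)) * ζ (μ y u)
      have h1 : ζ (fderiv ℝ μ y u v) = ζ (fderiv ℝ μ y v u) -
          Complex.I * (τ (μ y u) * ζ (μ y v) - τ (μ y v) * ζ (μ y u)) := by
        rw [← h.map_lieBr_fst, ← map_sub, sub_eq_add_neg _ (lieBr G _ _), ← hMC y hy]
        congr 1
        abel
      rw [h1, Complex.real_smul, Complex.real_smul]
      ring
  exact ⟨t, z, ht0, hz0, ht, hz, hts, hzs⟩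

end Potentials

/-! ### The group law in the integrated coordinates. -/

section Functions

variable {E : Type*} [NormedAddCommGroup E] [NormedSpace ℝ E] [FiniteDimensional ℝ E]
  {G : Type*} [TopologicalSpace G] [ChartedSpace E G] [Group G] [LieGroup 𝓘(ℝ, E) ∞ G]

variable (E G) in
/-- The neighbourhood of `1` given by a ball in the chart at `1`. -/
def chartBall (r : ℝ) : Set G :=
  (extChartAt 𝓘(ℝ, E) (1 : G)).source ∩
    extChartAt 𝓘(ℝ, E) (1 : G) ⁻¹' Metric.ball (extChartAt 𝓘(ℝ, E) (1 : G) 1) r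

lemma isOpen_chartBall (r : ℝ) : IsOpen (chartBall E G r) :=
  (continuousOn_extChartAt (I := 𝓘(ℝ, E)) (1 : G)).isOpen_inter_preimage
    (isOpen_extChartAt_source 1) Metric.isOpen_ball

lemma one_mem_chartBall {r : ℝ} (hr : 0 < r) : (1 : G) ∈ chartBall E G r :=
  ⟨mem_extChartAt_source 1, Metric.mem_ball_self hr⟩

lemma exists_ball_subset_target : ∃ r > 0,
    Metric.ball (extChartAt 𝓘(ℝ, E) (1 : G) 1) r ⊆ (extChartAt 𝓘(ℝ, E) (1 : G)).target :=
  Metric.isOpen_iff.1 (isOpen_extChartAt_target (I := 𝓘(ℝ, E)) (1 : G)) _ (mem_extChartAt_target 1)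

lemma exists_chartBall_subset {U : Set G} (hU : U ∈ 𝓝 (1 : G)) : ∃ r > 0, chartBall E G r ⊆ U := by
  have hc := continuousAt_extChartAt_symm (I := 𝓘(ℝ, E)) (1 : G)
  have h1 : U ∈ 𝓝 ((extChartAt 𝓘(ℝ, E) (1 : G)).symm (extChartAt 𝓘(ℝ, E) (1 : G) 1)) := by
    rwa [extChartAt_to_inv]
  obtain ⟨r, hr, h⟩ := Metric.mem_nhds_iff.1 (hc.preimage_mem_nhds h1)
  refine ⟨r, hr, fun q hq ↦ ?_⟩
  have := h hq.2
  rwa [Set.mem_preimage, (extChartAt 𝓘(ℝ, E) (1 : G)).left_inv hq.1] at this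

/-- A small ball can be multiplied with itself within a given ball. -/
lemma exists_chartBall_mul_subset {r : ℝ} (hr : 0 < r) : ∃ r' > 0, r' ≤ r ∧
    ∀ a ∈ chartBall E G r', ∀ b ∈ chartBall E G r', a * b ∈ chartBall E G r := by
  have hc : ContinuousAt (fun p : G × G ↦ p.1 * p.2) (1, 1) :=
    (contMDiff_mul 𝓘(ℝ, E) ∞).continuous.continuousAt
  have h1 : chartBall E G r ∈ 𝓝 ((1 : G) * 1) := by
    rw [mul_one]
    exact (isOpen_chartBall r).mem_nhds (one_mem_chartBall hr)
  have h2 := hc.preimage_mem_nhds h1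
  rw [nhds_prod_eq, Filter.mem_prod_iff] at h2
  obtain ⟨U, hU, V, hV, hUV⟩ := h2
  obtain ⟨ρ, hρ, hρU⟩ := exists_chartBall_subset (E := E) (Filter.inter_mem hU hV)
  refine ⟨min ρ r, lt_min hρ hr, min_le_right _ _, fun a ha b hb ↦ ?_⟩
  have hsub : chartBall E G (min ρ r) ⊆ chartBall E G ρ := fun q hq ↦
    ⟨hq.1, Metric.ball_subset_ball (min_le_left _ _) hq.2⟩
  exact hUV (Set.mk_mem_prod (hρU (hsub ha)).1 (hρU (hsub hb)).2)

lemma eq_of_mvfderiv_eq_zero {V : Type*} [NormedAddCommGroup V] [NormedSpace ℝ V] {r : ℝ}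
    (hr : Metric.ball (extChartAt 𝓘(ℝ, E) (1 : G) 1) r ⊆ (extChartAt 𝓘(ℝ, E) (1 : G)).target)
    {f : G → V} (hf : ∀ q ∈ chartBall E G r, MDifferentiableAt 𝓘(ℝ, E) 𝓘(ℝ, V) f q ∧
      ∀ w, mvfderiv 𝓘(ℝ, E) f q w = 0) {q : G} (hq : q ∈ chartBall E G r) : f q = f 1 := by
  have hσ (y : E) (hy : y ∈ Metric.ball (extChartAt 𝓘(ℝ, E) (1 : G) 1) r) :
      (extChartAt 𝓘(ℝ, E) (1 : G)).symm y ∈ chartBall E G r :=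
    ⟨(extChartAt 𝓘(ℝ, E) (1 : G)).map_target (hr hy), by
      rwa [Set.mem_preimage, (extChartAt 𝓘(ℝ, E) (1 : G)).right_inv (hr hy)]⟩
  have hmd (y : E) (hy : y ∈ Metric.ball (extChartAt 𝓘(ℝ, E) (1 : G) 1) r) :
      MDifferentiableAt 𝓘(ℝ, E) 𝓘(ℝ, E) (extChartAt 𝓘(ℝ, E) (1 : G)).symm y :=
    (contMDiffAt_extChartAt_symm (1 : G) (hr hy)).mdifferentiableAt (by simp)
  have h1 : Set.EqOn (fderiv ℝ (f ∘ (extChartAt 𝓘(ℝ, E) (1 : G)).symm)) 0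
      (Metric.ball (extChartAt 𝓘(ℝ, E) (1 : G) 1) r) := fun y hy ↦ by
    ext u
    rw [← mvfderiv_apply_mfderiv (hf _ (hσ y hy)).1 (hmd y hy)]
    exact (hf _ (hσ y hy)).2 _
  have h2 : DifferentiableOn ℝ (f ∘ (extChartAt 𝓘(ℝ, E) (1 : G)).symm)
      (Metric.ball (extChartAt 𝓘(ℝ, E) (1 : G) 1) r) := fun y hy ↦
    (MDifferentiableAt.comp (I' := 𝓘(ℝ, E)) y (hf _ (hσ y hy)).1
      (hmd y hy)).differentiableAt.differentiableWithinAt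
  have h3 := Metric.isOpen_ball.is_const_of_fderiv_eq_zero (convex_ball _ r).isPreconnected h2 h1
    hq.2 (Metric.mem_ball_self (Metric.nonempty_ball.1 ⟨_, hq.2⟩))
  rw [Function.comp_apply, Function.comp_apply, (extChartAt 𝓘(ℝ, E) (1 : G)).left_inv hq.1,
    extChartAt_to_inv] at h3
  exact h3

lemma mcChart_mfderiv {q : G} (hq : q ∈ (extChartAt 𝓘(ℝ, E) (1 : G)).source)
    (w : TangentSpace 𝓘(ℝ, E) q) :
    mcChart G (extChartAt 𝓘(ℝ, E) (1 : G) q)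
      (mfderiv 𝓘(ℝ, E) 𝓘(ℝ, E) (extChartAt 𝓘(ℝ, E) (1 : G)) q w : E) = mcForm q w := by
  have h (p : G) (hp : p = q) (v : E) :
      mcForm p (coordField G v p) = mcForm q (coordField G v q) := by subst hp; rfl
  refine (mcChart_apply _ _).trans ((h _ ((extChartAt 𝓘(ℝ, E) (1 : G)).left_inv hq) _).trans ?_)
  exact congrArg (mcForm q) (coordField_mfderiv hq w)

/-- The derivative of a function given in the chart at `1`. -/
lemma mvfderiv_comp_chart {F : Type*} [NormedAddCommGroup F] [NormedSpace ℝ F] {f : E → F}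
    {T : E →L[ℝ] F} {q : G} (hq : q ∈ (extChartAt 𝓘(ℝ, E) (1 : G)).source)
    (hf : HasFDerivAt f (T.comp (mcChart G (extChartAt 𝓘(ℝ, E) (1 : G) q)))
      (extChartAt 𝓘(ℝ, E) (1 : G) q)) :
    MDifferentiableAt 𝓘(ℝ, E) 𝓘(ℝ, F) (fun q ↦ f (extChartAt 𝓘(ℝ, E) (1 : G) q)) q ∧
      ∀ w, mvfderiv 𝓘(ℝ, E) (fun q ↦ f (extChartAt 𝓘(ℝ, E) (1 : G) q)) q w = T (mcForm q w) := by
  have hκ := (contMDiffAt_chart hq).mdifferentiableAt (by simp)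
  have hfd := hf.differentiableAt.mdifferentiableAt
  refine ⟨MDifferentiableAt.comp (I' := 𝓘(ℝ, E)) q hfd hκ, fun w ↦ ?_⟩
  have h := mfderiv_comp (I := 𝓘(ℝ, E)) (I' := 𝓘(ℝ, E)) (I'' := 𝓘(ℝ, F)) q hfd hκ
  refine (congrArg (fun S : TangentSpace 𝓘(ℝ, E) q →L[ℝ] F ↦ S w) h).trans ?_
  rw [mfderiv_eq_fderiv, hf.fderiv, ← mcChart_mfderiv hq]
  rfl

/-- A function with left invariant derivative is additive near `1`. -/
lemma map_mul_of_mvfderiv_eq {r r' : ℝ}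
    (hr : Metric.ball (extChartAt 𝓘(ℝ, E) (1 : G) 1) r ⊆ (extChartAt 𝓘(ℝ, E) (1 : G)).target)
    (hr' : r' ≤ r)
    (hmul : ∀ a ∈ chartBall E G r', ∀ b ∈ chartBall E G r', a * b ∈ chartBall E G r)
    {V : Type*} [NormedAddCommGroup V] [NormedSpace ℝ V] {f : G → V} {S : V →L[ℝ] V} {a : G}
    (ha : a ∈ chartBall E G r') (hf : ∀ q ∈ chartBall E G r, MDifferentiableAt 𝓘(ℝ, E) 𝓘(ℝ, V) f q)
    (hf' : ∀ q ∈ chartBall E G r', ∀ w, mvfderiv 𝓘(ℝ, E) f (a * q)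
      (mfderiv 𝓘(ℝ, E) 𝓘(ℝ, E) (a * ·) q w) = S (mvfderiv 𝓘(ℝ, E) f q w))
    (hf1 : f 1 = 0) {q : G} (hq : q ∈ chartBall E G r') : f (a * q) = f a + S (f q) := by
  have hsub : chartBall E G r' ⊆ chartBall E G r := fun q hq ↦
    ⟨hq.1, Metric.ball_subset_ball hr' hq.2⟩
  -- `f (a * q) - S (f q)` has zero derivative on a ball, hence equals its value `f a` at 1.
  have key := eq_of_mvfderiv_eq_zero ((Metric.ball_subset_ball hr').trans hr)
    (f := fun q ↦ f (a * q) - S (f q)) (fun q hq ↦ ?_) hq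
  · simp only [mul_one, hf1, map_zero, sub_zero] at key
    exact sub_eq_iff_eq_add.1 key
  · have h1 : MDifferentiableAt 𝓘(ℝ, E) 𝓘(ℝ, V) (fun q ↦ f (a * q)) q :=
      MDifferentiableAt.comp (I' := 𝓘(ℝ, E)) q (hf _ (hmul a ha q hq))
        (mdifferentiableAt_mul_left a q)
    have h2 : MDifferentiableAt 𝓘(ℝ, E) 𝓘(ℝ, V) (fun q ↦ S (f q)) q :=
      MDifferentiableAt.comp (I' := 𝓘(ℝ, V)) q S.differentiableAt.mdifferentiableAt
        (hf q (hsub hq))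
    refine ⟨h1.sub h2, fun w ↦ ?_⟩
    rw [mvfderiv_fun_sub h1 h2, sub_apply, mvfderiv_comp_mul_left (hf _ (hmul a ha q hq)), hf' q hq,
      mvfderiv_clm_comp S (hf q (hsub hq)), sub_self]

/-- Existence of local coordinates on a Lie group whose Lie algebra embeds into that of the group
of motions of the plane. -/
lemma IsMotionCoordinates.exists_functions {ζ : E →ₗ[ℝ] ℂ} {τ : E →ₗ[ℝ] ℝ}
    (h : IsMotionCoordinates G ζ τ) : ∃ (r : ℝ) (t : E → ℝ) (z : E → ℂ), 0 < r ∧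
      Metric.ball (extChartAt 𝓘(ℝ, E) (1 : G) 1) r ⊆ (extChartAt 𝓘(ℝ, E) (1 : G)).target ∧
      ContDiffOn ℝ ∞ t (Metric.ball (extChartAt 𝓘(ℝ, E) (1 : G) 1) r) ∧
      ContDiffOn ℝ ∞ z (Metric.ball (extChartAt 𝓘(ℝ, E) (1 : G) 1) r) ∧
      t (extChartAt 𝓘(ℝ, E) (1 : G) 1) = 0 ∧ z (extChartAt 𝓘(ℝ, E) (1 : G) 1) = 0 ∧
      (∀ y ∈ Metric.ball (extChartAt 𝓘(ℝ, E) (1 : G) 1) r, ∀ u, fderiv ℝ t y u = 0 →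
        fderiv ℝ z y u = 0 → u = 0) ∧
      (∀ a ∈ chartBall E G r, ∀ b ∈ chartBall E G r,
        t (extChartAt 𝓘(ℝ, E) (1 : G) (a * b)) =
          t (extChartAt 𝓘(ℝ, E) (1 : G) a) + t (extChartAt 𝓘(ℝ, E) (1 : G) b)) ∧
      (∀ a ∈ chartBall E G r, ∀ b ∈ chartBall E G r,
        z (extChartAt 𝓘(ℝ, E) (1 : G) (a * b)) = z (extChartAt 𝓘(ℝ, E) (1 : G) a) +
          Complex.exp (Complex.I * t (extChartAt 𝓘(ℝ, E) (1 : G) a)) *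
            z (extChartAt 𝓘(ℝ, E) (1 : G) b)) := by
  obtain ⟨r, hr0, hr⟩ := exists_ball_subset_target (E := E) (G := G)
  obtain ⟨t, z, ht0, hz0, ht, hz, hts, hzs⟩ := h.exists_potentials (contDiffOn_mcChart.mono hr)
    fun y hy u v ↦ fderiv_mcChart (hr hy) u v
  -- The coordinates are known on the ball of radius `r`; the smaller radius keeps products inside
  -- it.
  obtain ⟨r', hr0', hr', hmul⟩ := exists_chartBall_mul_subset (E := E) (G := G) hr0
  have hsubE := Metric.ball_subset_ball (x := extChartAt 𝓘(ℝ, E) (1 : G) 1) hr'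
  have hsub : chartBall E G r' ⊆ chartBall E G r := fun q hq ↦ ⟨hq.1, hsubE hq.2⟩
  have hdt (q : G) (hq : q ∈ chartBall E G r) := mvfderiv_comp_chart hq.1 (ht _ hq.2)
  have hdz (q : G) (hq : q ∈ chartBall E G r) := by
    have := hz _ hq.2
    rw [← ContinuousLinearMap.smul_comp] at this
    exact mvfderiv_comp_chart hq.1 this
  have hadd (a : G) (ha : a ∈ chartBall E G r') (b : G) (hb : b ∈ chartBall E G r') :
      t (extChartAt 𝓘(ℝ, E) (1 : G) (a * b)) =
          t (extChartAt 𝓘(ℝ, E) (1 : G) a) + t (extChartAt 𝓘(ℝ, E) (1 : G) b) :=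
    map_mul_of_mvfderiv_eq (f := fun q ↦ t (extChartAt 𝓘(ℝ, E) (1 : G) q))
      (S := ContinuousLinearMap.id ℝ ℝ) hr hr' hmul ha (fun q hq ↦ (hdt q hq).1)
      (fun q hq w ↦ by
        rw [(hdt _ (hmul a ha q hq)).2, mcForm_mfderiv_mul, (hdt q (hsub hq)).2]
        rfl) ht0 hb
  refine ⟨r', t, z, hr0', hsubE.trans hr, hts.mono hsubE, hzs.mono hsubE, ht0, hz0, ?_, hadd, ?_⟩
  · intro y hy u hu hu'
    rw [(ht y (hsubE hy)).fderiv] at hu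
    rw [(hz y (hsubE hy)).fderiv] at hu'
    refine mcChart_eq_zero (hr (hsubE hy)) (h.eq_zero _ ?_ hu)
    exact (mul_eq_zero.1 hu').resolve_left (Complex.exp_ne_zero _)
  · intro a ha b hb
    refine map_mul_of_mvfderiv_eq (f := fun q ↦ z (extChartAt 𝓘(ℝ, E) (1 : G) q))
      (S := ContinuousLinearMap.mul ℝ ℂ
        (Complex.exp (Complex.I * t (extChartAt 𝓘(ℝ, E) (1 : G) a)))) hr hr' hmul ha
      (fun q hq ↦ (hdz q hq).1) (fun q hq w ↦ ?_) hz0 hb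
    -- The form dz is left invariant only up to exp(it); the additivity of `t` splits off the
    -- constant factor exp(i t(a)), which is `S`.
    rw [(hdz _ (hmul a ha q hq)).2, mcForm_mfderiv_mul, (hdz q (hsub hq)).2]
    change Complex.exp _ * ζ _ = Complex.exp _ * (Complex.exp _ * ζ _)
    rw [hadd a ha q hq, Complex.ofReal_add, mul_add, Complex.exp_add, mul_assoc]

end Functions

end

section


/-! ### Construction of the local isomorphism with E(2). -/

variable {E : Type*} [NormedAddCommGroup E] [NormedSpace ℝ E] [FiniteDimensional ℝ E]

/-- The inverse function theorem, for a smooth map with injective derivative between spaces of the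
same dimension. -/
lemma exists_openPartialHomeomorph {F : Type*} [NormedAddCommGroup F] [NormedSpace ℝ F]
    [FiniteDimensional ℝ F] (hEF : Module.finrank ℝ E = Module.finrank ℝ F) {f : E → F} {s : Set E}
    (hs : IsOpen s) (hf : ContDiffOn ℝ ∞ f s)
    (hinj : ∀ y ∈ s, ∀ u, fderiv ℝ f y u = 0 → u = 0) {y₀ : E} (hy₀ : y₀ ∈ s) :
    ∃ Φ : OpenPartialHomeomorph E F, y₀ ∈ Φ.source ∧ Φ.source ⊆ s ∧ (∀ y, Φ y = f y) ∧
      ContDiffOn ℝ ∞ Φ.symm Φ.target := by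
  have : CompleteSpace E := FiniteDimensional.complete ℝ E
  have hd (y : E) (hy : y ∈ s) : ∃ e : E ≃L[ℝ] F, HasFDerivAt f (e : E →L[ℝ] F) y := by
    refine ⟨(LinearEquiv.ofInjectiveOfFinrankEq (fderiv ℝ f y : E →ₗ[ℝ] F)
      ((injective_iff_map_eq_zero _).2 (hinj y hy)) hEF).toContinuousLinearEquiv, ?_⟩
    have := ((hf.contDiffAt (hs.mem_nhds hy)).differentiableAt (by simp)).hasFDerivAt
    refine this.congr_fderiv ?_
    ext u
    rfl
  have hc := hf.contDiffAt (hs.mem_nhds hy₀)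
  obtain ⟨e, he⟩ := hd y₀ hy₀
  set Φ := hc.toOpenPartialHomeomorph f he (by simp)
  have hΦ (y : E) : Φ y = f y := rfl
  -- Restricting to `s` keeps the derivative invertible throughout the source, so the inverse is
  -- smooth on the whole target and not only near the image of `y₀`.
  refine ⟨Φ.restrOpen s hs, ⟨hc.mem_toOpenPartialHomeomorph_source he (by simp), hy₀⟩,
    fun y hy ↦ hy.2, hΦ, fun p hp ↦ ContDiffAt.contDiffWithinAt ?_⟩
  have hq := (Φ.restrOpen s hs).map_target hp
  obtain ⟨e', he'⟩ := hd _ hq.2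
  exact (Φ.restrOpen s hs).contDiffAt_symm hp he' (hf.contDiffAt (hs.mem_nhds hq.2))

/-- As a total function `polar` is a homomorphism from ℂ ⋊ ℝ to E(2), so no bound on the angles is
needed. -/
lemma E2.polar_mul (z w : ℂ) (s t : ℝ) :
    polar (z + Complex.exp (Complex.I * t) * w, t + s) = polar (z, t) * polar (w, s) := by
  refine ext' ?_ ?_ ?_
  · change z + Complex.exp (Complex.I * t) * w = z + (Circle.exp t : ℂ) * signConj 1 w
    rw [Circle.coe_exp, mul_comm Complex.I, signConj, if_pos rfl]
  · change (Circle.exp (t + s) : ℂ) = (Circle.exp t * Circle.exp s ^ (((1 : ℤˣ)) : ℤ) : Circle)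
    rw [Units.val_one, zpow_one, Circle.exp_add]
  · exact (one_mul (1 : ℤˣ)).symm

variable {G : Type*} [TopologicalSpace G] [ChartedSpace E G] [Group G] [LieGroup 𝓘(ℝ, E) ∞ G]

/-- A Lie group whose Lie algebra is that of the group of motions of the plane is locally isomorphic
to that group. -/
theorem IsMotionCoordinates.locallyIsomorphic {ζ : E →ₗ[ℝ] ℂ} {τ : E →ₗ[ℝ] ℝ}
    (h : IsMotionCoordinates G ζ τ) (hE : 3 ≤ Module.finrank ℝ E) :
    LocallyIsomorphic 𝓘(ℝ, E) E2.model G E2 := by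
  have : IsManifold 𝓘(ℝ, E) ∞ G := inferInstance
  obtain ⟨r, t, z, hr0, hr, ht, hz, ht0, hz0, hinj, hadd, hmul⟩ := h.exists_functions
  have hball := Metric.mem_ball_self (x := extChartAt 𝓘(ℝ, E) (1 : G) 1) hr0
  have hsmooth : ContDiffOn ℝ ∞ (fun y ↦ (z y, t y))
      (Metric.ball (extChartAt 𝓘(ℝ, E) (1 : G) 1) r) := hz.prodMk ht
  obtain ⟨Φ, h1, hsub, hΦ, hsymm⟩ := exists_openPartialHomeomorph (F := ℂ × ℝ)
    (by
      have := h.finrank_le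
      rw [Module.finrank_prod, Complex.finrank_real_complex, Module.finrank_self]
      omega) Metric.isOpen_ball hsmooth
    (fun y hy u hu ↦ by
      have hy' := Metric.isOpen_ball.mem_nhds hy
      rw [((hz.contDiffAt hy').differentiableAt (by simp)).fderiv_prodMk
        ((ht.contDiffAt hy').differentiableAt (by simp))] at hu
      exact hinj y hy u (congrArg Prod.snd hu) (congrArg Prod.fst hu)) hball
  have hφ (x : G) : ((chartAt E (1 : G)).trans (Φ.trans E2.polar)) x =
      E2.polar (z (extChartAt 𝓘(ℝ, E) (1 : G) x), t (extChartAt 𝓘(ℝ, E) (1 : G) x)) :=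
    congrArg E2.polar (hΦ _)
  have hsource (x : G) (hx : x ∈ ((chartAt E (1 : G)).trans (Φ.trans E2.polar)).source) :
      x ∈ (chartAt E (1 : G)).source ∧ chartAt E (1 : G) x ∈ Φ.source := ⟨hx.1, hx.2.1⟩
  have hsource' (x : G) (hx : x ∈ ((chartAt E (1 : G)).trans (Φ.trans E2.polar)).source) :
      x ∈ chartBall E G r :=
    ⟨by rw [extChartAt_source]; exact hx.1, hsub hx.2.1⟩
  refine ⟨(chartAt E (1 : G)).trans (Φ.trans E2.polar), ?_, ?_, ?_, ?_⟩
  · refine ⟨mem_chart_source E (1 : G), h1, ?_⟩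
    change Φ (extChartAt 𝓘(ℝ, E) (1 : G) 1) ∈ E2.polar.source
    rw [hΦ, E2.polar_source, ht0]
    exact ⟨neg_lt_zero.2 Real.pi_pos, Real.pi_pos⟩
  · refine E2.contMDiff_polar.contMDiffOn.comp (t := Set.univ) ?_ (Set.subset_univ _)
    refine ContMDiffOn.comp (t := Φ.source) (I' := 𝓘(ℝ, E)) ?_
      ((contMDiffOn_chart (I := 𝓘(ℝ, E)) (x := (1 : G))).mono fun x hx ↦ (hsource x hx).1)
      fun x hx ↦ (hsource x hx).2
    exact ((hsmooth.mono hsub).congr fun y _ ↦ hΦ y).contMDiffOn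
  · refine (contMDiffOn_chart_symm (I := 𝓘(ℝ, E)) (x := (1 : G))).comp
      (t := (chartAt E (1 : G)).target) ?_ fun p hp ↦ hp.2
    exact hsymm.contMDiffOn.comp (E2.contMDiffOn_polar_symm.mono fun p hp ↦ hp.1.1)
      fun p hp ↦ hp.1.2
  · intro x hx y hy _
    rw [hφ, hφ, hφ, hadd x (hsource' x hx) y (hsource' y hy),
      hmul x (hsource' x hx) y (hsource' y hy), E2.polar_mul]

end

end ContactLie

end

theorem mainTheorem2
    {E : Type*} [NormedAddCommGroup E] [NormedSpace ℝ E] [FiniteDimensional ℝ E]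
    {G : Type*} [TopologicalSpace G] [ChartedSpace E G] [Group G] [LieGroup 𝓘(ℝ, E) ∞ G]
    (hG : ContactLie.HasLeftInvariantContactForm 𝓘(ℝ, E) G) :
    (5 ≤ Module.finrank ℝ E → ¬ ContactLie.HasFlatLeftInvariantMetric 𝓘(ℝ, E) G) ∧
    (3 ≤ Module.finrank ℝ E →
      (ContactLie.HasFlatLeftInvariantMetric 𝓘(ℝ, E) G ↔
        ContactLie.LocallyIsomorphic 𝓘(ℝ, E) ContactLie.E2.model G ContactLie.E2)) := by
  refine ⟨fun hE hf ↦ ?_, fun hE ↦ ⟨fun hf ↦ ?_, fun hl ↦ ?_⟩⟩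
  -- The embedding into the 3-dimensional algebra of motions contradicts dimension at least 5.
  · obtain ⟨ζ, τ, h⟩ := ContactLie.exists_isMotionCoordinates hG hf (by omega)
    have := h.finrank_le
    omega
  · obtain ⟨ζ, τ, h⟩ := ContactLie.exists_isMotionCoordinates hG hf (by omega)
    exact h.locallyIsomorphic hE
  · obtain ⟨ζ, τ, h⟩ := hl.exists_isMotionCoordinates
    exact h.hasFlatLeftInvariantMetric hE
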